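/- Let $N\ge 2$, $L\ge 1$, $\varepsilon=e^{2\pi i/N}$, $\gamma=\mathrm{diag}(1,\varepsilon^{-1},\dots,\varepsilon^{1-N})$, $\mathfrak g=sl_N(\mathbb C)$ with $(A|B)=\mathrm{tr}(AB)$. Let the cyclic group $C_N$ act on $\mathbb P^1$ by $t\mapsto\varepsilon t$, and let $Q_1,\dots,Q_L$ be distinct points of $\mathbb P^1/C_N$ other than $0,\infty$, represented by $z_1,\dots,z_L\in\mathbb C^\times$ (so $z_i^N\neq z_j^N$ for $i\ne j$). At each $Q_i$ consider the affine Lie algebra $\hat{\mathfrak g}^{Q_i}=sl_N(\mathbb C((t-z_i)))\oplus\mathbb C\hat k$ with cocycle $\mathrm{Res}_{t=z_i}(dA|B)$. At $0$ let $\hat{\mathfrak g}^{(0)}=\{A\in sl_N(\mathbb C((t))): A(\varepsilon t)=\gamma A(t)\gamma^{-1}\}\oplus\mathbb C\hat k$ with cocycle $\frac1N\mathrm{Res}_{t=0}(dA|B)$, and at $\infty$, with $s=1/t$, let $\hat{\mathfrak g}^{(\infty)}=\{A\in sl_N(\mathbb C((s))): A(\varepsilon^{-1}s)=\gamma A(s)\gamma^{-1}\}\oplus\mathbb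 C\hat k$ with cocycle $\frac1N\mathrm{Res}_{s=0}(dA|B)$. The latter two are (completed) affine Lie algebras of type $A^{(1)}_{N-1}$ with Cartan subalgebra $\mathfrak h\oplus\mathbb C\hat k$ ($\mathfrak h$ = constant traceless diagonal matrices) and simple coroots $$\alpha_i^\vee=\pm(E_{i,i}-E_{i+1,i+1})+\hat k/N\ (1\le i\le N-1),\qquad \alpha_0^\vee=\pm(E_{N,N}-E_{1,1})+\hat k/N,$$ with sign $+$ at $0$ and $-$ at $\infty$. For $*\in\{0,\infty\}$, a weight $\mu$ is a linear functional on $\mathfrak h\oplus\mathbb C\hat k$; its level is $\mu(\hat k)$, and it is dominant integral if $\mu(\alpha_i^\vee)\in\mathbb Z_{\ge0}$ for $0\le i\le N-1$. The Verma module $M^{(*)}_\mu$ is the universal $\hat{\mathfrak g}^{(*)}$-module generated by a vector annihilated by all elements with only positive powers of $t$ (for $*=0$), resp. $s$ (for $*=\infty$), on which $\mathfrak h\oplus\mathbb C\hat k$ acts by $\mu$. For dominant integral $\mu$, $L^{(*)}_\mu$ denotes its irreducible quotient (the quotient by the largest proper submodule). Let $\mathfrak g_{out}^{orb}$ be the Lie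 algebra of $\mathfrak g$-valued rational functions $f(t)$ on $\mathbb P^1$ with $f(\varepsilon t)=\gamma f(t)\gamma^{-1}$ whose poles lie over $\{0,Q_1,\dots,Q_L,\infty\}$. It acts on a tensor product $M_0\otimes M\otimes M_\infty$, $M=\bigotimes_{i=1}^L M_i$, of modules of a common level over $\hat{\mathfrak g}^{(0)},\hat{\mathfrak g}^{Q_i},\hat{\mathfrak g}^{(\infty)}$ by the sum of the actions of its Laurent expansions at $0$, $z_i$, $\infty$. The space of orbifold conformal coinvariants is $$CC_{orb}(M_0\otimes M\otimes M_\infty)=(M_0\otimes M\otimes M_\infty)/\mathfrak g_{out}^{orb}(M_0\otimes M\otimes M_\infty).$$ **Proposition.** Let $k\in\mathbb C$. Assume that each $M_i$ is an integrable highest weight $\hat{\mathfrak g}^{Q_i}$-module of level $k$, and let $\mu_0,\mu_\infty$ be weights of $\hat{\mathfrak g}^{(0)},\hat{\mathfrak g}^{(\infty)}$ of level $k$. Then: 1. $CC_{orb}(M^{(0)}_{\mu_0}\otimes M\otimes M^{(\infty)}_{\mu_\infty})=0$ unless $\mu_0$ and $\mu_\infty$ are both dominant integral. 2. If $\mu_0$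 and $\mu_\infty$ are dominant integral, the canonical projections induce a linear isomorphism $$CC_{orb}(M^{(0)}_{\mu_0}\otimes M\otimes M^{(\infty)}_{\mu_\infty})\cong CC_{orb}(L^{(0)}_{\mu_0}\otimes M\otimes L^{(\infty)}_{\mu_\infty}).$$ -/

import Mathlib

open scoped TensorProduct

noncomputable section

namespace OrbifoldWZW

/-! ### Laurent series -/

/-- The field `ℂ((ξ))`. -/
abbrev Laurent : Type := LaurentSeries ℂ

/-- The coefficientwise `ℂ`-algebra structure; it takes precedence over the (propositionally
equal) structure through formal power series. -/
instance instAlgebraLaurent : Algebra ℂ Laurent := HahnSeries.instAlgebra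

instance : SMulCommClass ℂ Laurent Laurent :=
  @Algebra.to_smulCommClass ℂ Laurent _ _ instAlgebraLaurent

instance : IsScalarTower ℂ Laurent Laurent :=
  @IsScalarTower.right ℂ Laurent _ _ instAlgebraLaurent

instance {n : Type*} [Fintype n] [DecidableEq n] :
    SMulCommClass ℂ (Matrix n n Laurent) (Matrix n n Laurent) :=
  @Algebra.to_smulCommClass ℂ (Matrix n n Laurent) _ _ _

instance {n : Type*} [Fintype n] [DecidableEq n] :
    IsScalarTower ℂ (Matrix n n Laurent) (Matrix n n Laurent) :=
  @IsScalarTower.right ℂ (Matrix n n Laurent) _ _ _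

@[simp] theorem algebraMap_laurent (c : ℂ) :
    algebraMap ℂ Laurent c = HahnSeries.single 0 c := rfl

theorem coeff_derivative (f : Laurent) (n : ℤ) :
    (LaurentSeries.derivative ℂ f).coeff n = ((n : ℂ) + 1) * f.coeff (n + 1) := by
  simp [LaurentSeries.derivative_apply]

/-- The Euler operator `ξ d/dξ`. -/
def euler (f : Laurent) : Laurent where
  coeff m := (m : ℂ) * f.coeff m
  isPWO_support' := f.isPWO_support.mono fun m hm => by
    simp only [Function.mem_support, HahnSeries.mem_support] at hm ⊢
    exact right_ne_zero_of_mul hm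

theorem euler_support (f : Laurent) : (euler f).support ⊆ f.support := fun m hm => by
  simp only [HahnSeries.mem_support, euler] at hm ⊢
  exact right_ne_zero_of_mul hm

theorem euler_mul (f g : Laurent) : euler (f * g) = euler f * g + f * euler g := by
  ext m
  rw [HahnSeries.coeff_add, HahnSeries.coeff_mul_left' f.isPWO_support (euler_support f),
    HahnSeries.coeff_mul_right' g.isPWO_support (euler_support g), ← Finset.sum_add_distrib]
  change (m : ℂ) * (f * g).coeff m = _
  rw [HahnSeries.coeff_mul, Finset.mul_sum]
  refine Finset.sum_congr rfl fun ij hij => ?_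
  have h : ij.1 + ij.2 = m := (Finset.mem_antidiagonal.mp hij).2.2
  have h' : (m : ℂ) = ij.1 + ij.2 := by rw [← h]; push_cast; ring
  simp only [euler, h']
  ring

theorem derivative_eq_euler (f : Laurent) :
    LaurentSeries.derivative ℂ f = HahnSeries.single (-1) 1 * euler f := by
  ext m
  rw [coeff_derivative]
  have h := HahnSeries.coeff_single_mul_add (r := (1 : ℂ)) (x := euler f) (a := m + 1) (b := -1)
  rw [show m + 1 + -1 = m by ring] at h
  rw [h]
  simp [euler]

theorem derivative_mul (f g : Laurent) :
    LaurentSeries.derivative ℂ (f * g) =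
      LaurentSeries.derivative ℂ f * g + f * LaurentSeries.derivative ℂ g := by
  simp only [derivative_eq_euler, euler_mul]
  ring

/-- The substitution `ξ ↦ ζ ξ` on Laurent series. -/
def scale (ζ : ℂˣ) : Laurent →ₐ[ℂ] Laurent :=
  AlgHom.ofLinearMap
    { toFun := fun f =>
        { coeff := fun m => ((ζ ^ m : ℂˣ) : ℂ) * f.coeff m
          isPWO_support' := f.isPWO_support.mono fun m hm => by
            simp only [Function.mem_support, HahnSeries.mem_support] at hm ⊢
            exact right_ne_zero_of_mul hm }
      map_add' := fun f g => by ext m; simp [mul_add]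
      map_smul' := fun c f => by ext m; simp; ring }
    (by
      ext m
      by_cases hm : m = 0
      · simp [hm]
      · simp [hm, HahnSeries.coeff_one])
    (fun f g => by
      have hs : ∀ f : Laurent, HahnSeries.support (Γ := ℤ) (R := ℂ)
          { coeff := fun m => ((ζ ^ m : ℂˣ) : ℂ) * f.coeff m
            isPWO_support' := f.isPWO_support.mono fun m hm => by
              simp only [Function.mem_support, HahnSeries.mem_support] at hm ⊢
              exact right_ne_zero_of_mul hm } ⊆ f.support := fun f m hm => by
        simp only [HahnSeries.mem_support] at hm ⊢
        exact right_ne_zero_of_mul hm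
      have hs' : ∀ f : Laurent, f.support ⊆ HahnSeries.support (Γ := ℤ) (R := ℂ)
          { coeff := fun m => ((ζ ^ m : ℂˣ) : ℂ) * f.coeff m
            isPWO_support' := f.isPWO_support.mono fun m hm => by
              simp only [Function.mem_support, HahnSeries.mem_support] at hm ⊢
              exact right_ne_zero_of_mul hm } := fun f m hm => by
        simp only [HahnSeries.mem_support] at hm ⊢
        exact mul_ne_zero (Units.ne_zero _) hm
      have hss := fun f => Set.Subset.antisymm (hs f) (hs' f)
      ext m
      simp only [LinearMap.coe_mk, AddHom.coe_mk]
      rw [HahnSeries.coeff_mul, HahnSeries.coeff_mul, Finset.mul_sum]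
      refine Finset.sum_congr (by ext x; simp only [Finset.mem_antidiagonal, hss]) ?_
      intro ij hij
      have h : ij.1 + ij.2 = m := (Finset.mem_antidiagonal.mp hij).2.2
      subst h
      rw [zpow_add]
      push_cast
      ring)

@[simp] theorem coeff_scale (ζ : ℂˣ) (f : Laurent) (m : ℤ) :
    (scale ζ f).coeff m = ((ζ ^ m : ℂˣ) : ℂ) * f.coeff m := rfl

/-! ### Rational functions and their expansions -/

/-- The substitution `t ↦ a` in rational functions of `t`, for `a` transcendental over `ℂ`. -/
def subst {E : Type} [Field E] [Algebra ℂ E] (a : E) (ha : Transcendental ℂ a) :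
    RatFunc ℂ →ₐ[ℂ] E :=
  RatFunc.liftAlgHom (Polynomial.aeval a)
    (nonZeroDivisors_le_comap_nonZeroDivisors_of_injective _
      (transcendental_iff_injective.mp ha))

@[simp] theorem subst_X {E : Type} [Field E] [Algebra ℂ E] (a : E) (ha : Transcendental ℂ a) :
    subst a ha RatFunc.X = a := by
  have h := RatFunc.liftAlgHom_apply_div' (Polynomial.aeval a)
    (nonZeroDivisors_le_comap_nonZeroDivisors_of_injective _
      (transcendental_iff_injective.mp ha)) Polynomial.X (1 : Polynomial ℂ)
  simpa [subst] using h

theorem ratFunc_algHom_ext {E : Type} [Field E] [Algebra ℂ E] {φ ψ : RatFunc ℂ →ₐ[ℂ] E}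
    (h : φ RatFunc.X = ψ RatFunc.X) : φ = ψ := by
  have hp : ∀ p : Polynomial ℂ, φ (algebraMap _ _ p) = ψ (algebraMap _ _ p) := fun p => by
    have : φ.comp (IsScalarTower.toAlgHom ℂ (Polynomial ℂ) (RatFunc ℂ)) =
        ψ.comp (IsScalarTower.toAlgHom ℂ (Polynomial ℂ) (RatFunc ℂ)) := by
      apply Polynomial.algHom_ext
      simpa using h
    exact DFunLike.congr_fun this p
  ext x
  rw [← RatFunc.num_div_denom x, map_div₀, map_div₀, hp, hp]

theorem transcendental_of_coeff {a : Laurent} {m : ℤ} (hm : m ≠ 0) (ha : a.coeff m ≠ 0) :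
    Transcendental ℂ a := by
  intro halg
  have hi : IsIntegral ℂ a := halg.isIntegral
  obtain ⟨c, rfl⟩ := minpoly.mem_range_of_degree_eq_one ℂ a
    (IsAlgClosed.degree_eq_one_of_irreducible ℂ (minpoly.irreducible hi))
  exact ha (by simp [HahnSeries.coeff_single_of_ne hm])

/-- Laurent expansion of a rational function of `t` at the point `z ∈ ℂ`, in the local
coordinate `ξ = t - z`. -/
def expandAt (z : ℂ) : RatFunc ℂ →ₐ[ℂ] Laurent :=
  subst (algebraMap ℂ Laurent z + HahnSeries.single 1 1)
    (transcendental_of_coeff one_ne_zero (by simp))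

theorem expandAt_X (z : ℂ) :
    expandAt z RatFunc.X = algebraMap ℂ Laurent z + HahnSeries.single 1 1 :=
  subst_X _ _

/-- Laurent expansion of a rational function of `t` at `∞`, in the local coordinate
`s = 1 / t`. -/
def expandInfty : RatFunc ℂ →ₐ[ℂ] Laurent :=
  subst (HahnSeries.single (-1) 1)
    (transcendental_of_coeff (m := -1) (by norm_num) (by simp))

theorem expandInfty_X : expandInfty RatFunc.X = HahnSeries.single (-1) 1 :=
  subst_X _ _

/-! ### The automorphism `Ad γ` -/

/-- The primitive root of unity `ε = exp (2πi/N)`. -/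
def eps (N : ℕ) : ℂˣ :=
  Units.mk0 (Complex.exp (2 * Real.pi * Complex.I / N)) (Complex.exp_ne_zero _)

/-- The matrix `γ = diag (1, ε⁻¹, …, ε^(1-N))`. -/
def gamma (N : ℕ) : Matrix (Fin N) (Fin N) ℂ :=
  Matrix.diagonal fun p => ((eps N ^ (-(p : ℤ)) : ℂˣ) : ℂ)

theorem isUnit_det_gamma (N : ℕ) : IsUnit (gamma N).det := by
  rw [gamma, Matrix.det_diagonal]
  exact (Finset.prod_ne_zero_iff.mpr fun p _ => Units.ne_zero _).isUnit

theorem inv_gamma (N : ℕ) :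
    (gamma N)⁻¹ = Matrix.diagonal fun p : Fin N => ((eps N ^ (p : ℤ) : ℂˣ) : ℂ) := by
  refine Matrix.inv_eq_left_inv ?_
  rw [gamma, Matrix.diagonal_mul_diagonal, ← Matrix.diagonal_one]
  congr 1
  ext p
  rw [← Units.val_mul, ← zpow_add]
  simp

section Ad

variable {N : ℕ} {R S : Type} [CommRing R] [Algebra ℂ R] [CommRing S] [Algebra ℂ S]

/-- `Ad γ (A) = γ A γ⁻¹` for matrices over a commutative `ℂ`-algebra. -/
def adGamma (A : Matrix (Fin N) (Fin N) R) : Matrix (Fin N) (Fin N) R :=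
  (gamma N).map (algebraMap ℂ R) * A * ((gamma N)⁻¹).map (algebraMap ℂ R)

theorem adGamma_apply (A : Matrix (Fin N) (Fin N) R) (p q : Fin N) :
    adGamma A p q = algebraMap ℂ R ((eps N ^ ((q : ℤ) - p) : ℂˣ) : ℂ) * A p q := by
  rw [adGamma, inv_gamma, gamma, Matrix.diagonal_map (by simp), Matrix.diagonal_map (by simp),
    Matrix.mul_diagonal, Matrix.diagonal_mul, sub_eq_add_neg, zpow_add, Units.val_mul, map_mul]
  ring

theorem adGamma_add (A B : Matrix (Fin N) (Fin N) R) :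
    adGamma (A + B) = adGamma A + adGamma B := by
  simp [adGamma, mul_add, add_mul]

theorem adGamma_sub (A B : Matrix (Fin N) (Fin N) R) :
    adGamma (A - B) = adGamma A - adGamma B := by
  simp [adGamma, mul_sub, sub_mul]

theorem adGamma_zero : adGamma (0 : Matrix (Fin N) (Fin N) R) = 0 := by simp [adGamma]

theorem adGamma_smul (c : ℂ) (A : Matrix (Fin N) (Fin N) R) :
    adGamma (c • A) = c • adGamma A := by
  simp [adGamma]

theorem adGamma_mul (A B : Matrix (Fin N) (Fin N) R) :
    adGamma (A * B) = adGamma A * adGamma B := by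
  ext p q
  rw [adGamma_apply, Matrix.mul_apply, Matrix.mul_apply, Finset.mul_sum]
  refine Finset.sum_congr rfl fun r _ => ?_
  rw [adGamma_apply, adGamma_apply,
    show (q : ℤ) - p = ((r : ℤ) - p) + ((q : ℤ) - r) by ring, zpow_add, Units.val_mul, map_mul]
  ring

theorem map_adGamma (φ : R →ₐ[ℂ] S) (A : Matrix (Fin N) (Fin N) R) :
    (adGamma A).map φ = adGamma (A.map φ) := by
  ext p q
  simp [adGamma_apply]

end Ad

/-! ### Loop algebras -/

attribute [local instance] LieRing.ofAssociativeRing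

/-- The (untwisted) loop algebra `sl_N(ℂ((ξ)))`. -/
def loop (N : ℕ) : LieSubalgebra ℂ (Matrix (Fin N) (Fin N) Laurent) where
  carrier := {A | A.trace = 0}
  add_mem' {A B} hA hB := by
    simp only [Set.mem_ofPred_eq] at hA hB ⊢
    rw [Matrix.trace_add, hA, hB, add_zero]
  zero_mem' := Matrix.trace_zero _ _
  smul_mem' c A hA := by
    simp only [Set.mem_ofPred_eq] at hA ⊢
    rw [Matrix.trace_smul, hA, smul_zero]
  lie_mem' {A B} _ _ := by
    simp only [Set.mem_ofPred_eq, LieRing.of_associative_ring_bracket, Matrix.trace_sub]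
    rw [Matrix.trace_mul_comm, sub_self]

/-- The twisted loop algebra of all `A ∈ sl_N(ℂ((ξ)))` with `A(ζ ξ) = Ad γ (A(ξ))`. -/
def twistedLoop (N : ℕ) (ζ : ℂˣ) : LieSubalgebra ℂ (Matrix (Fin N) (Fin N) Laurent) where
  carrier := {A | A.trace = 0 ∧ A.map (scale ζ) = adGamma A}
  add_mem' {A B} hA hB :=
    ⟨(loop N).add_mem hA.1 hB.1, by
      rw [Matrix.map_add _ (map_add _), hA.2, hB.2, adGamma_add]⟩
  zero_mem' := ⟨(loop N).zero_mem, by rw [Matrix.map_zero _ (map_zero _), adGamma_zero]⟩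
  smul_mem' c A hA :=
    ⟨(loop N).smul_mem c hA.1, by
      rw [Matrix.map_smul _ _ (fun a => map_smul _ _ a), hA.2, adGamma_smul]⟩
  lie_mem' {A B} hA hB :=
    ⟨(loop N).lie_mem hA.1 hB.1, by
      rw [LieRing.of_associative_ring_bracket, Matrix.map_sub _ (map_sub _), Matrix.map_mul,
        Matrix.map_mul, hA.2, hB.2, adGamma_sub, adGamma_mul, adGamma_mul]⟩

/-! ### Central extensions -/

section Cocycle

variable {N : ℕ}

/-- The residue `Res (dA | B)`, where `(X | Y) = tr (X Y)`. -/
def resPairing (A B : Matrix (Fin N) (Fin N) Laurent) : ℂ :=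
  (A.map (LaurentSeries.derivative ℂ) * B).trace.coeff (-1)

theorem resPairing_add_left (A A' B : Matrix (Fin N) (Fin N) Laurent) :
    resPairing (A + A') B = resPairing A B + resPairing A' B := by
  simp [resPairing, Matrix.map_add _ (map_add _), add_mul]

theorem resPairing_add_right (A B B' : Matrix (Fin N) (Fin N) Laurent) :
    resPairing A (B + B') = resPairing A B + resPairing A B' := by
  simp [resPairing, mul_add]

theorem resPairing_smul_right (c : ℂ) (A B : Matrix (Fin N) (Fin N) Laurent) :
    resPairing A (c • B) = c * resPairing A B := by
  have h : A.map (LaurentSeries.derivative ℂ) * c • B =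
      c • (A.map (LaurentSeries.derivative ℂ) * B) := mul_smul_comm _ _ _
  rw [resPairing, h, Matrix.trace_smul, HahnSeries.coeff_smul, smul_eq_mul]
  rfl

theorem resPairing_sub_right (A B B' : Matrix (Fin N) (Fin N) Laurent) :
    resPairing A (B - B') = resPairing A B - resPairing A B' := by
  simp [resPairing, mul_sub]

theorem map_derivative_mul (A B : Matrix (Fin N) (Fin N) Laurent) :
    (A * B).map (LaurentSeries.derivative ℂ) =
      A.map (LaurentSeries.derivative ℂ) * B + A * B.map (LaurentSeries.derivative ℂ) := by
  ext1 p q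
  simp only [Matrix.map_apply, Matrix.mul_apply, Matrix.add_apply, map_sum, derivative_mul,
    Finset.sum_add_distrib]

theorem coeff_trace_derivative (A : Matrix (Fin N) (Fin N) Laurent) :
    (A.map (LaurentSeries.derivative ℂ)).trace.coeff (-1) = 0 := by
  simp only [Matrix.trace, Matrix.diag_apply, Matrix.map_apply, HahnSeries.coeff_sum]
  exact Finset.sum_eq_zero fun p _ => by rw [coeff_derivative]; simp

theorem resPairing_swap (A B : Matrix (Fin N) (Fin N) Laurent) :
    resPairing A B = - resPairing B A := by
  have h := coeff_trace_derivative (A * B)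
  rw [map_derivative_mul, Matrix.trace_add, HahnSeries.coeff_add,
    Matrix.trace_mul_comm A] at h
  exact eq_neg_of_add_eq_zero_left h

theorem resPairing_self (A : Matrix (Fin N) (Fin N) Laurent) : resPairing A A = 0 :=
  self_eq_neg.mp (resPairing_swap A A)

theorem resPairing_leibniz (A B C : Matrix (Fin N) (Fin N) Laurent) :
    resPairing A ⁅B, C⁆ = resPairing ⁅A, B⁆ C + resPairing B ⁅A, C⁆ := by
  rw [resPairing_swap ⁅A, B⁆ C]
  simp only [LieRing.of_associative_ring_bracket, resPairing_sub_right]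
  have h : ∀ X Y Z : Matrix (Fin N) (Fin N) Laurent,
      resPairing X (Y * Z) + resPairing Y (Z * X) + resPairing Z (X * Y) = 0 := by
    intro X Y Z
    have h0 := coeff_trace_derivative (X * Y * Z)
    rw [map_derivative_mul, map_derivative_mul, add_mul, Matrix.trace_add, Matrix.trace_add,
      HahnSeries.coeff_add, HahnSeries.coeff_add, mul_assoc,
      Matrix.trace_mul_comm (X * Y) (Z.map _), mul_assoc X,
      Matrix.trace_mul_comm X (_ * Z), mul_assoc] at h0
    exact h0
  have h1 := h A B C
  have h2 := h A C B
  linear_combination h1 - h2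

end Cocycle

section Aff

variable {N : ℕ}

/-- The central extension `K ⊕ ℂ k̂` of a Lie algebra `K` of matrices of Laurent series, with
cocycle `c · Res (dA | B)`. -/
def Aff (K : LieSubalgebra ℂ (Matrix (Fin N) (Fin N) Laurent)) (_c : ℂ) : Type := K × ℂ

variable (K : LieSubalgebra ℂ (Matrix (Fin N) (Fin N) Laurent)) (c : ℂ)

instance : AddCommGroup (Aff K c) := inferInstanceAs (AddCommGroup (K × ℂ))

instance : Module ℂ (Aff K c) := inferInstanceAs (Module ℂ (K × ℂ))

/-- `[A + a k̂, B + b k̂] = [A, B] + c · Res (dA | B) k̂`. -/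
instance : Bracket (Aff K c) (Aff K c) where
  bracket x y := (⁅x.1, y.1⁆, c * resPairing x.1.1 y.1.1)

instance : LieRing (Aff K c) where
  add_lie x y z := Prod.ext (add_lie x.1 y.1 z.1) (by
    change c * resPairing (x.1.1 + y.1.1) z.1.1 = c * resPairing x.1.1 z.1.1 + c * resPairing y.1.1 z.1.1
    rw [resPairing_add_left, mul_add])
  lie_add x y z := Prod.ext (lie_add x.1 y.1 z.1) (by
    change c * resPairing x.1.1 (y.1.1 + z.1.1) = c * resPairing x.1.1 y.1.1 + c * resPairing x.1.1 z.1.1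
    rw [resPairing_add_right, mul_add])
  lie_self x := Prod.ext (lie_self x.1) (by
    change c * resPairing x.1.1 x.1.1 = 0
    rw [resPairing_self, mul_zero])
  leibniz_lie x y z := Prod.ext (leibniz_lie x.1 y.1 z.1) (by
    change c * resPairing x.1.1 ⁅y.1.1, z.1.1⁆ =
      c * resPairing ⁅x.1.1, y.1.1⁆ z.1.1 + c * resPairing y.1.1 ⁅x.1.1, z.1.1⁆
    rw [resPairing_leibniz, mul_add])

instance : LieAlgebra ℂ (Aff K c) where
  lie_smul a x y := Prod.ext (lie_smul a x.1 y.1) (by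
    change c * resPairing x.1.1 (a • y.1.1) = a * (c * resPairing x.1.1 y.1.1)
    rw [resPairing_smul_right]
    ring)

variable {K c}

/-- The matrix of Laurent series underlying the loop part of an element. -/
def Aff.mat (x : Aff K c) : Matrix (Fin N) (Fin N) Laurent := x.1.1

/-- The inclusion of vector spaces `K → K ⊕ ℂ k̂`. -/
def Aff.ofLoop (A : K) : Aff K c := (A, 0)

variable (K c) in
/-- The central element `k̂`. -/
def khat : Aff K c := (0, 1)

variable (K c) in
/-- The Cartan subalgebra: constant diagonal matrices and multiples of `k̂`. -/
def cartan : Submodule ℂ (Aff K c) where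
  carrier := {x | ∀ p q m, p ≠ q ∨ m ≠ 0 → (x.mat p q).coeff m = 0}
  add_mem' {x y} hx hy p q m h := by
    change (x.mat p q).coeff m + (y.mat p q).coeff m = 0
    rw [hx p q m h, hy p q m h, add_zero]
  zero_mem' _ _ _ _ := rfl
  smul_mem' a x hx p q m h := by
    change a * (x.mat p q).coeff m = 0
    rw [hx p q m h, mul_zero]

theorem khat_mem_cartan : khat K c ∈ cartan K c := fun _ _ _ _ => rfl

end Aff

/-! ### The affine Lie algebras at `Q_i`, `0` and `∞` -/

/-- The affine Lie algebra `sl_N(ℂ((ξ))) ⊕ ℂ k̂` with cocycle `Res (dA | B)`. -/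
abbrev AffQ (N : ℕ) : Type := Aff (loop N) 1

/-- The twisted affine Lie algebra at `0` (local coordinate `t`), with cocycle
`(1/N) Res (dA | B)`. -/
abbrev AffZero (N : ℕ) : Type := Aff (twistedLoop N (eps N)) (1 / N)

/-- The twisted affine Lie algebra at `∞` (local coordinate `s = 1/t`), with cocycle
`(1/N) Res (dA | B)`. In terms of `s`, the condition `f(εt) = Ad γ (f(t))` reads
`A(ε⁻¹ s) = Ad γ (A(s))`. -/
abbrev AffInfty (N : ℕ) : Type := Aff (twistedLoop N (eps N)⁻¹) (1 / N)

/-- The positive part of the affine Lie algebra at `Q_i`: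
power series whose constant term is strictly upper triangular. -/
def nPlusQ (N : ℕ) : Set (AffQ N) :=
  {x | x.2 = 0 ∧ ∀ p q m, m < 0 ∨ (m = 0 ∧ q ≤ p) → (x.mat p q).coeff m = 0}

/-- The positive part of a twisted affine Lie algebra:
power series with zero constant term. -/
def nPlusTw (N : ℕ) (ζ : ℂˣ) (c : ℂ) : Set (Aff (twistedLoop N ζ) c) :=
  {x | x.2 = 0 ∧ ∀ p q m, m ≤ 0 → (x.mat p q).coeff m = 0}

section Chevalley

variable {N : ℕ} [N.AtLeastTwo]

theorem sub_one_ne (i : Fin N) : i - 1 ≠ i := by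
  have : Fact (1 < N) := ⟨Nat.AtLeastTwo.one_lt⟩
  intro h
  have h1 : (1 : Fin N) = 0 := by simpa using h
  have h2 := congrArg Fin.val h1
  rw [Fin.val_one', Nat.mod_eq_of_lt Nat.AtLeastTwo.one_lt] at h2
  simp at h2

/-- The Chevalley generators `e_i` at `Q_i`. Indices are in `Fin N`, taken cyclically: with matrix
indices starting from `0`, `e_i = E_{i-1,i}` for `i ≠ 0` and `e_0 = ξ E_{N-1,0}`. -/
def chevalleyE (i : Fin N) : AffQ N :=
  Aff.ofLoop ⟨Matrix.single (i - 1) i (HahnSeries.single (if i = 0 then 1 else 0) 1),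
    Matrix.trace_single_eq_of_ne _ _ _ (sub_one_ne i)⟩

/-- The Chevalley generators `f_i` at `Q_i`: `f_i = E_{i,i-1}` for `i ≠ 0` and
`f_0 = ξ⁻¹ E_{0,N-1}`. -/
def chevalleyF (i : Fin N) : AffQ N :=
  Aff.ofLoop ⟨Matrix.single i (i - 1) (HahnSeries.single (if i = 0 then -1 else 0) 1),
    Matrix.trace_single_eq_of_ne _ _ _ (sub_one_ne i).symm⟩

/-- The diagonal matrix `E_{i-1,i-1} - E_{i,i}`, indices taken cyclically. -/
def hMat (i : Fin N) : Matrix (Fin N) (Fin N) ℂ :=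
  Matrix.diagonal (Pi.single (i - 1) 1 - Pi.single i 1)

theorem hMat_mem (ζ : ℂˣ) (i : Fin N) :
    (hMat i).map (algebraMap ℂ Laurent) ∈ twistedLoop N ζ := by
  constructor
  · have h : (hMat i).trace = 0 := by simp [hMat, Matrix.trace_diagonal]
    have h' := congrArg (algebraMap ℂ Laurent) h
    rwa [map_zero, ← RingHom.coe_coe, AddMonoidHom.map_trace] at h'
  · ext1 p q
    rw [adGamma_apply, Matrix.map_apply, Matrix.map_apply, AlgHom.commutes]
    by_cases hpq : p = q
    · simp [hpq]
    · simp [hMat, hpq]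

/-- The simple coroot `α_i^∨ = ± (E_{i-1,i-1} - E_{i,i}) + k̂ / N` of a twisted affine Lie algebra,
with sign `σ`. -/
def coroot (ζ : ℂˣ) (σ : ℂ) (i : Fin N) : Aff (twistedLoop N ζ) (1 / N) :=
  (σ • ⟨(hMat i).map (algebraMap ℂ Laurent), hMat_mem ζ i⟩, 1 / N)

theorem coroot_mem_cartan (ζ : ℂˣ) (σ : ℂ) (i : Fin N) :
    coroot ζ σ i ∈ cartan (twistedLoop N ζ) (1 / N) := by
  intro p q m h
  change σ * (algebraMap ℂ Laurent (hMat i p q)).coeff m = 0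
  rcases h with h | h
  · simp [hMat, h]
  · rw [algebraMap_laurent, HahnSeries.coeff_single_of_ne h, mul_zero]

end Chevalley

/-! ### Highest weight modules -/

section Modules

variable {G : Type} [LieRing G] [LieAlgebra ℂ G]

/-- The left ideal of `U(G)` generated by `n` and by `x - μ(x)` for `x ∈ h`. -/
def vermaIdeal (n : Set G) (h : Submodule ℂ G) (μ : Module.Dual ℂ h) :
    Submodule (UniversalEnvelopingAlgebra ℂ G) (UniversalEnvelopingAlgebra ℂ G) :=
  Submodule.span _
    ((UniversalEnvelopingAlgebra.ι ℂ '' n) ∪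
      Set.range fun x : h => UniversalEnvelopingAlgebra.ι ℂ (x : G) - algebraMap ℂ _ (μ x))

/-- The Verma module of highest weight `μ` relative to the positive part `n` and the Cartan
subalgebra `h`: the universal `G`-module generated by a vector that `n` annihilates and on which
`h` acts by `μ`. -/
def Verma (n : Set G) (h : Submodule ℂ G) (μ : Module.Dual ℂ h) : Type :=
  UniversalEnvelopingAlgebra ℂ G ⧸ vermaIdeal n h μ

variable (n : Set G) (h : Submodule ℂ G) (μ : Module.Dual ℂ h)

instance : AddCommGroup (Verma n h μ) :=
  inferInstanceAs (AddCommGroup (UniversalEnvelopingAlgebra ℂ G ⧸ vermaIdeal n h μ))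

instance : Module (UniversalEnvelopingAlgebra ℂ G) (Verma n h μ) :=
  inferInstanceAs (Module _ (UniversalEnvelopingAlgebra ℂ G ⧸ vermaIdeal n h μ))

instance : Module ℂ (Verma n h μ) :=
  inferInstanceAs (Module ℂ (UniversalEnvelopingAlgebra ℂ G ⧸ vermaIdeal n h μ))

instance : IsScalarTower ℂ (UniversalEnvelopingAlgebra ℂ G) (Verma n h μ) :=
  inferInstanceAs (IsScalarTower ℂ (UniversalEnvelopingAlgebra ℂ G)
    (UniversalEnvelopingAlgebra ℂ G ⧸ vermaIdeal n h μ))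

instance : LieRingModule G (Verma n h μ) where
  bracket x v := UniversalEnvelopingAlgebra.ι ℂ x • v
  add_lie x y v := by
    rw [map_add, add_smul]
  lie_add x v w := smul_add _ v w
  leibniz_lie x y v := by
    change UniversalEnvelopingAlgebra.ι ℂ x • UniversalEnvelopingAlgebra.ι ℂ y • v =
      UniversalEnvelopingAlgebra.ι ℂ ⁅x, y⁆ • v +
        UniversalEnvelopingAlgebra.ι ℂ y • UniversalEnvelopingAlgebra.ι ℂ x • v
    rw [LieHom.map_lie, LieRing.of_associative_ring_bracket, sub_smul, mul_smul, mul_smul,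
      sub_add_cancel]

instance : LieModule ℂ G (Verma n h μ) where
  smul_lie c x v := by
    change UniversalEnvelopingAlgebra.ι ℂ (c • x) • v = c • UniversalEnvelopingAlgebra.ι ℂ x • v
    rw [map_smul, smul_assoc]
  lie_smul c x v := by
    change UniversalEnvelopingAlgebra.ι ℂ x • c • v = c • UniversalEnvelopingAlgebra.ι ℂ x • v
    rw [← algebraMap_smul (UniversalEnvelopingAlgebra ℂ G) c v,
      ← algebraMap_smul (UniversalEnvelopingAlgebra ℂ G) c (UniversalEnvelopingAlgebra.ι ℂ x • v),
      smul_smul, smul_smul, Algebra.commutes]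

variable (G) in
/-- The sum of all proper submodules of a module. For a Verma module which has a largest proper
submodule (such as one whose highest weight is dominant integral), this is that submodule. -/
def maxProperSubmodule (V : Type) [AddCommGroup V] [Module ℂ V] [LieRingModule G V] :
    LieSubmodule ℂ G V :=
  sSup {W | W ≠ ⊤}

/-- The irreducible quotient of a Verma module: the quotient by its largest proper submodule. -/
abbrev IrreducibleQuotient : Type :=
  Verma n h μ ⧸ maxProperSubmodule G (Verma n h μ)

end Modules

/-- `V` is an integrable highest weight module of level `k` over the affine Lie algebra
`sl_N(ℂ((ξ))) ⊕ ℂ k̂`: it is generated by a nonzero vector that the positive part annihilates and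
on which the Cartan subalgebra acts by a weight, the Chevalley generators act locally nilpotently,
and `k̂` acts as `k`. -/
structure IsIntegrableHighestWeight (N : ℕ) [N.AtLeastTwo] (k : ℂ) (V : Type*) [AddCommGroup V]
    [Module ℂ V] [LieRingModule (AffQ N) V] [LieModule ℂ (AffQ N) V] : Prop where
  exists_highestWeightVector : ∃ (v : V) (Λ : Module.Dual ℂ (cartan (loop N) 1)),
    v ≠ 0 ∧ (∀ x ∈ nPlusQ N, ⁅x, v⁆ = 0) ∧
    (∀ x : cartan (loop N) 1, ⁅(x : AffQ N), v⁆ = Λ x • v) ∧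
    LieSubmodule.lieSpan ℂ (AffQ N) {v} = ⊤
  nilpotent_e : ∀ (i : Fin N) (v : V),
    ∃ m : ℕ, ((LieModule.toEnd ℂ (AffQ N) V (chevalleyE i)) ^ m) v = 0
  nilpotent_f : ∀ (i : Fin N) (v : V),
    ∃ m : ℕ, ((LieModule.toEnd ℂ (AffQ N) V (chevalleyF i)) ^ m) v = 0
  level : ∀ v : V, ⁅khat (loop N) 1, v⁆ = k • v

/-! ### Weights and Verma modules at `0` and `∞` -/

/-- Weights of the twisted affine Lie algebra at `0`. -/
abbrev WeightZero (N : ℕ) : Type := Module.Dual ℂ (cartan (twistedLoop N (eps N)) (1 / N))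

/-- Weights of the twisted affine Lie algebra at `∞`. -/
abbrev WeightInfty (N : ℕ) : Type := Module.Dual ℂ (cartan (twistedLoop N (eps N)⁻¹) (1 / N))

/-- The level `μ(k̂)` of a weight. -/
def level {N : ℕ} {K : LieSubalgebra ℂ (Matrix (Fin N) (Fin N) Laurent)} {c : ℂ}
    (μ : Module.Dual ℂ (cartan K c)) : ℂ :=
  μ ⟨khat K c, khat_mem_cartan⟩

/-- `μ(α_i^∨)` is a nonnegative integer for all `i`, where `α_i^∨` corresponds to
`H_{i,i+1} + k̂ / N` under the identification with the affine Lie algebra. -/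
def DominantIntegralZero {N : ℕ} [N.AtLeastTwo] (μ : WeightZero N) : Prop :=
  ∀ i : Fin N, ∃ m : ℕ, μ ⟨coroot (eps N) 1 i, coroot_mem_cartan _ _ _⟩ = m

/-- `μ(α_i^∨)` is a nonnegative integer for all `i`, where `α_i^∨` corresponds to
`- H_{i,i+1} + k̂ / N` under the identification with the affine Lie algebra. -/
def DominantIntegralInfty {N : ℕ} [N.AtLeastTwo] (μ : WeightInfty N) : Prop :=
  ∀ i : Fin N, ∃ m : ℕ, μ ⟨coroot (eps N)⁻¹ (-1) i, coroot_mem_cartan _ _ _⟩ = m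

/-- The Verma module at `0`. -/
abbrev VermaZero {N : ℕ} (μ : WeightZero N) : Type := Verma (nPlusTw N (eps N) (1 / N)) _ μ

/-- The Verma module at `∞`. -/
abbrev VermaInfty {N : ℕ} (μ : WeightInfty N) : Type := Verma (nPlusTw N (eps N)⁻¹ (1 / N)) _ μ

/-- The irreducible quotient of the Verma module at `0`. -/
abbrev IrrZero {N : ℕ} (μ : WeightZero N) : Type :=
  IrreducibleQuotient (nPlusTw N (eps N) (1 / N)) _ μ

/-- The irreducible quotient of the Verma module at `∞`. -/
abbrev IrrInfty {N : ℕ} (μ : WeightInfty N) : Type :=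
  IrreducibleQuotient (nPlusTw N (eps N)⁻¹ (1 / N)) _ μ

/-! ### Meromorphic sections and conformal coinvariants -/

theorem transcendental_eps_mul_X (N : ℕ) :
    Transcendental ℂ (algebraMap ℂ (RatFunc ℂ) (eps N) * RatFunc.X) := by
  intro h
  refine RatFunc.transcendental_X (K := ℂ) ?_
  have h2 := (isAlgebraic_algebraMap (A := RatFunc ℂ) ((eps N)⁻¹ : ℂˣ).val).mul h
  rwa [← mul_assoc, ← map_mul, ← Units.val_mul, inv_mul_cancel, Units.val_one, map_one,
    one_mul] at h2

/-- The substitution `t ↦ ε t` in rational functions. -/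
def rotate (N : ℕ) : RatFunc ℂ →ₐ[ℂ] RatFunc ℂ :=
  subst (algebraMap ℂ (RatFunc ℂ) (eps N) * RatFunc.X) (transcendental_eps_mul_X N)

theorem rotate_X (N : ℕ) : rotate N RatFunc.X = algebraMap ℂ (RatFunc ℂ) (eps N) * RatFunc.X :=
  subst_X _ _

/-- Rational functions without poles outside `0`, `∞` and the points `w` with
`w ^ N = z i ^ N` for some `i`. -/
def regularOutside (N : ℕ) {L : ℕ} (z : Fin L → ℂ) : Subalgebra ℂ (RatFunc ℂ) where
  carrier := {f | ∀ w : ℂ, f.denom.IsRoot w → w = 0 ∨ ∃ i, w ^ N = z i ^ N}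
  mul_mem' {f g} hf hg w hw := by
    have h := hw.dvd (RatFunc.denom_mul_dvd f g)
    rw [Polynomial.root_mul] at h
    exact h.elim (hf w) (hg w)
  add_mem' {f g} hf hg w hw := by
    have h := hw.dvd (RatFunc.denom_add_dvd f g)
    rw [Polynomial.root_mul] at h
    exact h.elim (hf w) (hg w)
  algebraMap_mem' c w hw := by
    rw [IsScalarTower.algebraMap_apply ℂ (Polynomial ℂ) (RatFunc ℂ), RatFunc.denom_algebraMap] at hw
    simp at hw

/-- The Lie algebra of `sl_N(ℂ)`-valued meromorphic functions `f(t)` on `ℙ¹`, with poles at most at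
`0`, `∞` and the preimages of the points `Q_i = [z i]` of `ℙ¹/C_N`, such that
`f(ε t) = Ad γ (f(t))`. -/
def gOut (N : ℕ) {L : ℕ} (z : Fin L → ℂ) :
    LieSubalgebra ℂ (Matrix (Fin N) (Fin N) (RatFunc ℂ)) where
  carrier := {f | f.trace = 0 ∧ f.map (rotate N) = adGamma f ∧
    ∀ p q, f p q ∈ regularOutside N z}
  add_mem' {f g} hf hg :=
    ⟨by rw [Matrix.trace_add, hf.1, hg.1, add_zero],
      by rw [Matrix.map_add _ (map_add _), hf.2.1, hg.2.1, adGamma_add],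
      fun p q => add_mem (hf.2.2 p q) (hg.2.2 p q)⟩
  zero_mem' := ⟨Matrix.trace_zero _ _, by rw [Matrix.map_zero _ (map_zero _), adGamma_zero],
    fun _ _ => zero_mem _⟩
  smul_mem' c f hf :=
    ⟨by rw [Matrix.trace_smul, hf.1, smul_zero],
      by rw [Matrix.map_smul _ _ (show ∀ a, rotate N (c • a) = c • rotate N a from
        (rotate N).toLinearMap.map_smul c), hf.2.1,
        adGamma_smul],
      fun p q => (regularOutside N z).smul_mem (hf.2.2 p q) c⟩
  lie_mem' {f g} hf hg :=
    ⟨by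
      rw [LieRing.of_associative_ring_bracket, Matrix.trace_sub, Matrix.trace_mul_comm, sub_self],
      by
        rw [LieRing.of_associative_ring_bracket, Matrix.map_sub _ (map_sub _), Matrix.map_mul,
          Matrix.map_mul, hf.2.1, hg.2.1, adGamma_sub, adGamma_mul, adGamma_mul],
      fun p q => by
        rw [LieRing.of_associative_ring_bracket, Matrix.sub_apply, Matrix.mul_apply,
          Matrix.mul_apply]
        exact sub_mem (sum_mem fun r _ => mul_mem (hf.2.2 p r) (hg.2.2 r q))
          (sum_mem fun r _ => mul_mem (hg.2.2 p r) (hf.2.2 r q))⟩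

section Expansion

variable {N L : ℕ} {z : Fin L → ℂ}

theorem trace_map {φ : RatFunc ℂ →ₐ[ℂ] Laurent} (f : gOut N z) :
    (f.1.map φ).trace = 0 := by
  have h := congrArg φ f.2.1
  rwa [map_zero, Matrix.trace, map_sum] at h

theorem scale_expandAt_zero (x : RatFunc ℂ) :
    scale (eps N) (expandAt 0 x) = expandAt 0 (rotate N x) := by
  have h : (scale (eps N)).comp (expandAt 0) = (expandAt 0).comp (rotate N) := by
    apply ratFunc_algHom_ext
    rw [AlgHom.comp_apply, AlgHom.comp_apply, rotate_X, map_mul, AlgHom.commutes,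
      expandAt_X]
    ext m
    by_cases hm : m = 1
    · subst hm; simp
    · simp [hm]
  exact DFunLike.congr_fun h x

theorem scale_expandInfty (x : RatFunc ℂ) :
    scale (eps N)⁻¹ (expandInfty x) = expandInfty (rotate N x) := by
  have h : (scale (eps N)⁻¹).comp expandInfty = expandInfty.comp (rotate N) := by
    apply ratFunc_algHom_ext
    rw [AlgHom.comp_apply, AlgHom.comp_apply, rotate_X, map_mul, AlgHom.commutes,
      expandInfty_X]
    ext m
    by_cases hm : m = -1
    · subst hm; simp
    · simp [hm]
  exact DFunLike.congr_fun h x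

/-- The germ of `f` at `0`. -/
def germZero (f : gOut N z) : AffZero N :=
  Aff.ofLoop ⟨f.1.map (expandAt 0), trace_map f, by
    rw [← map_adGamma, ← f.2.2.1]
    ext1 p q
    exact scale_expandAt_zero _⟩

/-- The germ of `f` at `∞`. -/
def germInfty (f : gOut N z) : AffInfty N :=
  Aff.ofLoop ⟨f.1.map expandInfty, trace_map f, by
    rw [← map_adGamma, ← f.2.2.1]
    ext1 p q
    exact scale_expandInfty _⟩

/-- The germ of `f` at `Q_i`, in the local coordinate `ξ = t - z i`. -/
def germ (f : gOut N z) (i : Fin L) : AffQ N :=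
  Aff.ofLoop ⟨f.1.map (expandAt (z i)), trace_map f⟩

end Expansion

section Coinvariants

variable (N : ℕ) {L : ℕ} (z : Fin L → ℂ)
  (V₀ : Type*) [AddCommGroup V₀] [Module ℂ V₀] [LieRingModule (AffZero N) V₀]
  [LieModule ℂ (AffZero N) V₀]
  (M : Fin L → Type*) [∀ i, AddCommGroup (M i)] [∀ i, Module ℂ (M i)]
  [∀ i, LieRingModule (AffQ N) (M i)] [∀ i, LieModule ℂ (AffQ N) (M i)]
  (V₁ : Type*) [AddCommGroup V₁] [Module ℂ V₁] [LieRingModule (AffInfty N) V₁]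
  [LieModule ℂ (AffInfty N) V₁]

/-- The action of `(A_i)_i` on `⨂ M_i`: the sum over `i` of the action of `A_i` on the
`i`-th factor. -/
def tensorAction (x : Fin L → AffQ N) : Module.End ℂ (⨂[ℂ] i, M i) :=
  ∑ i, PiTensorProduct.map
    (Function.update (fun j => (LinearMap.id : M j →ₗ[ℂ] M j)) i
      (LieModule.toEnd ℂ (AffQ N) (M i) (x i)))

/-- The action of a meromorphic section on `V₀ ⊗ (⨂ M_i) ⊗ V_∞` through its germs at `0`, at the
`Q_i` and at `∞`. -/
def outAction (f : gOut N z) : Module.End ℂ (V₀ ⊗[ℂ] (⨂[ℂ] i, M i) ⊗[ℂ] V₁) :=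
  TensorProduct.map
      (TensorProduct.map (LieModule.toEnd ℂ (AffZero N) V₀ (germZero f)) LinearMap.id)
      LinearMap.id +
    TensorProduct.map (TensorProduct.map LinearMap.id (tensorAction N M (germ f))) LinearMap.id +
    TensorProduct.map LinearMap.id (LieModule.toEnd ℂ (AffInfty N) V₁ (germInfty f))

/-- The subspace `g_out (V₀ ⊗ M ⊗ V_∞)`. -/
def outSubmodule : Submodule ℂ (V₀ ⊗[ℂ] (⨂[ℂ] i, M i) ⊗[ℂ] V₁) :=
  ⨆ f : gOut N z, LinearMap.range (outAction N z V₀ M V₁ f)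

/-- The space `CC_orb (V₀ ⊗ M ⊗ V_∞)` of conformal coinvariants of the orbifold `ℙ¹/C_N`. -/
abbrev CCorb : Type _ := (V₀ ⊗[ℂ] (⨂[ℂ] i, M i) ⊗[ℂ] V₁) ⧸ outSubmodule N z V₀ M V₁

end Coinvariants

end OrbifoldWZW

end

noncomputable section

namespace OrbifoldWZW

attribute [local instance] LieRing.ofAssociativeRing

/-! ### Locally nilpotent operators -/

section LocNil

variable {V : Type*} [AddCommGroup V] [Module ℂ V]

/-! The proof studies the pairing of one outer Verma module with the remaining tensor factors,
modulo `O = outSubmodule`. At the point 0, let `V` be the Verma module with generator `v`. The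
vectors `a` with `a ⊗ u ∈ O` for all `u` form a submodule, `IsInvariantPairing.radical`. Indeed the
functions `E_{p,p+m} t^m`, made traceless, belong to `gOut`. On a given vector of `V` every element
of the affine algebra acts as a finite combination of their germs and of the scalar `k̂`.

The pole allowed at a point `Q_i` provides `χ = t / (1 - t^N / z_i^N)`, which has a simple zero at 0
and also vanishes at ∞. The section `E_{p,p+1} χ` acts locally nilpotently on every `M_i`, because
all root vectors with Laurent series coefficients do so on integrable modules
(`IsIntegrableHighestWeight.locNil_root`). It acts locally nilpotently on the module at ∞ because it
is ad-nilpotent and kills the highest weight vector there. At 0 it acts on the string `f_p ^ n v`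
like a simple root vector, sending `f_p ^ (n+1) v` to `(n+1)(l-n) f_p ^ n v`, where `l` is the value
of the weight on the corresponding simple coroot. Moving the section across the pairing and
inducting on the nilpotency order puts `f_p ^ n v` in the radical as soon as `l` is not an integer
`≥ n` (`IsInvariantPairing.lowering_pow_mem`). If some `l` is not a natural number, `n = 0` puts `v`
itself in the radical and the coinvariants vanish. If all are natural numbers, the radical contains
every `f_p ^ (l+1) v`.

It remains to see that a submodule containing these singular vectors contains every proper
submodule. This is Kac's theorem that integrable highest weight modules are irreducible
(`IsPrincipalRep.highestWeightVector_mem`), proved with a Casimir operator adapted to the principal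
grading. Its commutators with the operators of degree `±1` are `∓2(1 + k/N)` times these operators.
At noncritical level it therefore replaces the degree derivation and detects the length of a word in
the lowering operators. A joint eigenvector of minimal length in a nonzero submodule is singular,
its weight is dominant by `sl₂` theory, and comparison of Casimir eigenvalues forces the length to
be zero. The same eigenvalues show that two proper submodules have a proper sum
(`IsPrincipalRep.notMem_sup`).

The point ∞ is treated in the same way with `1/t` for `t` and the shift `g = -1` for `g = 1`. Right
exactness of the tensor product then gives the isomorphism (`exists_coinvariants_equiv`). -/

/-- Every vector is killed by some power of `f`. -/
def LocNil (f : Module.End ℂ V) : Prop := ∀ v, ∃ n : ℕ, (f ^ n) v = 0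

theorem pow_apply_eq_zero_of_le {f : Module.End ℂ V} {m n : ℕ} (h : m ≤ n) {v : V}
    (hv : (f ^ m) v = 0) : (f ^ n) v = 0 := by
  obtain ⟨d, rfl⟩ := Nat.exists_eq_add_of_le' h
  rw [pow_add, Module.End.mul_apply, hv, map_zero]

/-- The subspace of vectors on which `f` is nilpotent. -/
def nilSubmodule (f : Module.End ℂ V) : Submodule ℂ V where
  carrier := {v | ∃ n : ℕ, (f ^ n) v = 0}
  add_mem' := by
    rintro v w ⟨m, hm⟩ ⟨n, hn⟩
    exact ⟨max m n, by rw [map_add, pow_apply_eq_zero_of_le (le_max_left _ _) hm,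
      pow_apply_eq_zero_of_le (le_max_right _ _) hn, add_zero]⟩
  zero_mem' := ⟨0, map_zero _⟩
  smul_mem' := by
    rintro c v ⟨m, hm⟩
    exact ⟨m, by rw [map_smul, hm, smul_zero]⟩

theorem locNil_of_span {f : Module.End ℂ V} {s : Set V} (hs : Submodule.span ℂ s = ⊤)
    (h : ∀ v ∈ s, ∃ n : ℕ, (f ^ n) v = 0) : LocNil f := fun v => by
  have : Submodule.span ℂ s ≤ nilSubmodule f := Submodule.span_le.mpr h
  exact this (hs ▸ Submodule.mem_top)

theorem locNil_zero : LocNil (0 : Module.End ℂ V) := fun v => ⟨1, by simp⟩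

theorem LocNil.smul {f : Module.End ℂ V} (hf : LocNil f) (c : ℂ) : LocNil (c • f) := fun v => by
  obtain ⟨n, hn⟩ := hf v
  exact ⟨n, by rw [smul_pow, LinearMap.smul_apply, hn, smul_zero]⟩

theorem add_pow_apply_eq_zero {f g : Module.End ℂ V} (hfg : Commute f g) {m n : ℕ} {v : V}
    (hm : (f ^ m) v = 0) (hn : (g ^ n) v = 0) : ((f + g) ^ (m + n)) v = 0 := by
  rw [hfg.add_pow, LinearMap.sum_apply]
  refine Finset.sum_eq_zero fun i hi => ?_
  suffices h : (f ^ i * g ^ (m + n - i)) v = 0 by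
    rw [← (Nat.cast_commute _ _).eq, Module.End.mul_apply, h, map_zero]
  rcases le_or_gt m i with h | h
  · rw [(hfg.pow_pow _ _).eq, Module.End.mul_apply, pow_apply_eq_zero_of_le h hm, map_zero]
  · rw [Module.End.mul_apply, pow_apply_eq_zero_of_le (by omega) hn, map_zero]

theorem LocNil.add {f g : Module.End ℂ V} (hf : LocNil f) (hg : LocNil g) (hfg : Commute f g) :
    LocNil (f + g) := fun v => by
  obtain ⟨m, hm⟩ := hf v
  obtain ⟨n, hn⟩ := hg v
  exact ⟨_, add_pow_apply_eq_zero hfg hm hn⟩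

theorem locNil_sum {ι : Type*} (s : Finset ι) {f : ι → Module.End ℂ V} (hf : ∀ i ∈ s, LocNil (f i))
    (h : ∀ i ∈ s, ∀ j ∈ s, Commute (f i) (f j)) : LocNil (∑ i ∈ s, f i) := by
  classical
  induction s using Finset.induction_on with
  | empty => simpa using locNil_zero
  | insert a s ha ih =>
    rw [Finset.sum_insert ha]
    refine (hf a (by simp)).add (ih (fun i hi => hf i (by simp [hi]))
      (fun i hi j hj => h i (by simp [hi]) j (by simp [hj]))) ?_
    exact Commute.sum_right _ _ _ fun i hi => h a (by simp) i (by simp [hi])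

end LocNil

/-! ### Joint eigenvectors -/

section Joint

variable {V : Type*} [AddCommGroup V] [Module ℂ V]

/-- For an index `j` at which two characters differ, `F j - χ₀ j` removes the `χ₀` term and rescales
the other one by a nonzero factor, so induction on the set of characters applies. With `W = ⊥` this
is the independence of eigenvectors with distinct characters. -/
theorem component_mem {ι : Type*} {F : ι → Module.End ℂ V} {W : Submodule ℂ V}
    (hW : ∀ i, ∀ w ∈ W, F i w ∈ W) (s : Finset (ι → ℂ)) :
    ∀ w : (ι → ℂ) → V, (∀ χ ∈ s, ∀ i, F i (w χ) = χ i • w χ) → ∑ χ ∈ s, w χ ∈ W →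
      ∀ χ ∈ s, w χ ∈ W := by
  classical
  induction s using Finset.induction_on with
  | empty => simp
  | insert χ₀ s h₀ ih =>
    intro w hw hs
    have hmem : ∀ χ ∈ s, w χ ∈ W := by
      intro χ₁ h₁
      have hne : χ₁ ≠ χ₀ := by rintro rfl; exact h₀ h₁
      obtain ⟨j, hj⟩ := Function.ne_iff.mp hne
      have h := ih (fun χ => (χ j - χ₀ j) • w χ)
        (fun χ hχ i => by rw [map_smul, hw χ (by simp [hχ]), smul_comm]) (by
          have : ∑ χ ∈ s, (χ j - χ₀ j) • w χ =
              F j (∑ χ ∈ insert χ₀ s, w χ) - χ₀ j • ∑ χ ∈ insert χ₀ s, w χ := by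
            rw [Finset.sum_insert h₀, map_add, hw χ₀ (by simp), map_sum, smul_add, Finset.smul_sum,
              add_sub_add_left_eq_sub, ← Finset.sum_sub_distrib]
            refine Finset.sum_congr rfl fun χ hχ => ?_
            rw [hw χ (by simp [hχ]), sub_smul]
          rw [this]
          exact sub_mem (hW _ _ hs) (W.smul_mem _ hs)) χ₁ h₁
      exact (W.smul_mem_iff (sub_ne_zero.mpr hj)).mp h
    intro χ hχ
    rcases Finset.mem_insert.mp hχ with rfl | hχ
    · rw [Finset.sum_insert h₀] at hs
      exact (W.add_mem_iff_left (sum_mem hmem)).mp hs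
    · exact hmem χ hχ

/-- A decomposition into joint eigenvectors. -/
theorem exists_components {ι J : Type*} {F : ι → Module.End ℂ V} {w : J → V} {ch : J → ι → ℂ}
    (hw : ∀ j i, F i (w j) = ch j i • w j) {u : V} (hu : u ∈ Submodule.span ℂ (Set.range w)) :
    ∃ (s : Finset (ι → ℂ)) (c : (ι → ℂ) → V), u = ∑ χ ∈ s, c χ ∧
      (∀ χ i, F i (c χ) = χ i • c χ) ∧ (∀ χ, c χ ∈ Submodule.span ℂ (w '' {j | ch j = χ})) := by
  classical
  obtain ⟨l, rfl⟩ := (Finsupp.mem_span_range_iff_exists_finsupp).mp hu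
  have hmem : ∀ χ, ∑ j ∈ l.support with ch j = χ, l j • w j ∈
      Submodule.span ℂ (w '' {j | ch j = χ}) := fun χ =>
    sum_mem fun j hj => Submodule.smul_mem _ _ (Submodule.subset_span
      ⟨j, (Finset.mem_filter.mp hj).2, rfl⟩)
  refine ⟨l.support.image ch, fun χ => ∑ j ∈ l.support with ch j = χ, l j • w j, ?_, ?_, hmem⟩
  · exact (Finset.sum_fiberwise_of_maps_to (fun j hj => Finset.mem_image_of_mem ch hj) _).symm
  · intro χ i
    rw [map_sum, Finset.smul_sum]
    refine Finset.sum_congr rfl fun j hj => ?_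
    rw [map_smul, hw, (Finset.mem_filter.mp hj).2, smul_comm]

/-- Some component of a nonzero vector of `W` is nonzero and lies in `W`. Its character occurs among
the `ch j`, since otherwise the component would lie in the span of the empty set. -/
theorem exists_joint_eigenvector {ι J : Type*} {F : ι → Module.End ℂ V} {w : J → V}
    {ch : J → ι → ℂ} (hw : ∀ j i, F i (w j) = ch j i • w j)
    (hspan : Submodule.span ℂ (Set.range w) = ⊤) {W : Submodule ℂ V}
    (hW : ∀ i, ∀ u ∈ W, F i u ∈ W) (hne : W ≠ ⊥) :
    ∃ j, ∃ u ∈ W, u ≠ 0 ∧ (∀ i, F i u = ch j i • u) ∧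
      u ∈ Submodule.span ℂ (w '' {j' | ch j' = ch j}) := by
  obtain ⟨u, hu, hu0⟩ := Submodule.exists_mem_ne_zero_of_ne_bot hne
  obtain ⟨s, c, hsum, hc, hc'⟩ := exists_components hw (hspan ▸ Submodule.mem_top : u ∈ _)
  have hcW := component_mem hW s c (fun χ _ => hc χ) (hsum ▸ hu)
  obtain ⟨χ, hχ, hχ0⟩ : ∃ χ ∈ s, c χ ≠ 0 := by
    by_contra! h
    exact hu0 (hsum.trans (Finset.sum_eq_zero h))
  have : ∃ j, ch j = χ := by
    by_contra! h
    have h' : {j | ch j = χ} = ∅ := Set.eq_empty_of_forall_notMem h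
    have := hc' χ
    rw [h', Set.image_empty, Submodule.span_empty, Submodule.mem_bot] at this
    exact hχ0 this
  obtain ⟨j, rfl⟩ := this
  exact ⟨j, c _, hcW _ hχ, hχ0, hc _, hc' _⟩

/-- If only multiples of `v` have the joint eigenvalue of `v`, then stable subspaces which do not
contain `v` are contained in a common subspace which does not contain `v`. -/
theorem notMem_sup_of_notMem {ι J : Type*} {F : ι → Module.End ℂ V} {w : J → V}
    {ch : J → ι → ℂ} (hw : ∀ j i, F i (w j) = ch j i • w j)
    (hspan : Submodule.span ℂ (Set.range w) = ⊤) {j₀ : J}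
    (hj₀ : ∀ j, ch j = ch j₀ → j = j₀) {W₁ W₂ : Submodule ℂ V}
    (hW₁ : ∀ i, ∀ u ∈ W₁, F i u ∈ W₁) (hW₂ : ∀ i, ∀ u ∈ W₂, F i u ∈ W₂)
    (h₁ : w j₀ ∉ W₁) (h₂ : w j₀ ∉ W₂) : w j₀ ∉ W₁ ⊔ W₂ := by
  classical
  -- The component of character `ch j₀` is a multiple of `w j₀` that lies in `W`, hence is zero.
  have key : ∀ W : Submodule ℂ V, (∀ i, ∀ u ∈ W, F i u ∈ W) → w j₀ ∉ W → ∀ u ∈ W,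
      ∃ (s : Finset (ι → ℂ)) (c : (ι → ℂ) → V), u = ∑ χ ∈ s, c χ ∧
        (∀ χ i, F i (c χ) = χ i • c χ) ∧ c (ch j₀) = 0 := by
    intro W hW hv u hu
    obtain ⟨s, c, hsum, hc, hc'⟩ := exists_components hw (hspan ▸ Submodule.mem_top : u ∈ _)
    have hcW := component_mem hW s c (fun χ _ => hc χ) (hsum ▸ hu)
    refine ⟨s, fun χ => if χ = ch j₀ then 0 else c χ, ?_, ?_, by simp⟩
    · rw [hsum]
      refine Finset.sum_congr rfl fun χ hχ => ?_
      dsimp only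
      split_ifs with h
      · subst h
        have h1 := hc' (ch j₀)
        have h2 : {j | ch j = ch j₀} = {j₀} := by
          ext j; exact ⟨hj₀ j, by rintro rfl; rfl⟩
        rw [h2, Set.image_singleton] at h1
        obtain ⟨a, ha⟩ := Submodule.mem_span_singleton.mp h1
        have h3 := hcW _ hχ
        rw [← ha] at h3 ⊢
        by_cases ha0 : a = 0
        · rw [ha0, zero_smul]
        · exact absurd ((W.smul_mem_iff ha0).mp h3) hv
      · rfl
    · intro χ i
      dsimp only
      split_ifs
      · simp
      · exact hc χ i
  intro hmem
  obtain ⟨u₁, hu₁, u₂, hu₂, hu⟩ := Submodule.mem_sup.mp hmem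
  obtain ⟨s₁, c₁, hs₁, hc₁, h₁0⟩ := key W₁ hW₁ h₁ u₁ hu₁
  obtain ⟨s₂, c₂, hs₂, hc₂, h₂0⟩ := key W₂ hW₂ h₂ u₂ hu₂
  -- The components of `w j₀ - u₁ - u₂ = 0`; at `ch j₀` only `w j₀` survives, so it would have to
  -- vanish.
  let d : (ι → ℂ) → V := fun χ => (if χ = ch j₀ then w j₀ else 0) -
    (if χ ∈ s₁ then c₁ χ else 0) - (if χ ∈ s₂ then c₂ χ else 0)
  have hd : ∀ χ i, F i (d χ) = χ i • d χ := by
    intro χ i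
    simp only [d, map_sub, smul_sub]
    congr 1
    · congr 1
      · split_ifs with h
        · rw [hw, h]
        · simp
      · split_ifs
        · exact hc₁ χ i
        · simp
    · split_ifs
      · exact hc₂ χ i
      · simp
  have h := component_mem (F := F) (W := ⊥) (fun i u hu => by
      rw [Submodule.mem_bot] at hu ⊢; rw [hu, map_zero]) (insert (ch j₀) (s₁ ∪ s₂)) d
    (fun χ _ => hd χ) (by
      rw [Submodule.mem_bot]
      have e1 : ∑ χ ∈ insert (ch j₀) (s₁ ∪ s₂), (if χ ∈ s₁ then c₁ χ else 0) = u₁ := by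
        rw [hs₁, ← Finset.sum_filter]
        refine Finset.sum_congr ?_ fun _ _ => rfl
        ext χ; simp; tauto
      have e2 : ∑ χ ∈ insert (ch j₀) (s₁ ∪ s₂), (if χ ∈ s₂ then c₂ χ else 0) = u₂ := by
        rw [hs₂, ← Finset.sum_filter]
        refine Finset.sum_congr ?_ fun _ _ => rfl
        ext χ; simp; tauto
      simp only [d, Finset.sum_sub_distrib]
      rw [e1, e2, Finset.sum_ite_eq' , if_pos (by simp), ← hu]
      abel) (ch j₀) (by simp)
  rw [Submodule.mem_bot] at h
  simp only [d, if_true, h₁0, h₂0, ite_self, sub_zero] at h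
  exact h₁ (h ▸ W₁.zero_mem)

end Joint

/-! ### The Casimir operator -/

section Casimir

variable {ι : Type*} [AddCommGroup ι] [Fintype ι] [DecidableEq ι] {V : Type*} [AddCommGroup V]
  [Module ℂ V]

/-- Operators `X p m` which represent the matrices `E_{p,p+mg} ξ^m`, up to scalar matrices, on a
smooth module over the affine Lie algebra in its principal realization; `c` is the level divided
by the size of the matrices. Only the commutators with the operators of degree `±1` are
prescribed. -/
structure IsPrincipalRep (g : ι) (c : ℂ) (X : ι → ℤ → Module.End ℂ V) : Prop where
  comm : ∀ p m r n, n = 1 ∨ n = -1 → X p m * X r n - X r n * X p m =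
    (if r = p + m • g then X p (m + n) else 0) - (if p = r + n • g then X r (m + n) else 0) +
      (if m + n = 0 ∧ r = p + m • g then (m * c : ℂ) else 0) • 1
  trace : ∀ m : ℤ, m • g = 0 → ∑ p, X p m = 0
  smooth : ∀ w, ∃ M : ℕ, ∀ m : ℤ, M ≤ m → ∀ p, X p m w = 0

/-- The degree zero products of the terms of degrees `-m` and `m`. -/
def casimirTerm (g : ι) (X : ι → ℤ → Module.End ℂ V) (m : ℤ) : Module.End ℂ V :=
  ∑ p, X (p + m • g) (-m) * X p m

/-- Auxiliary products in the commutators of the Casimir operator. -/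
def casimirFlux (g : ι) (X : ι → ℤ → Module.End ℂ V) (r : ι) (n b : ℤ) : Module.End ℂ V :=
  X r (n - b) * X (r + (n - b) • g) b - X (r + b • g) (n - b) * X r b

variable {g : ι} {c : ℂ} {X : ι → ℤ → Module.End ℂ V}

/-- The matrix parts of the commutators form a difference of consecutive fluxes, so that sums over
`m` telescope. The cocycle contributes only for `m = ±n`. -/
theorem IsPrincipalRep.casimirTerm_comm (h : IsPrincipalRep g c X) (m : ℤ) (r : ι) (n : ℤ)
    (hn : n = 1 ∨ n = -1) :
    casimirTerm g X m * X r n - X r n * casimirTerm g X m =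
      casimirFlux g X r n (m + n) - casimirFlux g X r n m -
        (n * c * ((if m = -n then 1 else 0) + if m = n then 1 else 0) : ℂ) • X r n := by
  have e1 : casimirTerm g X m * X r n - X r n * casimirTerm g X m =
      ∑ p, X (p + m • g) (-m) * (X p m * X r n - X r n * X p m) +
      ∑ p, (X (p + m • g) (-m) * X r n - X r n * X (p + m • g) (-m)) * X p m := by
    rw [casimirTerm, Finset.sum_mul, Finset.mul_sum, ← Finset.sum_sub_distrib,
      ← Finset.sum_add_distrib]
    refine Finset.sum_congr rfl fun p _ => ?_
    noncomm_ring
  have c1 : ∀ p, (r = p + m • g) = (p = r - m • g) := fun p => by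
    rw [eq_iff_iff, eq_sub_iff_add_eq, eq_comm]
  have c2 : ∀ p, (r = p + m • g + (-m) • g) = (p = r) := fun p => by
    rw [neg_smul, add_neg_cancel_right, eq_iff_iff, eq_comm]
  have c3 : ∀ p, (p + m • g = r + n • g) = (p = r + n • g - m • g) := fun p => by
    rw [eq_iff_iff, eq_sub_iff_add_eq]
  have s1 : ∑ p, X (p + m • g) (-m) * (X p m * X r n - X r n * X p m) =
      X r (-m) * X (r - m • g) (m + n) - X (r + n • g + m • g) (-m) * X r (m + n) +
        (if m = -n then (m * c : ℂ) else 0) • X r n := by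
    have : ∀ p, X (p + m • g) (-m) * (X p m * X r n - X r n * X p m) =
        (if p = r - m • g then X (p + m • g) (-m) * X p (m + n) else 0) -
        (if p = r + n • g then X (p + m • g) (-m) * X r (m + n) else 0) +
        (if p = r - m • g then (if m = -n then (m * c : ℂ) else 0) • X (p + m • g) (-m) else 0) := by
      intro p
      simp only [h.comm p m r n hn, c1, mul_add, mul_sub, mul_ite, mul_zero, mul_smul_comm,
        mul_one, eq_neg_iff_add_eq_zero]
      congr 1
      by_cases h1 : p = r - m • g <;> by_cases h2 : m + n = 0 <;> simp [h1, h2]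
    rw [Finset.sum_congr rfl fun p _ => this p, Finset.sum_add_distrib, Finset.sum_sub_distrib,
      Finset.sum_ite_eq', Finset.sum_ite_eq', Finset.sum_ite_eq']
    simp only [Finset.mem_univ, if_true, sub_add_cancel]
    congr 1
    split_ifs with hm
    · rw [hm, neg_neg]
    · simp
  have s2 : ∑ p, (X (p + m • g) (-m) * X r n - X r n * X (p + m • g) (-m)) * X p m =
      X (r + m • g) (n - m) * X r m - X r (n - m) * X (r + n • g - m • g) m -
        (if m = n then (m * c : ℂ) else 0) • X r n := by
    have : ∀ p, (X (p + m • g) (-m) * X r n - X r n * X (p + m • g) (-m)) * X p m =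
        (if p = r then X (p + m • g) (n - m) * X p m else 0) -
        (if p = r + n • g - m • g then X r (n - m) * X p m else 0) -
        (if p = r then (if m = n then (m * c : ℂ) else 0) • X p m else 0) := by
      intro p
      simp only [h.comm _ _ r n hn, c2, c3, add_mul, sub_mul, ite_mul, zero_mul, smul_mul_assoc,
        one_mul, neg_add_eq_sub, sub_eq_zero]
      rw [sub_eq_add_neg _ (ite (p = r) _ _)]
      congr 1
      by_cases h1 : p = r <;> by_cases h2 : n = m <;> simp [h1, h2, eq_comm]
      exact fun h => absurd h.symm h2
    rw [Finset.sum_congr rfl fun p _ => this p, Finset.sum_sub_distrib, Finset.sum_sub_distrib,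
      Finset.sum_ite_eq', Finset.sum_ite_eq', Finset.sum_ite_eq']
    simp only [Finset.mem_univ, if_true]
    congr 1
    split_ifs with hm
    · rw [hm]
    · simp
  rw [e1, s1, s2, casimirFlux, casimirFlux]
  have t1 : n - (m + n) = -m := by ring
  have t2 : r + (-m) • g = r - m • g := by rw [neg_smul, sub_eq_add_neg]
  have t3 : r + (m + n) • g = r + n • g + m • g := by rw [add_smul]; abel
  have t4 : r + (n - m) • g = r + n • g - m • g := by rw [sub_smul]; abel
  rw [t1, t2, t3, t4]
  have t5 : ((if m = -n then (m * c : ℂ) else 0)) = -(n * c * if m = -n then 1 else 0) := by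
    split_ifs with hm
    · rw [hm]; push_cast; ring
    · simp
  have t6 : ((if m = n then (m * c : ℂ) else 0)) = (n * c * if m = n then 1 else 0) := by
    split_ifs with hm
    · rw [hm]; ring
    · simp
  rw [t5, t6, mul_add, add_smul, neg_smul]
  abel

/-- Partial sums of the Casimir operator. -/
def casimirPartial (g : ι) (X : ι → ℤ → Module.End ℂ V) (M : ℕ) : Module.End ℂ V :=
  casimirTerm g X 0 + (2 : ℂ) • ∑ j ∈ Finset.range M, casimirTerm g X (j + 1)

/-- Telescoping leaves the outer flux. At the inner end, the weight one of the term `m = 0` against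
the weight two of the others leaves minus the sum of the fluxes at 0 and 1. That sum accounts for
the 1 in `1 + c`, and the cocycle at `m = 1` accounts for the `c`. -/
theorem IsPrincipalRep.casimirPartial_comm_one (h : IsPrincipalRep g c X) (hg : g ≠ 0) (r : ι)
    (M : ℕ) :
    casimirPartial g X (M + 1) * X r 1 - X r 1 * casimirPartial g X (M + 1) =
      -(2 * (1 + c)) • X r 1 + (2 : ℂ) • casimirFlux g X r 1 (M + 2) := by
  -- The four products pair off into the commutators of `X r 0` and of `X (r + g) 0` with `X r 1`,
  -- which are `X r 1` and `-X r 1` since `g ≠ 0`.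
  have hF : casimirFlux g X r 1 0 + casimirFlux g X r 1 1 = (2 : ℂ) • X r 1 := by
    have h1 := h.comm r 0 r 1 (Or.inl rfl)
    have h2 := h.comm (r + g) 0 r 1 (Or.inl rfl)
    simp [hg] at h1 h2
    simp only [casimirFlux, sub_zero, sub_self, one_smul, zero_smul, add_zero]
    rw [two_smul]
    rw [sub_eq_iff_eq_add] at h1 h2
    rw [h1, h2]
    abel
  have hsum : ∀ M : ℕ, (∑ j ∈ Finset.range (M + 1), casimirTerm g X (j + 1)) * X r 1 -
      X r 1 * ∑ j ∈ Finset.range (M + 1), casimirTerm g X (j + 1) =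
      casimirFlux g X r 1 (M + 2) - casimirFlux g X r 1 1 - c • X r 1 := by
    intro M
    induction M with
    | zero =>
      have := h.casimirTerm_comm 1 r 1 (Or.inl rfl)
      simpa using this
    | succ M ih =>
      rw [Finset.sum_range_succ, add_mul, mul_add, add_sub_add_comm, ih,
        h.casimirTerm_comm _ r 1 (Or.inl rfl)]
      have e1 : ¬ (((M + 1 : ℕ) : ℤ) + 1 = -1) := by omega
      have e2 : ¬ (((M + 1 : ℕ) : ℤ) + 1 = 1) := by omega
      rw [if_neg e1, if_neg e2]
      push_cast
      rw [show (M : ℤ) + 1 + 1 = M + 2 by ring, show (M : ℤ) + 2 + 1 = M + 1 + 2 by ring]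
      simp only [add_zero, mul_zero, zero_smul, sub_zero]
      abel
  have h0 := h.casimirTerm_comm 0 r 1 (Or.inl rfl)
  simp at h0
  rw [casimirPartial, add_mul, mul_add, add_sub_add_comm, smul_mul_assoc, mul_smul_comm,
    ← smul_sub, hsum, h0]
  have : casimirFlux g X r 1 0 = (2 : ℂ) • X r 1 - casimirFlux g X r 1 1 := by
    rw [← hF, add_sub_cancel_right]
  rw [this]
  module

theorem IsPrincipalRep.casimirPartial_comm_neg_one (h : IsPrincipalRep g c X) (hg : g ≠ 0) (r : ι)
    (M : ℕ) :
    casimirPartial g X (M + 1) * X r (-1) - X r (-1) * casimirPartial g X (M + 1) =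
      (2 * (1 + c)) • X r (-1) - (2 : ℂ) • casimirFlux g X r (-1) (M + 1) := by
  have hg' : r ≠ r - g := fun h => hg (sub_eq_self.mp h.symm)
  have hF : casimirFlux g X r (-1) 0 + casimirFlux g X r (-1) (-1) = (2 : ℂ) • X r (-1) := by
    have h1 := h.comm r 0 r (-1) (Or.inr rfl)
    have h2 := h.comm (r - g) 0 r (-1) (Or.inr rfl)
    simp [← sub_eq_add_neg, hg'] at h1 h2
    simp only [casimirFlux, sub_zero, sub_self, neg_smul, one_smul, zero_smul, add_zero,
      ← sub_eq_add_neg]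
    rw [two_smul]
    rw [sub_eq_iff_eq_add] at h1 h2
    rw [h1, h2]
    abel
  have hsum : ∀ M : ℕ, (∑ j ∈ Finset.range (M + 1), casimirTerm g X (j + 1)) * X r (-1) -
      X r (-1) * ∑ j ∈ Finset.range (M + 1), casimirTerm g X (j + 1) =
      casimirFlux g X r (-1) 0 - casimirFlux g X r (-1) (M + 1) + c • X r (-1) := by
    intro M
    induction M with
    | zero =>
      have := h.casimirTerm_comm 1 r (-1) (Or.inr rfl)
      simpa using this
    | succ M ih =>
      rw [Finset.sum_range_succ, add_mul, mul_add, add_sub_add_comm, ih,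
        h.casimirTerm_comm _ r (-1) (Or.inr rfl)]
      have e1 : ¬ (((M + 1 : ℕ) : ℤ) + 1 = - -1) := by omega
      have e2 : ¬ (((M + 1 : ℕ) : ℤ) + 1 = -1) := by omega
      rw [if_neg e1, if_neg e2]
      push_cast
      rw [show (M : ℤ) + 1 + 1 + -1 = M + 1 by ring]
      simp only [add_zero, mul_zero, zero_smul, sub_zero]
      abel
  have h0 := h.casimirTerm_comm 0 r (-1) (Or.inr rfl)
  simp at h0
  rw [casimirPartial, add_mul, mul_add, add_sub_add_comm, smul_mul_assoc, mul_smul_comm,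
    ← smul_sub, hsum, h0]
  have : casimirFlux g X r (-1) (-1) = (2 : ℂ) • X r (-1) - casimirFlux g X r (-1) 0 := by
    rw [← hF, add_sub_cancel_left]
  rw [this]
  module

theorem casimirTerm_apply_eq_zero {M : ℕ} {w : V} (hM : ∀ m : ℤ, M ≤ m → ∀ p, X p m w = 0)
    {m : ℤ} (hm : M ≤ m) : casimirTerm g X m w = 0 := by
  rw [casimirTerm, LinearMap.sum_apply]
  exact Finset.sum_eq_zero fun p _ => by rw [Module.End.mul_apply, hM m hm, map_zero]

theorem casimirPartial_apply_eq {M : ℕ} {w : V} (hM : ∀ m : ℤ, M ≤ m → ∀ p, X p m w = 0)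
    {M' : ℕ} (h : M ≤ M') : casimirPartial g X M' w = casimirPartial g X M w := by
  obtain ⟨d, rfl⟩ := Nat.exists_eq_add_of_le h
  rw [casimirPartial, casimirPartial, Finset.sum_range_add, smul_add, ← add_assoc,
    LinearMap.add_apply]
  convert add_zero _
  rw [LinearMap.smul_apply, LinearMap.sum_apply, Finset.sum_eq_zero, smul_zero]
  intro j _
  exact casimirTerm_apply_eq_zero hM (by push_cast; omega)

/-- The Casimir operator of a smooth module. -/
def casimir (h : IsPrincipalRep g c X) : Module.End ℂ V where
  toFun w := casimirPartial g X (h.smooth w).choose w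
  map_add' v w := by
    have hv := (h.smooth v).choose_spec
    have hw := (h.smooth w).choose_spec
    have hvw := (h.smooth (v + w)).choose_spec
    set a := (h.smooth v).choose
    set b := (h.smooth w).choose
    set d := (h.smooth (v + w)).choose
    rw [← casimirPartial_apply_eq hv (le_max_left a (max b d)),
      ← casimirPartial_apply_eq hw ((le_max_left b d).trans (le_max_right a _)),
      ← casimirPartial_apply_eq hvw ((le_max_right b d).trans (le_max_right a _)), map_add]
  map_smul' s v := by
    have hv := (h.smooth v).choose_spec
    have hsv := (h.smooth (s • v)).choose_spec
    set a := (h.smooth v).choose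
    set d := (h.smooth (s • v)).choose
    rw [← casimirPartial_apply_eq hv (le_max_left a d),
      ← casimirPartial_apply_eq hsv (le_max_right a d), map_smul, RingHom.id_apply]

theorem casimir_apply_eq (h : IsPrincipalRep g c X) {M : ℕ} {w : V}
    (hM : ∀ m : ℤ, M ≤ m → ∀ p, X p m w = 0) : casimir h w = casimirPartial g X M w := by
  have hw := (h.smooth w).choose_spec
  change casimirPartial g X (h.smooth w).choose w = _
  rw [← casimirPartial_apply_eq hw (le_max_left _ M), casimirPartial_apply_eq hM (le_max_right _ _)]

theorem exists_casimir_apply_eq (h : IsPrincipalRep g c X) (v w : V) : ∃ M : ℕ,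
    (∀ m : ℤ, M ≤ m → ∀ p, X p m v = 0) ∧ (∀ m : ℤ, M ≤ m → ∀ p, X p m w = 0) ∧
    casimir h v = casimirPartial g X (M + 1) v ∧ casimir h w = casimirPartial g X (M + 1) w := by
  obtain ⟨a, ha⟩ := h.smooth v
  obtain ⟨b, hb⟩ := h.smooth w
  have ha' : ∀ m : ℤ, (max a b : ℕ) ≤ m → ∀ p, X p m v = 0 := fun m hm => ha m (by omega)
  have hb' : ∀ m : ℤ, (max a b : ℕ) ≤ m → ∀ p, X p m w = 0 := fun m hm => hb m (by omega)
  exact ⟨max a b, ha', hb', casimir_apply_eq h fun m hm => ha' m (by push_cast at *; omega),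
    casimir_apply_eq h fun m hm => hb' m (by push_cast at *; omega)⟩

/-- Both products in the outer flux first apply an operator of degree `M + 2`, which kills `w`. Up
to an additive constant on words, the Casimir operator thus acts as a multiple of the degree,
although no degree derivation is available. -/
theorem casimir_apply_one (h : IsPrincipalRep g c X) (hg : g ≠ 0) (r : ι) (w : V) :
    casimir h (X r 1 w) = X r 1 (casimir h w) - (2 * (1 + c)) • X r 1 w := by
  obtain ⟨M, hM, hM', e1, e2⟩ := exists_casimir_apply_eq h w (X r 1 w)
  have := LinearMap.congr_fun (h.casimirPartial_comm_one hg r M) w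
  simp only [LinearMap.sub_apply, LinearMap.add_apply, Module.End.mul_apply, LinearMap.smul_apply,
    casimirFlux, hM (M + 2) (by omega), map_zero] at this
  rw [e1, e2, sub_eq_iff_eq_add.mp this]
  module

theorem casimir_apply_neg_one (h : IsPrincipalRep g c X) (hg : g ≠ 0) (r : ι) (w : V) :
    casimir h (X r (-1) w) = X r (-1) (casimir h w) + (2 * (1 + c)) • X r (-1) w := by
  obtain ⟨M, hM, hM', e1, e2⟩ := exists_casimir_apply_eq h w (X r (-1) w)
  have := LinearMap.congr_fun (h.casimirPartial_comm_neg_one hg r M) w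
  simp only [LinearMap.sub_apply, Module.End.mul_apply, LinearMap.smul_apply,
    casimirFlux, hM (M + 1) (by omega), map_zero] at this
  rw [e1, e2, sub_eq_iff_eq_add.mp this]
  module

/-- The Casimir operator on vectors of weight `b` killed by all positive operators. -/
theorem casimir_apply_singular (h : IsPrincipalRep g c X) {w : V} {b : ι → ℂ}
    (hw : ∀ p m, 0 < m → X p m w = 0) (hb : ∀ p, X p 0 w = b p • w) :
    casimir h w = (∑ p, b p ^ 2) • w := by
  rw [casimir_apply_eq h (M := 1) fun m hm p => hw p m (by omega), casimirPartial]
  simp only [LinearMap.add_apply, LinearMap.smul_apply, Finset.range_one, Finset.sum_singleton]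
  rw [casimirTerm_apply_eq_zero (M := 1) (m := (0 : ℕ) + 1) (fun m hm p => hw p m (by omega))
    (by simp), smul_zero, add_zero, casimirTerm, LinearMap.sum_apply, Finset.sum_smul]
  refine Finset.sum_congr rfl fun p _ => ?_
  rw [Module.End.mul_apply, hb, map_smul, zero_smul, add_zero, neg_zero, hb, smul_smul, sq]

theorem casimir_mem (h : IsPrincipalRep g c X) {W : Submodule ℂ V}
    (hW : ∀ p m, ∀ w ∈ W, X p m w ∈ W) {w : V} (hw : w ∈ W) : casimir h w ∈ W := by
  have ht : ∀ m, casimirTerm g X m w ∈ W := fun m => by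
    rw [casimirTerm, LinearMap.sum_apply]
    exact sum_mem fun p _ => hW _ _ _ (hW _ _ _ hw)
  change casimirPartial g X _ w ∈ W
  rw [casimirPartial, LinearMap.add_apply, LinearMap.smul_apply, LinearMap.sum_apply]
  exact W.add_mem (ht 0) (W.smul_mem _ (sum_mem fun j _ => ht _))

end Casimir

/-! ### Irreducibility of integrable highest weight modules -/

section Irreducible

variable {V : Type*} [AddCommGroup V] [Module ℂ V]

/-- The action of a raising operator `P` on the vectors `f ^ n v`, where `P` and `f` generate a
copy of `sl₂` up to an operator `G` which is zero on `v` and commutes with `f`. -/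
theorem raise_pow_apply {P f H G : Module.End ℂ V} (hP : P * f - f * P = H)
    (hH : H * f - f * H = G - (2 : ℂ) • f) (hG : G * f = f * G) {v : V} {l : ℂ} (hPv : P v = 0)
    (hHv : H v = l • v) (hGv : G v = 0) (n : ℕ) :
    P ((f ^ (n + 1)) v) = ((n + 1) * (l - n) : ℂ) • (f ^ n) v := by
  have h1 : ∀ n : ℕ, G ((f ^ n) v) = 0 := fun n => by
    have : Commute G (f ^ n) := Commute.pow_right hG n
    rw [← Module.End.mul_apply, this.eq, Module.End.mul_apply, hGv, map_zero]
  have h2 : ∀ n : ℕ, H ((f ^ n) v) = (l - 2 * n) • (f ^ n) v := by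
    intro n
    induction n with
    | zero => simp [hHv]
    | succ n ih =>
      have := LinearMap.congr_fun hH ((f ^ n) v)
      simp only [LinearMap.sub_apply, Module.End.mul_apply, LinearMap.smul_apply, h1, ih, map_smul,
        ← pow_succ' f n, ← Module.End.mul_apply f (f ^ n) v] at this
      rw [sub_eq_iff_eq_add.mp this]
      push_cast
      module
  induction n with
  | zero =>
    have := LinearMap.congr_fun hP v
    simp only [LinearMap.sub_apply, Module.End.mul_apply, hPv, hHv, map_zero, sub_zero] at this
    simp [this]
  | succ n ih =>
    have := LinearMap.congr_fun hP ((f ^ (n + 1)) v)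
    simp only [LinearMap.sub_apply, Module.End.mul_apply, h2, ih, map_smul,
      ← pow_succ' f, ← Module.End.mul_apply f (f ^ n) v,
      ← Module.End.mul_apply f (f ^ (n + 1)) v] at this
    rw [sub_eq_iff_eq_add.mp this]
    push_cast
    module

/-- At the least power of `f` killing `v`, the left side is zero while the vector on the right is
not, so the scalar factor vanishes. -/
theorem exists_nat_of_raise {P f : Module.End ℂ V} {v : V} {l : ℂ}
    (h : ∀ n : ℕ, P ((f ^ (n + 1)) v) = ((n + 1) * (l - n) : ℂ) • (f ^ n) v) (hv : v ≠ 0)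
    (hf : ∃ n : ℕ, (f ^ n) v = 0) : ∃ m : ℕ, l = m := by
  classical
  have hn := Nat.find_spec hf
  rcases hm : Nat.find hf with _ | m
  · rw [hm] at hn
    exact absurd hn hv
  · have hmin := Nat.find_min hf (m := m) (by omega)
    have := h m
    rw [← hm, hn, map_zero, eq_comm, smul_eq_zero_iff_left hmin, mul_eq_zero, sub_eq_zero] at this
    exact ⟨m, this.resolve_left (Nat.cast_add_one_ne_zero m)⟩

variable {ι : Type*} [AddCommGroup ι] [Fintype ι] [DecidableEq ι]
variable {g : ι} {c : ℂ} {X : ι → ℤ → Module.End ℂ V}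

/-- The operators of degree `s = ±1` generate all those of degrees `s m`, `m ≥ 1`. -/
theorem IsPrincipalRep.generate (h : IsPrincipalRep g c X)
    (hgen : ∀ p q : ι, ∃ j : ℕ, q = p + j • g) {s : ℤ} (hs : s = 1 ∨ s = -1)
    {A : Submodule ℂ (Module.End ℂ V)} (hA : ∀ x ∈ A, ∀ y ∈ A, x * y - y * x ∈ A)
    (h1 : ∀ p, X p s ∈ A) (m : ℕ) : ∀ p, X p (s * (m + 1)) ∈ A := by
  induction m with
  | zero => simpa using h1
  | succ m ih =>
    -- The second operator starts in the column where the first one ends. The product in the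
    -- opposite order survives only if the total degree shifts indices by zero.
    have key : ∀ p, X p (s * (m + 1) + s) - (if p = p + (s * (m + 1)) • g + s • g then
        X (p + (s * (m + 1)) • g) (s * (m + 1) + s) else 0) ∈ A := by
      intro p
      have := hA _ (ih p) _ (h1 (p + (s * (m + 1)) • g))
      rw [h.comm _ _ _ _ hs, if_pos rfl, if_neg (c := _ ∧ _), zero_smul, add_zero] at this
      · exact this
      · rcases hs with rfl | rfl <;> omega
    have e : s * ((m + 1 : ℕ) + 1) = s * (m + 1) + s := by push_cast; ring
    rw [e]
    have e' : ∀ p, (p = p + (s * (m + 1)) • g + s • g) = ((s * (m + 1) + s) • g = 0) := fun p => by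
      rw [add_assoc, ← add_smul, eq_iff_iff, eq_comm, add_eq_left]
    by_cases hz : (s * (m + 1) + s) • g = 0
    · have hstep : ∀ p, X p (s * (m + 1) + s) - X (p + (s * (m + 1)) • g) (s * (m + 1) + s) ∈ A := by
        intro p
        have := key p
        rwa [if_pos ((e' p).mpr hz)] at this
      have hz' : (s * (m + 1)) • g = - (s • g) := by
        rw [add_smul] at hz; exact eq_neg_of_add_eq_zero_left hz
      rw [hz'] at hstep
      set d : ι → Module.End ℂ V := fun p => X p (s * (m + 1) + s) with hd
      have hstep' : ∀ p, d (p + g) - d p ∈ A := by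
        intro p
        rcases hs with rfl | rfl
        · have := hstep (p + g)
          rwa [one_smul, add_neg_cancel_right] at this
        · have := hstep p
          rw [neg_smul, one_smul, neg_neg] at this
          rw [← neg_sub]
          exact A.neg_mem this
      have hd' : ∀ p q, d q - d p ∈ A := by
        intro p q
        obtain ⟨j, rfl⟩ := hgen p q
        induction j with
        | zero => simp
        | succ j ihj =>
          have := A.add_mem (hstep' (p + j • g)) ihj
          rwa [sub_add_sub_cancel, add_assoc, ← succ_nsmul] at this
      intro p
      -- In diagonal degrees the brackets give only differences; averaging them over `q` with the
      -- trace relation isolates `X p`.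
      have hsum : ∑ q, (d p - d q) ∈ A := sum_mem fun q _ => hd' q p
      rw [Finset.sum_sub_distrib, h.trace _ hz, sub_zero, Finset.sum_const, Finset.card_univ,
        ← Nat.cast_smul_eq_nsmul ℂ] at hsum
      have : Nonempty ι := ⟨p⟩
      exact (A.smul_mem_iff (Nat.cast_ne_zero.mpr Fintype.card_ne_zero)).mp hsum
    · intro p
      have := key p
      rwa [if_neg (fun h => hz ((e' p).mp h)), sub_zero] at this

/-- The operators killing `u` are closed under commutators, and degree one generates all positive
degrees. -/
theorem IsPrincipalRep.apply_pos_eq_zero (h : IsPrincipalRep g c X)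
    (hgen : ∀ p q : ι, ∃ j : ℕ, q = p + j • g) {u : V} (hu : ∀ p, X p 1 u = 0) (p : ι) (m : ℤ)
    (hm : 0 < m) : X p m u = 0 := by
  have := h.generate hgen (Or.inl rfl) (A := LinearMap.ker (LinearMap.applyₗ u))
    (fun x hx y hy => by
      simp only [LinearMap.mem_ker, LinearMap.applyₗ_apply_apply, LinearMap.sub_apply,
        Module.End.mul_apply] at hx hy ⊢
      rw [hx, hy, map_zero, map_zero, sub_zero]) (fun p => hu p) (m - 1).toNat p
  rw [Int.toNat_of_nonneg (by omega), one_mul, sub_add_cancel] at this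
  exact this

/-- Products of lowering operators applied to `v`. -/
def word (g : ι) (X : ι → ℤ → Module.End ℂ V) (v : V) : List ι → V
  | [] => v
  | p :: l => X (p + g) (-1) (word g X v l)

/-- The joint eigenvalues of the Casimir operator and the Cartan subalgebra on `word`. -/
def wordEigenvalue (g : ι) (c : ℂ) (a : ι → ℂ) (l : List ι) : Option ι → ℂ
  | none => ∑ p, a p ^ 2 + 2 * (1 + c) * l.length
  | some q => a q + (l.map fun p => (if q = p + g then 1 else 0) - if q = p then 1 else 0).sum

/-- The Casimir operator and the Cartan subalgebra. -/
def casimirOrCartan (h : IsPrincipalRep g c X) : Option ι → Module.End ℂ V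
  | none => casimir h
  | some q => X q 0

variable {v : V} {a : ι → ℂ}

theorem casimirOrCartan_word (h : IsPrincipalRep g c X) (hg : g ≠ 0)
    (hpos : ∀ p m, 0 < m → X p m v = 0) (hwt : ∀ p, X p 0 v = a p • v) (l : List ι)
    (i : Option ι) :
    casimirOrCartan h i (word g X v l) = wordEigenvalue g c a l i • word g X v l := by
  induction l with
  | nil =>
    cases i with
    | none => simpa [casimirOrCartan, wordEigenvalue, word] using casimir_apply_singular h hpos hwt
    | some q => simpa [casimirOrCartan, wordEigenvalue, word] using hwt q
  | cons p l ih =>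
    cases i with
    | none =>
      simp only [casimirOrCartan, wordEigenvalue, word] at ih ⊢
      rw [casimir_apply_neg_one h hg, ih, map_smul, List.length_cons]
      push_cast
      module
    | some q =>
      simp only [casimirOrCartan, wordEigenvalue, word, List.map_cons, List.sum_cons] at ih ⊢
      have h1 := LinearMap.congr_fun (h.comm q 0 (p + g) (-1) (Or.inr rfl)) (word g X v l)
      simp only [LinearMap.sub_apply, Module.End.mul_apply, ih, map_smul,
        zero_smul, add_zero, zero_add, neg_smul, one_smul, add_neg_cancel_right, Int.cast_zero,
        zero_mul, ite_self] at h1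
      rw [sub_eq_iff_eq_add.mp h1]
      have e1 : (if p + g = q then X q (-1) else 0) (word g X v l) =
          (if q = p + g then (1 : ℂ) else 0) • X (p + g) (-1) (word g X v l) := by
        split_ifs with h2 h3 h3
        · rw [h2, one_smul]
        · exact absurd h2.symm h3
        · exact absurd h3.symm h2
        · simp
      have e2 : (if q = p then X (p + g) (-1) else 0) (word g X v l) =
          (if q = p then (1 : ℂ) else 0) • X (p + g) (-1) (word g X v l) := by
        split_ifs <;> simp
      rw [e1, e2]
      module

/-- The Casimir eigenvalue is an affine function of the length with slope `2 (1 + c)`, nonzero at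
noncritical level. Hence no nonempty word has the character of the highest weight vector. -/
theorem eq_nil_of_wordEigenvalue_eq (hc : 1 + c ≠ 0) {l : List ι}
    (h : wordEigenvalue g c a l = wordEigenvalue g c a []) : l = [] := by
  have := congrFun h none
  simpa [wordEigenvalue, hc] using this

theorem casimirOrCartan_mem (h : IsPrincipalRep g c X) {W : Submodule ℂ V}
    (hW : ∀ p m, ∀ w ∈ W, X p m w ∈ W) (i : Option ι) (w : V) (hw : w ∈ W) :
    casimirOrCartan h i w ∈ W := by
  cases i with
  | none => exact casimir_mem h hW hw
  | some q => exact hW q 0 w hw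

/-- Proper submodules of a highest weight module of noncritical level have a proper sum. -/
theorem IsPrincipalRep.notMem_sup (h : IsPrincipalRep g c X) (hg : g ≠ 0) (hc : 1 + c ≠ 0)
    (hpos : ∀ p m, 0 < m → X p m v = 0) (hwt : ∀ p, X p 0 v = a p • v)
    (hspan : Submodule.span ℂ (Set.range (word g X v)) = ⊤) {W₁ W₂ : Submodule ℂ V}
    (hW₁ : ∀ p m, ∀ w ∈ W₁, X p m w ∈ W₁) (hW₂ : ∀ p m, ∀ w ∈ W₂, X p m w ∈ W₂)
    (h₁ : v ∉ W₁) (h₂ : v ∉ W₂) : v ∉ W₁ ⊔ W₂ :=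
  notMem_sup_of_notMem (j₀ := []) (casimirOrCartan_word h hg hpos hwt) hspan
    (fun _ => eq_nil_of_wordEigenvalue_eq hc) (casimirOrCartan_mem h hW₁)
    (casimirOrCartan_mem h hW₂) h₁ h₂

/-- Pairs a vector `s` with a sum of negatives of simple roots. It serves with `s = a + b`, where `b
- a` is such a sum, to evaluate a difference of squares. -/
theorem sum_list_ite_mul (s : ι → ℂ) (l : List ι) :
    ∑ q, (l.map fun p => (if q = p + g then (1 : ℂ) else 0) - if q = p then 1 else 0).sum * s q =
      (l.map fun p => s (p + g) - s p).sum := by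
  induction l with
  | nil => simp
  | cons p l ih => simp [add_mul, sub_mul, Finset.sum_add_distrib, Finset.sum_sub_distrib, ih]

/-- `X p 1` and `X (p + g) (-1)` generate an `sl₂` whose coroot has the value `b p - b (p + g) + c`
on `u`; no error term is needed, whence `G = 0`. -/
theorem IsPrincipalRep.raise_lower (h : IsPrincipalRep g c X) (hg : g ≠ 0) (p : ι) {u : V}
    {b : ι → ℂ} (hu : X p 1 u = 0) (hb : ∀ p, X p 0 u = b p • u) (n : ℕ) :
    X p 1 ((X (p + g) (-1) ^ (n + 1)) u) =
      ((n + 1) * ((b p - b (p + g) + c) - n) : ℂ) • (X (p + g) (-1) ^ n) u := by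
  have h1 := h.comm p 1 (p + g) (-1) (Or.inr rfl)
  have h2 := h.comm p 0 (p + g) (-1) (Or.inr rfl)
  have h3 := h.comm (p + g) 0 (p + g) (-1) (Or.inr rfl)
  simp only [one_smul, neg_smul, zero_smul, add_zero, add_neg_cancel_right, if_true, zero_add,
    add_eq_left, hg, if_false, Int.cast_zero, zero_mul, ite_self, and_self, Int.cast_one,
    one_mul, add_neg_cancel, zero_sub, sub_zero] at h1 h2 h3
  refine raise_pow_apply (G := 0) h1 ?_ (by simp) hu ?_ (by simp) n
  · rw [zero_sub]
    rw [sub_eq_iff_eq_add] at h2 h3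
    rw [add_mul, sub_mul, h2, h3, mul_add, mul_sub, smul_mul_assoc, one_mul, mul_smul_comm, mul_one,
      two_smul]
    abel
  · simp only [LinearMap.add_apply, LinearMap.sub_apply, hb, LinearMap.smul_apply,
      Module.End.one_apply]
    module

/-- Integrable highest weight modules of dominant integral highest weight are irreducible. -/
theorem IsPrincipalRep.highestWeightVector_mem (h : IsPrincipalRep g c X) (hg : g ≠ 0)
    (hgen : ∀ p q : ι, ∃ j : ℕ, q = p + j • g) (hc : 1 + c ≠ 0)
    (hpos : ∀ p m, 0 < m → X p m v = 0) (hwt : ∀ p, X p 0 v = a p • v)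
    (hspan : Submodule.span ℂ (Set.range (word g X v)) = ⊤)
    (hdom : ∀ p, ∃ m : ℕ, a p - a (p + g) + c = m) (hnil : ∀ p, LocNil (X p (-1)))
    {W : Submodule ℂ V} (hW : ∀ p m, ∀ w ∈ W, X p m w ∈ W) (hne : W ≠ ⊥) : v ∈ W := by
  classical
  have hw := casimirOrCartan_word h hg hpos hwt
  -- Among the joint eigenvectors in `W`, one whose character belongs to a shortest word will be
  -- chosen.
  have hex : ∃ n : ℕ, ∃ l : List ι, l.length = n ∧ ∃ u ∈ W, u ≠ 0 ∧
      (∀ i, casimirOrCartan h i u = wordEigenvalue g c a l i • u) ∧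
      u ∈ Submodule.span ℂ (word g X v '' {j | wordEigenvalue g c a j = wordEigenvalue g c a l}) := by
    obtain ⟨l, u, hu⟩ := exists_joint_eigenvector hw hspan (casimirOrCartan_mem h hW) hne
    exact ⟨_, l, rfl, u, hu⟩
  obtain ⟨l, hl, u, huW, hu0, hu, hu'⟩ := Nat.find_spec hex
  have hmin := fun n => Nat.find_min hex (m := n)
  rw [← hl] at hmin
  -- A nonzero `X r 1 u` would again be a joint eigenvector, with Casimir eigenvalue lowered by `2
  -- (1 + c)`, hence belonging to a word shorter by one.
  have hsing : ∀ r, X r 1 u = 0 := by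
    intro r
    by_contra hr
    have hstab : ∀ i, ∃ s : ℂ, casimirOrCartan h i (X r 1 u) = s • X r 1 u ∧
        (i = none → s = wordEigenvalue g c a l none - 2 * (1 + c)) := by
      intro i
      cases i with
      | none =>
        refine ⟨_, ?_, fun _ => rfl⟩
        have := hu none
        simp only [casimirOrCartan] at this ⊢
        rw [casimir_apply_one h hg, this, map_smul, sub_smul]
      | some q =>
        refine ⟨wordEigenvalue g c a l (some q) + (if r = q then 1 else 0) -
          if q = r + g then 1 else 0, ?_, by simp⟩
        have h1 := LinearMap.congr_fun (h.comm q 0 r 1 (Or.inl rfl)) u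
        have h2 := hu (some q)
        simp only [casimirOrCartan] at h2 ⊢
        simp only [LinearMap.sub_apply, Module.End.mul_apply, h2, map_smul,
          zero_smul, add_zero, zero_add, one_smul, Int.cast_zero, zero_mul, ite_self] at h1
        rw [sub_eq_iff_eq_add.mp h1, sub_smul, add_smul]
        have e1 : (if r = q then X q 1 else 0) u = (if r = q then (1 : ℂ) else 0) • X r 1 u := by
          split_ifs with h3
          · rw [h3, one_smul]
          · simp
        have e2 : (if q = r + g then X r 1 else 0) u =
            (if q = r + g then (1 : ℂ) else 0) • X r 1 u := by
          split_ifs <;> simp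
        rw [e1, e2]
        abel
    -- The line through `X r 1 u` is stable, so its character is that of some word `j`, whose length
    -- the Casimir eigenvalue then determines.
    obtain ⟨j, u', hu'm, hu'0, hu'F, hu's⟩ := exists_joint_eigenvector hw hspan
      (W := Submodule.span ℂ {X r 1 u}) (fun i w hw => by
        obtain ⟨t, rfl⟩ := Submodule.mem_span_singleton.mp hw
        obtain ⟨s, hs, _⟩ := hstab i
        rw [map_smul, hs]
        exact Submodule.smul_mem _ _ (Submodule.smul_mem _ _ (Submodule.mem_span_singleton_self _)))
      (by rwa [Ne, Submodule.span_singleton_eq_bot])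
    obtain ⟨t, rfl⟩ := Submodule.mem_span_singleton.mp hu'm
    obtain ⟨s, hs, hs'⟩ := hstab none
    have hF := hu'F none
    rw [map_smul, hs, smul_smul, smul_smul, ← sub_eq_zero, ← sub_smul,
      smul_eq_zero_iff_left hr, mul_comm t, ← sub_mul, mul_eq_zero_iff_right
        (fun ht => hu'0 (by rw [ht, zero_smul])), hs' rfl] at hF
    have hlen : j.length + 1 = l.length := by
      simp only [wordEigenvalue] at hF
      have : 2 * (1 + c) * ((l.length : ℂ) - (j.length + 1)) = 0 := by linear_combination hF
      rw [mul_eq_zero_iff_left (mul_ne_zero two_ne_zero hc), sub_eq_zero] at this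
      exact_mod_cast this.symm
    exact hmin j.length (by omega) ⟨j, rfl, _, W.smul_mem _ (hW _ _ _ huW), hu'0, hu'F, hu's⟩
  set b : ι → ℂ := fun q => wordEigenvalue g c a l (some q) with hb
  have hbu : ∀ p, X p 0 u = b p • u := fun p => hu (some p)
  -- Singularity of `u` and local nilpotency of the lowering operators make the weight of `u`
  -- dominant as well.
  have hdom' : ∀ p, ∃ m : ℕ, b p - b (p + g) + c = m := fun p =>
    exists_nat_of_raise (h.raise_lower hg p (hsing p) hbu) hu0 (hnil _ u)
  choose m hm using hdom
  choose m' hm' using hdom'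
  have hcas := hu none
  simp only [casimirOrCartan] at hcas
  rw [casimir_apply_singular h (h.apply_pos_eq_zero hgen hsing) hbu, ← sub_eq_zero, ← sub_smul,
    smul_eq_zero_iff_left hu0] at hcas
  -- The difference of squares is the pairing of `b - a` with `a + b`, and each letter `p` of the
  -- word contributes `2 c - (m p + m' p)`.
  have hsq : ∑ q, b q ^ 2 - ∑ q, a q ^ 2 = 2 * c * l.length - ((l.map fun p => m p + m' p).sum : ℕ) := by
    have h1 : ∑ q, b q ^ 2 - ∑ q, a q ^ 2 = ∑ q, (l.map fun p => (if q = p + g then (1 : ℂ) else 0) -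
        if q = p then 1 else 0).sum * (a q + b q) := by
      rw [← Finset.sum_sub_distrib]
      refine Finset.sum_congr rfl fun q _ => ?_
      simp only [hb, wordEigenvalue]
      ring
    rw [h1, sum_list_ite_mul (fun q => a q + b q)]
    have h2 : ∀ p, a (p + g) + b (p + g) - (a p + b p) = 2 * c - ((m p + m' p : ℕ) : ℂ) := by
      intro p
      push_cast
      rw [← hm, ← hm']
      ring
    simp only [h2]
    clear * -
    induction l with
    | nil => simp
    | cons p l ih =>
      simp only [List.map_cons, List.sum_cons, ih, List.length_cons]
      push_cast
      ring
  -- Subtracting the Casimir eigenvalue cancels the terms in `c` and leaves a sum of natural numbers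
  -- equal to zero, one of them twice the length.
  have hl0 : l = [] := by
    simp only [wordEigenvalue] at hcas
    have : ((2 * l.length + (l.map fun p => m p + m' p).sum : ℕ) : ℂ) = 0 := by
      push_cast at hsq ⊢
      linear_combination hsq - hcas
    have := Nat.cast_eq_zero.mp this
    exact List.length_eq_zero_iff.mp (by omega)
  subst hl0
  have hset : {j | wordEigenvalue g c a j = wordEigenvalue g c a []} = {[]} := by
    ext j
    exact ⟨eq_nil_of_wordEigenvalue_eq hc, by rintro rfl; rfl⟩
  rw [hset, Set.image_singleton] at hu'
  obtain ⟨t, rfl⟩ := Submodule.mem_span_singleton.mp hu'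
  exact (W.smul_mem_iff fun ht => hu0 (by rw [ht, zero_smul])).mp huW

end Irreducible

/-! ### Orders of Laurent series and commutators in central extensions -/

/-- The coefficients of `f` below `ξ ^ r` are zero. -/
def OrdGE (r : ℤ) (f : Laurent) : Prop := ∀ m < r, f.coeff m = 0

theorem OrdGE.mono {r s : ℤ} {f : Laurent} (h : OrdGE r f) (hs : s ≤ r) : OrdGE s f :=
  fun m hm => h m (hm.trans_le hs)

theorem OrdGE.mul {r s : ℤ} {f g : Laurent} (hf : OrdGE r f) (hg : OrdGE s g) :
    OrdGE (r + s) (f * g) := fun m hm => by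
  rw [HahnSeries.coeff_mul]
  refine Finset.sum_eq_zero fun ij hij => ?_
  have h : ij.1 + ij.2 = m := (Finset.mem_antidiagonal.mp hij).2.2
  rcases lt_or_ge ij.1 r with h1 | h1
  · rw [hf _ h1, zero_mul]
  · rw [hg _ (by omega), mul_zero]

theorem OrdGE.add {r : ℤ} {f g : Laurent} (hf : OrdGE r f) (hg : OrdGE r g) :
    OrdGE r (f + g) := fun m hm => by rw [HahnSeries.coeff_add, hf m hm, hg m hm, add_zero]

theorem OrdGE.sub {r : ℤ} {f g : Laurent} (hf : OrdGE r f) (hg : OrdGE r g) :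
    OrdGE r (f - g) := fun m hm => by rw [HahnSeries.coeff_sub, hf m hm, hg m hm, sub_zero]

theorem ordGE_zero (r : ℤ) : OrdGE r 0 := fun _ _ => rfl

theorem OrdGE.sum {ι : Type*} {s : Finset ι} {r : ℤ} {f : ι → Laurent}
    (hf : ∀ i ∈ s, OrdGE r (f i)) : OrdGE r (∑ i ∈ s, f i) := fun m hm => by
  rw [HahnSeries.coeff_sum]
  exact Finset.sum_eq_zero fun i hi => hf i hi m hm

theorem OrdGE.derivative {r : ℤ} {f : Laurent} (hf : OrdGE r f) :
    OrdGE (r - 1) (LaurentSeries.derivative ℂ f) := fun m hm => by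
  rw [coeff_derivative, hf _ (by omega), mul_zero]

theorem ordGE_single {m r : ℤ} (h : r ≤ m) (a : ℂ) : OrdGE r (HahnSeries.single m a) :=
  fun n hn => HahnSeries.coeff_single_of_ne (by omega)

theorem exists_ordGE (f : Laurent) : ∃ r ≤ 0, OrdGE r f := by
  by_cases h : f = 0
  · exact ⟨0, le_rfl, h ▸ ordGE_zero 0⟩
  · refine ⟨min 0 f.order, min_le_left _ _, fun m hm => HahnSeries.coeff_eq_zero_of_lt_order ?_⟩
    exact hm.trans_le (min_le_right _ _)

theorem derivative_single (m : ℤ) (a : ℂ) :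
    LaurentSeries.derivative ℂ (HahnSeries.single m a) = HahnSeries.single (m - 1) (m * a) := by
  ext n
  rw [coeff_derivative]
  by_cases h : n + 1 = m
  · subst h; simp
  · rw [HahnSeries.coeff_single_of_ne h, HahnSeries.coeff_single_of_ne (by omega), mul_zero]

section

variable {N : ℕ}

/-- The coefficients of all entries of `A` below `ξ ^ r` are zero. -/
def MatOrdGE (r : ℤ) (A : Matrix (Fin N) (Fin N) Laurent) : Prop := ∀ p q, OrdGE r (A p q)

theorem MatOrdGE.mul {r s : ℤ} {A B : Matrix (Fin N) (Fin N) Laurent} (hA : MatOrdGE r A)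
    (hB : MatOrdGE s B) : MatOrdGE (r + s) (A * B) := fun p q => by
  rw [Matrix.mul_apply]
  exact OrdGE.sum fun i _ => (hA p i).mul (hB i q)

theorem exists_matOrdGE (A : Matrix (Fin N) (Fin N) Laurent) : ∃ r ≤ 0, MatOrdGE r A := by
  choose r hr h using fun p q => exists_ordGE (A p q)
  have h1 : ∃ s ≤ 0, ∀ i : Fin N × Fin N, s ≤ r i.1 i.2 := by
    obtain ⟨s, hs⟩ := Finite.bddBelow_range fun i : Fin N × Fin N => r i.1 i.2
    exact ⟨min 0 s, min_le_left _ _, fun i => (min_le_right _ _).trans (hs ⟨i, rfl⟩)⟩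
  obtain ⟨s, hs, h1⟩ := h1
  exact ⟨s, hs, fun p q => (h p q).mono (h1 (p, q))⟩

/-- Differentiation lowers the order by one, so the product has order at least `r + s - 1 ≥ 0` and
no residue. -/
theorem resPairing_eq_zero {r s : ℤ} {A B : Matrix (Fin N) (Fin N) Laurent} (hA : MatOrdGE r A)
    (hB : MatOrdGE s B) (h : 0 < r + s) : resPairing A B = 0 := by
  have h1 : MatOrdGE (r - 1) (A.map (LaurentSeries.derivative ℂ)) := fun p q => (hA p q).derivative
  have h2 := h1.mul hB
  exact OrdGE.sum (s := Finset.univ) (fun i _ => h2 i i) (-1) (by omega)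

theorem resPairing_sub_left (A A' B : Matrix (Fin N) (Fin N) Laurent) :
    resPairing (A - A') B = resPairing A B - resPairing A' B := by
  rw [eq_sub_iff_add_eq, ← resPairing_add_left, sub_add_cancel]

theorem resPairing_single_left (p q : Fin N) (f : Laurent)
    (B : Matrix (Fin N) (Fin N) Laurent) :
    resPairing (Matrix.single p q f) B = (LaurentSeries.derivative ℂ f * B q p).coeff (-1) := by
  have : (Matrix.single p q f).map (LaurentSeries.derivative ℂ) =
      Matrix.single p q (LaurentSeries.derivative ℂ f) := by
    ext1 i j
    by_cases h : p = i ∧ q = j <;> simp [h]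
  rw [resPairing, this, Matrix.trace_single_mul, smul_eq_mul]

/-- This makes the scalar corrections in `letterMat` invisible to the cocycle. -/
theorem resPairing_scalar_left (f : Laurent) {B : Matrix (Fin N) (Fin N) Laurent}
    (hB : B.trace = 0) : resPairing (Matrix.scalar (Fin N) f) B = 0 := by
  have : (Matrix.scalar (Fin N) f).map (LaurentSeries.derivative ℂ) =
      Matrix.scalar (Fin N) (LaurentSeries.derivative ℂ f) := by
    ext1 i j
    by_cases h : i = j <;> simp [Matrix.scalar_apply, h]
  rw [resPairing, this, Matrix.scalar_apply, ← Matrix.smul_eq_diagonal_mul, Matrix.trace_smul, hB,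
    smul_zero, HahnSeries.coeff_zero]

variable {K : LieSubalgebra ℂ (Matrix (Fin N) (Fin N) Laurent)} {c : ℂ}

theorem Aff.ext_mat {x y : Aff K c} (h1 : x.mat = y.mat) (h2 : x.2 = y.2) : x = y :=
  Prod.ext (Subtype.ext h1) h2

theorem Aff.mat_lie (x y : Aff K c) : ⁅x, y⁆.mat = x.mat * y.mat - y.mat * x.mat := rfl

theorem Aff.snd_lie (x y : Aff K c) : ⁅x, y⁆.2 = c * resPairing x.mat y.mat := rfl

theorem Aff.mat_add (x y : Aff K c) : (x + y).mat = x.mat + y.mat := rfl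

theorem Aff.mat_sub (x y : Aff K c) : (x - y).mat = x.mat - y.mat := rfl

theorem Aff.mat_smul (a : ℂ) (x : Aff K c) : (a • x).mat = a • x.mat := rfl

theorem Aff.mat_zero : (0 : Aff K c).mat = 0 := rfl

theorem Aff.snd_add (x y : Aff K c) : (x + y).2 = x.2 + y.2 := rfl

theorem Aff.snd_sub (x y : Aff K c) : (x - y).2 = x.2 - y.2 := rfl

theorem Aff.snd_smul (a : ℂ) (x : Aff K c) : (a • x).2 = a * x.2 := rfl

theorem Aff.mat_khat : (khat K c).mat = 0 := rfl

theorem Aff.mat_smul_khat (a : ℂ) : (a • khat K c).mat = 0 :=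
  congrArg Subtype.val (smul_zero a : a • (0 : K) = 0)

theorem Aff.snd_khat : (khat K c).2 = 1 := rfl

theorem Aff.mat_sum {ι : Type*} (s : Finset ι) (x : ι → Aff K c) :
    (∑ i ∈ s, x i).mat = ∑ i ∈ s, (x i).mat := by
  classical
  induction s using Finset.induction_on with
  | empty => rfl
  | insert a s ha ih => rw [Finset.sum_insert ha, Finset.sum_insert ha, Aff.mat_add, ih]

theorem Aff.snd_sum {ι : Type*} (s : Finset ι) (x : ι → Aff K c) :
    (∑ i ∈ s, x i).2 = ∑ i ∈ s, (x i).2 := by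
  classical
  induction s using Finset.induction_on with
  | empty => rfl
  | insert a s ha ih => rw [Finset.sum_insert ha, Finset.sum_insert ha, Aff.snd_add, ih]

theorem khat_lie (x : Aff K c) : ⁅khat K c, x⁆ = 0 := by
  refine Aff.ext_mat ?_ ?_
  · rw [Aff.mat_lie, Aff.mat_khat, zero_mul, mul_zero, sub_zero, Aff.mat_zero]
  · obtain ⟨r, _, hr⟩ := exists_matOrdGE x.mat
    change c * resPairing 0 x.mat = 0
    rw [resPairing_eq_zero (r := 1 - r) (A := 0) (fun _ _ => ordGE_zero _) hr (by omega), mul_zero]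

/-! ### Smooth modules -/

section Smooth

variable {V : Type*} [AddCommGroup V] [LieRingModule (Aff K c) V]

variable (K c) in
/-- All elements of the loop algebra of order at least `r` kill `w`. -/
def KilledFrom (r : ℤ) (w : V) : Prop :=
  ∀ x : Aff K c, x.2 = 0 → MatOrdGE r x.mat → ⁅x, w⁆ = 0

theorem KilledFrom.mono {r s : ℤ} {w : V} (h : KilledFrom K c r w) (hs : r ≤ s) :
    KilledFrom K c s w :=
  fun x hx hx' => h x hx fun p q => (hx' p q).mono hs

variable [Module ℂ V] [LieModule ℂ (Aff K c) V]

/-- The vectors killed by all elements of sufficiently high order form a submodule, because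
bracketing with a fixed `y` lowers orders by a bounded amount. -/
theorem exists_killedFrom {v : V} (hv : ∃ r, KilledFrom K c r v)
    (hspan : LieSubmodule.lieSpan ℂ (Aff K c) {v} = ⊤) (w : V) :
    ∃ r : ℕ, KilledFrom K c r w := by
  let W : LieSubmodule ℂ (Aff K c) V :=
    { carrier := {w | ∃ r : ℕ, KilledFrom K c r w}
      add_mem' := by
        rintro a b ⟨r, hr⟩ ⟨s, hs⟩
        refine ⟨max r s, fun x hx hx' => ?_⟩
        rw [lie_add, hr.mono (by simp) x hx hx', hs.mono (by simp) x hx hx', add_zero]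
      zero_mem' := ⟨0, fun x _ _ => lie_zero x⟩
      smul_mem' := by
        rintro a w ⟨r, hr⟩
        exact ⟨r, fun x hx hx' => by rw [lie_smul, hr x hx hx', smul_zero]⟩
      lie_mem := by
        rintro y w ⟨r, hr⟩
        obtain ⟨s, hs, hy⟩ := exists_matOrdGE y.mat
        -- With `y` of order at least `s ≤ 0`, this threshold keeps `x` and `⁅x, y⁆` at order at
        -- least `r`, and the extra 1 makes the total order positive, which kills the cocycle.
        refine ⟨(r + 1 - s).toNat, fun x hx hx' => ?_⟩
        rw [Int.toNat_of_nonneg (by omega)] at hx'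
        rw [leibniz_lie, hr.mono (by omega) x hx hx', lie_zero, add_zero]
        refine hr.mono (s := r + 1) (by omega) _ ?_ ?_
        · rw [Aff.snd_lie, resPairing_eq_zero hx' hy (by omega), mul_zero]
        · rw [Aff.mat_lie]
          have h1 := hx'.mul hy
          have h2 := hy.mul hx'
          exact fun p q => ((h1 p q).mono (by omega)).sub ((h2 p q).mono (by omega)) }
  have hW : LieSubmodule.lieSpan ℂ (Aff K c) {v} ≤ W := by
    rw [LieSubmodule.lieSpan_le]
    rintro _ rfl
    obtain ⟨r, hr⟩ := hv
    exact ⟨r.toNat, hr.mono (Int.self_le_toNat r)⟩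
  exact hW (hspan ▸ LieSubmodule.mem_top w)

theorem khat_lie_eq {v : V} {k : ℂ} (hv : ⁅khat K c, v⁆ = k • v)
    (hspan : LieSubmodule.lieSpan ℂ (Aff K c) {v} = ⊤) (w : V) : ⁅khat K c, w⁆ = k • w := by
  let W : LieSubmodule ℂ (Aff K c) V :=
    { carrier := {w | ⁅khat K c, w⁆ = k • w}
      add_mem' := fun {a b} ha hb => by
        simp only [Set.mem_ofPred_eq] at ha hb ⊢
        rw [lie_add, ha, hb, smul_add]
      zero_mem' := by simp
      smul_mem' := fun a w hw => by
        simp only [Set.mem_ofPred_eq] at hw ⊢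
        rw [lie_smul, hw, smul_comm]
      lie_mem := fun {y w} hw => by
        change ⁅khat K c, w⁆ = k • w at hw
        change ⁅khat K c, ⁅y, w⁆⁆ = k • ⁅y, w⁆
        rw [leibniz_lie, khat_lie, zero_lie, zero_add, hw, lie_smul] }
  have hW : LieSubmodule.lieSpan ℂ (Aff K c) {v} ≤ W := by
    rw [LieSubmodule.lieSpan_le]
    rintro _ rfl
    exact hv
  exact hW (hspan ▸ LieSubmodule.mem_top w)

end Smooth

/-! ### Ad-nilpotent elements and local nilpotency -/

section Nilpotent

variable {L V : Type*} [LieRing L] [LieAlgebra ℂ L] [AddCommGroup V] [Module ℂ V]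
  [LieRingModule L V] [LieModule ℂ L V]

/-- An `ad`-nilpotent element which is nilpotent on a generator acts locally nilpotently. -/
theorem locNil_of_generator {x : L} {d : ℕ} (hx : ∀ y, ((LieAlgebra.ad ℂ L x) ^ d) y = 0) {v : V}
    (hv : ∃ n : ℕ, ((LieModule.toEnd ℂ L V x) ^ n) v = 0)
    (hspan : LieSubmodule.lieSpan ℂ L {v} = ⊤) : LocNil (LieModule.toEnd ℂ L V x) := fun w => by
  let W : LieSubmodule ℂ L V :=
    { nilSubmodule (LieModule.toEnd ℂ L V x) with
      lie_mem := by
        rintro y w ⟨n, hn⟩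
        -- In the Leibniz expansion of the power `d + n`, each term has either at least `d` factors
        -- on `y` or at least `n` on `w`.
        refine ⟨d + n, ?_⟩
        rw [LieModule.toEnd_pow_lie]
        refine Finset.sum_eq_zero fun ij hij => ?_
        rw [Finset.HasAntidiagonal.mem_antidiagonal] at hij
        rcases le_or_gt d ij.1 with h | h
        · rw [pow_apply_eq_zero_of_le h (hx y), zero_lie, smul_zero]
        · rw [pow_apply_eq_zero_of_le (by omega) hn, lie_zero, smul_zero] }
  have hW : LieSubmodule.lieSpan ℂ L {v} ≤ W := by
    rw [LieSubmodule.lieSpan_le]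
    rintro _ rfl
    exact hv
  exact hW (hspan ▸ LieSubmodule.mem_top w)

/-- Elements of the root spaces of real roots are `ad`-nilpotent. -/
theorem ad_single_pow_three {p q : Fin N} (hpq : p ≠ q) {f : Laurent} {x : Aff K c}
    (hx : x.mat = Matrix.single p q f) (y : Aff K c) : ((LieAlgebra.ad ℂ (Aff K c) x) ^ 3) y = 0 := by
  -- As the matrix of `x` squares to zero, `ad x` applied twice has matrix `-2 x y x`, again a
  -- multiple of `E_{p,q}`. A third bracket vanishes, and so does its cocycle, which only involves
  -- the entry `(q, p)`.
  have hxx : x.mat * x.mat = 0 := by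
    rw [hx, Matrix.single_mul_single_of_ne _ _ _ _ hpq.symm]
  obtain ⟨h, h2⟩ : ∃ h, ⁅x, ⁅x, y⁆⁆.mat = Matrix.single p q h := by
    refine ⟨-(f * y.mat q p * f + f * y.mat q p * f), ?_⟩
    have h3 : ⁅x, ⁅x, y⁆⁆.mat = -(x.mat * y.mat * x.mat + x.mat * y.mat * x.mat) := by
      rw [Aff.mat_lie, Aff.mat_lie, mul_sub, sub_mul, ← mul_assoc, ← mul_assoc, hxx, zero_mul,
        mul_assoc y.mat, hxx, mul_zero]
      abel
    rw [h3, hx, Matrix.single_mul_mul_single]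
    ext1 i j
    by_cases hij : p = i ∧ q = j <;> simp [hij]
  change ⁅x, ⁅x, ⁅x, y⁆⁆⁆ = 0
  refine Aff.ext_mat ?_ ?_
  · rw [Aff.mat_lie, h2, hx, Matrix.single_mul_single_of_ne _ _ _ _ hpq.symm,
      Matrix.single_mul_single_of_ne _ _ _ _ hpq.symm, sub_zero, Aff.mat_zero]
  · rw [Aff.snd_lie, hx, resPairing_single_left, h2, Matrix.single_apply_of_row_ne hpq,
      mul_zero, HahnSeries.coeff_zero, mul_zero]
    rfl

end Nilpotent

end

/-! ### The principal basis of a twisted affine Lie algebra -/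

section Letters

theorem single_mul_single_ite {N : ℕ} (p q r s : Fin N) (a b : Laurent) :
    Matrix.single p q a * Matrix.single r s b =
      if q = r then Matrix.single p s (a * b) else 0 := by
  split_ifs with h
  · subst h; rw [Matrix.single_mul_single_same]
  · rw [Matrix.single_mul_single_of_ne _ _ _ _ h]

theorem fin_eq_of_dvd_sub {N : ℕ} {p q : Fin N} (h : (N : ℤ) ∣ (p : ℤ) - q) : p = q := by
  have h1 := p.2
  have h2 := q.2
  have h3 := Int.eq_zero_of_abs_lt_dvd h (by rw [abs_lt]; constructor <;> omega)
  exact Fin.ext (by omega)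

variable {N : ℕ} [N.AtLeastTwo]

theorem eps_isPrimitiveRoot (N : ℕ) [N.AtLeastTwo] : IsPrimitiveRoot (eps N) N := by
  rw [← IsPrimitiveRoot.coe_units_iff]
  exact Complex.isPrimitiveRoot_exp N (NeZero.ne N)

/-- The automorphism with parameter `ζ` shifts rows and columns by `g`. -/
def IsTwist (g : Fin N) (ζ : ℂˣ) : Prop :=
  ∀ (p : Fin N) (m : ℤ), ζ ^ m = eps N ^ (((p + m • g : Fin N) : ℤ) - p)

theorem eps_zpow_eq_iff (a b : ℤ) : eps N ^ a = eps N ^ b ↔ (N : ℤ) ∣ a - b := by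
  rw [← (eps_isPrimitiveRoot N).zpow_eq_one_iff_dvd, zpow_sub, mul_inv_eq_one]

theorem fin_val_add_zsmul_one (p : Fin N) (m : ℤ) :
    (N : ℤ) ∣ ((p + m • (1 : Fin N) : Fin N) : ℤ) - p - m := by
  have h1 : ∀ p : Fin N, (N : ℤ) ∣ ((p + 1 : Fin N) : ℤ) - p - 1 := fun p => by
    rw [Fin.val_add, Fin.val_one', Nat.add_mod_mod]
    push_cast
    rw [← (Int.emod_emod_of_dvd _ dvd_rfl : ((p : ℤ) + 1) % N % N = _), sub_sub]
    exact Int.dvd_of_emod_eq_zero (by simp [Int.sub_emod])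
  induction m with
  | zero => simp
  | succ m ih =>
    have := h1 (p + (m : ℤ) • 1)
    rw [add_smul, one_smul, ← add_assoc]
    obtain ⟨a, ha⟩ := this
    obtain ⟨b, hb⟩ := ih
    exact ⟨a + b, by linear_combination ha + hb⟩
  | pred m ih =>
    have := h1 (p + (-(m : ℤ) - 1) • 1)
    rw [add_assoc, sub_smul, one_smul, sub_add_cancel, ← add_sub_assoc] at this
    rw [sub_smul, one_smul, ← add_sub_assoc]
    obtain ⟨a, ha⟩ := this
    obtain ⟨b, hb⟩ := ih
    exact ⟨b - a, by linear_combination hb - ha⟩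

theorem isTwist_zero : IsTwist (1 : Fin N) (eps N) := fun p m => by
  rw [eps_zpow_eq_iff]
  obtain ⟨a, ha⟩ := fin_val_add_zsmul_one p m
  exact ⟨-a, by linear_combination -ha⟩

theorem isTwist_infty : IsTwist (-1 : Fin N) (eps N)⁻¹ := fun p m => by
  rw [inv_zpow', eps_zpow_eq_iff]
  obtain ⟨a, ha⟩ := fin_val_add_zsmul_one p (-m)
  rw [smul_neg, ← neg_smul]
  exact ⟨-a, by linear_combination -ha⟩

theorem exists_add_nsmul_one (p q : Fin N) : ∃ j : ℕ, q = p + j • (1 : Fin N) := by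
  -- The residue `q - p`, shifted by `N` to be a natural number.
  refine ⟨q.val + (N - p.val), (fin_eq_of_dvd_sub ?_).symm⟩
  obtain ⟨a, ha⟩ := fin_val_add_zsmul_one p (q.val + (N - p.val) : ℕ)
  rw [natCast_zsmul] at ha
  refine ⟨a + 1, ?_⟩
  have h := p.2
  push_cast [Nat.cast_sub h.le] at ha ⊢
  linear_combination ha

theorem exists_add_nsmul_neg_one (p q : Fin N) : ∃ j : ℕ, q = p + j • (-1 : Fin N) := by
  obtain ⟨j, hj⟩ := exists_add_nsmul_one q p
  exact ⟨j, by rw [hj, smul_neg, add_neg_cancel_right]⟩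

variable {g : Fin N} {ζ : ℂˣ}

/-- Comparing coefficients in the twist condition gives `ζ ^ m = ε ^ (q - p)`. The power of the
coordinate thus determines the diagonal on which a coefficient may sit, so the grading by powers is
the principal one. -/
theorem IsTwist.eq_of_coeff_ne_zero (hζ : IsTwist g ζ) {A : Matrix (Fin N) (Fin N) Laurent}
    (hA : A ∈ twistedLoop N ζ) {p q : Fin N} {m : ℤ} (h : (A p q).coeff m ≠ 0) :
    q = p + m • g := by
  have h1 := congrArg (fun f : Laurent => f.coeff m) (congrFun (congrFun hA.2 p) q)
  simp only [Matrix.map_apply, coeff_scale, adGamma_apply, algebraMap_laurent,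
    HahnSeries.coeff_single_zero_mul] at h1
  have h2 : ζ ^ m = eps N ^ ((q : ℤ) - p) := Units.ext (mul_right_cancel₀ h h1)
  rw [hζ p m, eps_zpow_eq_iff, sub_sub_sub_cancel_right] at h2
  exact (fin_eq_of_dvd_sub h2).symm

variable (g) in
/-- The matrix `E_{p,p+mg} ξ^m`, corrected by a scalar matrix to have trace zero. -/
def letterMat (p : Fin N) (m : ℤ) : Matrix (Fin N) (Fin N) Laurent :=
  Matrix.single p (p + m • g) (HahnSeries.single m 1) -
    Matrix.scalar (Fin N) (HahnSeries.single m (if m • g = 0 then 1 / (N : ℂ) else 0))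

theorem scale_single (ζ : ℂˣ) (m : ℤ) (a : ℂ) : scale ζ (HahnSeries.single m a) =
    algebraMap ℂ Laurent ((ζ ^ m : ℂˣ) : ℂ) * HahnSeries.single m a := by
  ext n
  rw [coeff_scale, algebraMap_laurent, HahnSeries.coeff_single_zero_mul]
  by_cases h : n = m
  · rw [h]
  · rw [HahnSeries.coeff_single_of_ne h, mul_zero, mul_zero]

theorem letterMat_mem (hζ : IsTwist g ζ) (p : Fin N) (m : ℤ) :
    letterMat g p m ∈ twistedLoop N ζ := by
  constructor
  · rw [letterMat, Matrix.trace_sub, Matrix.scalar_apply, Matrix.trace_diagonal, Finset.sum_const,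
      Finset.card_univ, Fintype.card_fin]
    split_ifs with h
    · rw [h, add_zero, Matrix.trace_single_eq_same, sub_eq_zero]
      ext n
      rw [HahnSeries.coeff_nsmul]
      by_cases hn : n = m
      · simp [hn]
      · simp [hn]
    · rw [Matrix.trace_single_eq_of_ne _ _ _ (by simpa [eq_comm] using h)]
      simp
  · ext1 i j
    rw [Matrix.map_apply, adGamma_apply, letterMat, Matrix.sub_apply, map_sub, mul_sub]
    congr 1
    · by_cases h : p = i ∧ p + m • g = j
      · obtain ⟨rfl, rfl⟩ := h
        rw [Matrix.single_apply_same, scale_single, ← hζ]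
      · rw [Matrix.single_apply_of_ne _ _ _ _ _ h, map_zero, mul_zero]
    · by_cases h : i = j
      · subst h
        split_ifs with hm
        · have h1 : ζ ^ m = 1 := by rw [hζ 0 m, hm]; simp
          rw [Matrix.scalar_apply, Matrix.diagonal_apply_eq, scale_single, h1, sub_self, zpow_zero]
        · simp
      · rw [Matrix.scalar_apply, Matrix.diagonal_apply_ne _ h, map_zero, mul_zero]

/-- The element of the twisted affine Lie algebra given by `letterMat`. -/
def letter (hζ : IsTwist g ζ) (p : Fin N) (m : ℤ) : Aff (twistedLoop N ζ) (1 / N) :=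
  Aff.ofLoop ⟨letterMat g p m, letterMat_mem hζ p m⟩

theorem mat_letter (hζ : IsTwist g ζ) (p : Fin N) (m : ℤ) :
    (letter hζ p m).mat = letterMat g p m := rfl

theorem snd_letter (hζ : IsTwist g ζ) (p : Fin N) (m : ℤ) : (letter hζ p m).2 = 0 := rfl

theorem letterMat_of_ne (p : Fin N) {m : ℤ} (h : m • g ≠ 0) :
    letterMat g p m = Matrix.single p (p + m • g) (HahnSeries.single m 1) := by
  rw [letterMat, if_neg h, HahnSeries.single_eq_zero, map_zero, sub_zero]

theorem smul_ne_zero_of_eq (hg : g ≠ 0) {n : ℤ} (hn : n = 1 ∨ n = -1) : n • g ≠ 0 := by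
  rcases hn with rfl | rfl <;> simpa using hg

/-- For `n = ±1` the second factor carries no scalar correction. That of the first factor commutes
with all matrices and has zero cocycle with traceless ones, so only the matrix units matter. -/
theorem letter_lie (hζ : IsTwist g ζ) (hg : g ≠ 0) (p : Fin N) (m : ℤ) (r : Fin N) (n : ℤ)
    (hn : n = 1 ∨ n = -1) : ⁅letter hζ p m, letter hζ r n⁆ =
      (if r = p + m • g then letter hζ p (m + n) else 0) -
        (if p = r + n • g then letter hζ r (m + n) else 0) +
        (if m + n = 0 ∧ r = p + m • g then m * (1 / N) else 0 : ℂ) • khat _ _ := by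
  have hng := smul_ne_zero_of_eq hg hn
  have e1 : (p + m • g = r) = (r = p + m • g) := by rw [eq_iff_iff, eq_comm]
  have e2 : (r + n • g = p) = (p = r + n • g) := by rw [eq_iff_iff, eq_comm]
  have e3 : p + m • g + n • g = p + (m + n) • g := by rw [add_smul, add_assoc]
  have e4 : r + n • g + m • g = r + (m + n) • g := by rw [add_smul]; abel
  refine Aff.ext_mat ?_ ?_
  · rw [Aff.mat_lie, Aff.mat_add, Aff.mat_sub, Aff.mat_smul_khat, add_zero,
      mat_letter, mat_letter, letterMat_of_ne r hng, letterMat, sub_mul, mul_sub,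
      (Matrix.scalar_commute _ (fun _ => Commute.all _ _) _).eq, sub_sub_sub_cancel_right,
      single_mul_single_ite, single_mul_single_ite, HahnSeries.single_mul_single,
      HahnSeries.single_mul_single, mul_one, add_comm n m]
    by_cases h1 : r = p + m • g <;> by_cases h2 : p = r + n • g
    -- Both products survive only when the total shift is zero; the two letters on the right then
    -- carry the same scalar correction, which cancels.
    · have h3 : (m + n) • g = 0 := by
        rw [h1, e3] at h2
        simpa using h2.symm
      rw [if_pos h1.symm, if_pos h2.symm, if_pos h1, if_pos h2, mat_letter, mat_letter, letterMat,
        letterMat, sub_sub_sub_cancel_right, ← e3, ← e4, ← h1, ← h2, ← h1]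
    · have h3 : (m + n) • g ≠ 0 := fun h3 => h2 (by rw [h1, e3, h3, add_zero])
      rw [if_pos h1.symm, if_neg (fun h => h2 h.symm), if_pos h1, if_neg h2, mat_letter,
        letterMat_of_ne _ h3, ← e3, ← h1, Aff.mat_zero]
    · have h3 : (m + n) • g ≠ 0 := fun h3 => h1 (by rw [h2, e4, h3, add_zero])
      rw [if_neg (fun h => h1 h.symm), if_pos h2.symm, if_neg h1, if_pos h2, mat_letter,
        letterMat_of_ne _ h3, ← e4, ← h2, Aff.mat_zero]
    · rw [if_neg (fun h => h1 h.symm), if_neg (fun h => h2 h.symm), if_neg h1, if_neg h2,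
        Aff.mat_zero]
  · rw [Aff.snd_lie, Aff.snd_add, Aff.snd_sub, Aff.snd_smul, Aff.snd_khat, mul_one]
    have s1 : ∀ (P : Prop) [Decidable P] (x : Aff (twistedLoop N ζ) (1 / N)), x.2 = 0 →
        (if P then x else 0 : Aff (twistedLoop N ζ) (1 / N)).2 = 0 := by
      intro P _ x hx
      split_ifs
      · exact hx
      · rfl
    rw [s1 _ _ (snd_letter _ _ _), s1 _ _ (snd_letter _ _ _), sub_zero, zero_add, mat_letter,
      mat_letter, letterMat, resPairing_sub_left,
      resPairing_scalar_left _ (letterMat_mem hζ r n).1, sub_zero, resPairing_single_left,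
      letterMat_of_ne r hng, derivative_single]
    by_cases h1 : r = p + m • g
    · by_cases h2 : m + n = 0
      · have h3 : r + n • g = p := by rw [h1, e3, h2, zero_smul, add_zero]
        rw [if_pos ⟨h2, h1⟩, h3, h1, Matrix.single_apply_same, HahnSeries.single_mul_single,
          show m - 1 + n = -1 by omega, HahnSeries.coeff_single_same]
        ring
      · rw [if_neg (by tauto)]
        by_cases h3 : r = p + m • g ∧ r + n • g = p
        · rw [h3.2, h1, Matrix.single_apply_same, HahnSeries.single_mul_single,
            HahnSeries.coeff_single_of_ne (by omega), mul_zero]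
        · rw [Matrix.single_apply_of_ne _ _ _ _ _ h3, mul_zero, HahnSeries.coeff_zero, mul_zero]
    · rw [if_neg (by tauto), Matrix.single_apply_of_ne _ _ _ _ _ (by tauto), mul_zero,
        HahnSeries.coeff_zero, mul_zero]

theorem letter_trace (hζ : IsTwist g ζ) (m : ℤ) (hm : m • g = 0) :
    ∑ p, letter hζ p m = 0 := by
  refine Aff.ext_mat ?_ ?_
  · rw [Aff.mat_sum, Aff.mat_zero]
    simp only [mat_letter, letterMat, hm, if_true, add_zero]
    rw [Finset.sum_sub_distrib, Finset.sum_const, Finset.card_univ, Fintype.card_fin, sub_eq_zero]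
    ext i j n
    rw [Matrix.sum_apply, Matrix.smul_apply, Matrix.scalar_apply, HahnSeries.coeff_nsmul]
    by_cases hij : i = j
    · subst hij
      rw [Matrix.diagonal_apply_eq, Finset.sum_eq_single i (fun p _ hp => by
        rw [Matrix.single_apply_of_row_ne hp]) (by simp), Matrix.single_apply_same]
      by_cases hn : n = m
      · simp [hn]
      · simp [hn]
    · rw [Matrix.diagonal_apply_ne _ hij, Finset.sum_eq_zero fun p _ => by
        rw [Matrix.single_apply_of_ne]; rintro ⟨rfl, h⟩; exact hij h]
      simp
  · rw [Aff.snd_sum]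
    exact Finset.sum_eq_zero fun p _ => snd_letter hζ p m

/-- Every element of a twisted affine Lie algebra is a combination of `k̂` and elements of the
principal basis up to elements of high order. -/
theorem exists_letter_approx (hζ : IsTwist g ζ) (x : Aff (twistedLoop N ζ) (1 / N)) (r : ℤ) :
    ∃ y ∈ Submodule.span ℂ (Set.range fun i : Fin N × ℤ => letter hζ i.1 i.2),
      (x - x.2 • khat _ _ - y).2 = 0 ∧ MatOrdGE r (x - x.2 • khat _ _ - y).mat := by
  obtain ⟨s, _, hs⟩ := exists_matOrdGE x.mat
  -- The homogeneous parts of `x` from degree `s`, below which it vanishes, up to degree `r`.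
  refine ⟨∑ m ∈ Finset.Ico s r, ∑ p, (x.mat p (p + m • g)).coeff m • letter hζ p m,
    sum_mem fun m _ => sum_mem fun p _ => Submodule.smul_mem _ _
      (Submodule.subset_span ⟨(p, m), rfl⟩), ?_, ?_⟩
  · rw [Aff.snd_sub, Aff.snd_sub, Aff.snd_smul, Aff.snd_khat, Aff.snd_sum, Finset.sum_eq_zero]
    · ring
    · intro m _
      rw [Aff.snd_sum]
      exact Finset.sum_eq_zero fun p _ => by rw [Aff.snd_smul, snd_letter, mul_zero]
  · intro i j n hn
    rw [Aff.mat_sub, Aff.mat_sub, Aff.mat_smul_khat, sub_zero, Aff.mat_sum,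
      Matrix.sub_apply, HahnSeries.coeff_sub, sub_eq_zero, Matrix.sum_apply, HahnSeries.coeff_sum]
    have key : ∀ m, ((∑ p, (x.mat p (p + m • g)).coeff m • letter hζ p m).mat i j).coeff n =
        if n = m then (x.mat i j).coeff m else 0 := by
      intro m
      have hsc : ∀ p, (((x.mat p (p + m • g)).coeff m • letter hζ p m).mat i j).coeff n =
          (x.mat p (p + m • g)).coeff m * (Matrix.single p (p + m • g)
            (HahnSeries.single m (1 : ℂ)) i j).coeff n -
          (x.mat p (p + m • g)).coeff m * (Matrix.scalar (Fin N) (HahnSeries.single m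
            (if m • g = 0 then 1 / (N : ℂ) else 0)) i j).coeff n := by
        intro p
        rw [← mul_sub]
        rfl
      -- The scalar corrections add up to a multiple of a coefficient of the trace of `x`, which is
      -- zero.
      have hsum : ∑ p, (x.mat p (p + m • g)).coeff m * (Matrix.scalar (Fin N) (HahnSeries.single m
            (if m • g = 0 then 1 / (N : ℂ) else 0)) i j).coeff n = 0 := by
        rw [← Finset.sum_mul]
        split_ifs with hm
        · have ht := congrArg (fun f : Laurent => f.coeff m) x.1.2.1
          simp only [Matrix.trace, HahnSeries.coeff_sum, HahnSeries.coeff_zero,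
            Matrix.diag_apply] at ht
          simp only [hm, add_zero]
          rw [show ∑ p, (x.mat p p).coeff m = 0 from ht, zero_mul]
        · simp
      rw [Aff.mat_sum, Matrix.sum_apply, HahnSeries.coeff_sum, Finset.sum_congr rfl fun p _ => hsc p,
        Finset.sum_sub_distrib, hsum, sub_zero, Finset.sum_eq_single i (fun p _ hp => by
          rw [Matrix.single_apply_of_row_ne hp, HahnSeries.coeff_zero, mul_zero]) (by simp)]
      by_cases hj : i + m • g = j
      · subst hj
        rw [Matrix.single_apply_same]
        split_ifs with hnm
        · rw [hnm, HahnSeries.coeff_single_same, mul_one]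
        · rw [HahnSeries.coeff_single_of_ne hnm, mul_zero]
      · rw [Matrix.single_apply_of_col_ne _ _ hj, HahnSeries.coeff_zero, mul_zero]
        split_ifs
        -- Positions off the diagonal belonging to degree `m` carry no coefficient of degree `m`, by
        -- the twist condition.
        · by_contra h
          exact hj (hζ.eq_of_coeff_ne_zero x.1.2 (Ne.symm h)).symm
        · rfl
    rw [Finset.sum_congr rfl fun m _ => key m, Finset.sum_ite_eq]
    split_ifs with h
    · rfl
    · rw [Finset.mem_Ico, not_and_or, not_le] at h
      exact hs i j n (by omega)

end Letters

/-! ### Highest weight modules over twisted affine Lie algebras -/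

section HighestWeight

variable {N : ℕ} [N.AtLeastTwo] {g : Fin N} {ζ : ℂˣ} {V : Type*} [AddCommGroup V] [Module ℂ V]
  [LieRingModule (Aff (twistedLoop N ζ) (1 / N)) V] [LieModule ℂ (Aff (twistedLoop N ζ) (1 / N)) V]

/-- `V` is generated by the highest weight vector `v` of weight `μ`. -/
structure IsHighestWeight (v : V) (μ : Module.Dual ℂ (cartan (twistedLoop N ζ) (1 / N))) :
    Prop where
  pos : ∀ x ∈ nPlusTw N ζ (1 / N), ⁅x, v⁆ = 0
  weight : ∀ x : cartan (twistedLoop N ζ) (1 / N),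
    ⁅(x : Aff (twistedLoop N ζ) (1 / N)), v⁆ = μ x • v
  span : LieSubmodule.lieSpan ℂ (Aff (twistedLoop N ζ) (1 / N)) {v} = ⊤

theorem mem_nPlusTw_of_ordGE {x : Aff (twistedLoop N ζ) (1 / N)} (h : x.2 = 0)
    (h' : MatOrdGE 1 x.mat) : x ∈ nPlusTw N ζ (1 / N) :=
  ⟨h, fun p q m hm => h' p q m (by omega)⟩

theorem letter_mem_nPlusTw (hζ : IsTwist g ζ) (p : Fin N) {m : ℤ} (hm : 0 < m) :
    letter hζ p m ∈ nPlusTw N ζ (1 / N) := by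
  refine mem_nPlusTw_of_ordGE (snd_letter hζ p m) fun i j => ?_
  rw [mat_letter, letterMat, Matrix.sub_apply]
  refine OrdGE.sub ?_ ?_
  · by_cases h : p = i ∧ p + m • g = j
    · obtain ⟨rfl, rfl⟩ := h
      rw [Matrix.single_apply_same]
      exact ordGE_single hm _
    · rw [Matrix.single_apply_of_ne _ _ _ _ _ h]
      exact ordGE_zero _
  · by_cases h : i = j
    · subst h
      rw [Matrix.scalar_apply, Matrix.diagonal_apply_eq]
      exact ordGE_single hm _
    · rw [Matrix.scalar_apply, Matrix.diagonal_apply_ne _ h]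
      exact ordGE_zero _

theorem letter_zero_mem_cartan (hζ : IsTwist g ζ) (p : Fin N) :
    letter hζ p 0 ∈ cartan (twistedLoop N ζ) (1 / N) := by
  intro i j m h
  rw [mat_letter, letterMat, Matrix.sub_apply, HahnSeries.coeff_sub, zero_smul, add_zero]
  rcases h with h | h
  · rw [Matrix.single_apply_of_ne _ _ _ _ _ (by rintro ⟨rfl, rfl⟩; exact h rfl),
      Matrix.scalar_apply, Matrix.diagonal_apply_ne _ h, sub_self]
  · have h1 : ((Matrix.single p p (HahnSeries.single 0 (1 : ℂ)) :
        Matrix (Fin N) (Fin N) Laurent) i j).coeff m = 0 := by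
      by_cases hp : p = i ∧ p = j
      · obtain ⟨rfl, rfl⟩ := hp
        rw [Matrix.single_apply_same, HahnSeries.coeff_single_of_ne h]
      · rw [Matrix.single_apply_of_ne _ _ _ _ _ hp, HahnSeries.coeff_zero]
    have h2 : ∀ a : ℂ, ((Matrix.scalar (Fin N) (HahnSeries.single 0 a) :
        Matrix (Fin N) (Fin N) Laurent) i j).coeff m = 0 := by
      intro a
      by_cases hij : i = j
      · subst hij
        rw [Matrix.scalar_apply, Matrix.diagonal_apply_eq, HahnSeries.coeff_single_of_ne h]
      · rw [Matrix.scalar_apply, Matrix.diagonal_apply_ne _ hij, HahnSeries.coeff_zero]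
    rw [h1, h2, sub_zero]

variable (V) in
/-- The operators of the principal basis. -/
def letterEnd (hζ : IsTwist g ζ) (p : Fin N) (m : ℤ) : Module.End ℂ V :=
  LieModule.toEnd ℂ (Aff (twistedLoop N ζ) (1 / N)) V (letter hζ p m)

theorem letterEnd_apply (hζ : IsTwist g ζ) (p : Fin N) (m : ℤ) (w : V) :
    letterEnd V hζ p m w = ⁅letter hζ p m, w⁆ := rfl

/-- The eigenvalues of the diagonal elements of the principal basis. -/
def letterWeight (hζ : IsTwist g ζ) (μ : Module.Dual ℂ (cartan (twistedLoop N ζ) (1 / N)))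
    (p : Fin N) : ℂ :=
  μ ⟨letter hζ p 0, letter_zero_mem_cartan hζ p⟩

variable {v : V} {μ : Module.Dual ℂ (cartan (twistedLoop N ζ) (1 / N))}

theorem IsHighestWeight.khat_lie (h : IsHighestWeight v μ) (w : V) :
    ⁅khat (twistedLoop N ζ) (1 / N), w⁆ = level μ • w :=
  khat_lie_eq (h.weight ⟨_, khat_mem_cartan⟩) h.span w

theorem IsHighestWeight.exists_killedFrom (h : IsHighestWeight v μ) (w : V) :
    ∃ r : ℕ, KilledFrom (twistedLoop N ζ) (1 / N) r w :=
  OrbifoldWZW.exists_killedFrom ⟨1, fun x hx hx' => h.pos x (mem_nPlusTw_of_ordGE hx hx')⟩ h.span w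

/-- Subspaces stable under the principal basis are submodules. -/
theorem IsHighestWeight.lie_mem_of_letter (h : IsHighestWeight v μ) (hζ : IsTwist g ζ)
    {W : Submodule ℂ V} (hW : ∀ p m, ∀ w ∈ W, letterEnd V hζ p m w ∈ W)
    (x : Aff (twistedLoop N ζ) (1 / N)) {w : V} (hw : w ∈ W) : ⁅x, w⁆ ∈ W := by
  -- On `w`, elements of order at least `r` act as zero, so `x` acts as a combination of letters and
  -- of `k̂`, itself a scalar.
  obtain ⟨r, hr⟩ := h.exists_killedFrom w
  obtain ⟨y, hy, h1, h2⟩ := exists_letter_approx hζ x r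
  have h3 := hr _ h1 h2
  rw [sub_lie, sub_lie, sub_sub, sub_eq_zero, smul_lie, h.khat_lie] at h3
  rw [h3]
  refine W.add_mem (W.smul_mem _ (W.smul_mem _ hw)) ?_
  have : Submodule.span ℂ (Set.range fun i : Fin N × ℤ => letter hζ i.1 i.2) ≤
      W.comap ((LieModule.toEnd ℂ (Aff (twistedLoop N ζ) (1 / N)) V :
        Aff (twistedLoop N ζ) (1 / N) →ₗ[ℂ] V →ₗ[ℂ] V).flip w) := by
    rw [Submodule.span_le]
    rintro _ ⟨⟨p, m⟩, rfl⟩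
    exact hW p m w hw
  exact this hy

theorem IsHighestWeight.eq_top (h : IsHighestWeight v μ) {W : LieSubmodule ℂ
    (Aff (twistedLoop N ζ) (1 / N)) V} (hv : v ∈ W) : W = ⊤ := by
  rw [eq_top_iff, ← h.span, LieSubmodule.lieSpan_le]
  rintro _ rfl
  exact hv

theorem IsHighestWeight.isPrincipalRep (h : IsHighestWeight v μ) (hζ : IsTwist g ζ) (hg : g ≠ 0) :
    IsPrincipalRep g (level μ / N) (letterEnd V hζ) where
  comm p m r n hn := by
    have h1 : letterEnd V hζ p m * letterEnd V hζ r n - letterEnd V hζ r n * letterEnd V hζ p m =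
        LieModule.toEnd ℂ _ V ⁅letter hζ p m, letter hζ r n⁆ := by
      rw [LieHom.map_lie]; rfl
    have hk : LieModule.toEnd ℂ _ V (khat (twistedLoop N ζ) (1 / N)) = level μ • 1 :=
      LinearMap.ext fun w => h.khat_lie w
    rw [h1, letter_lie hζ hg p m r n hn, map_add, map_sub, map_smul, hk, apply_ite
      (LieModule.toEnd ℂ _ V), apply_ite (LieModule.toEnd ℂ _ V), map_zero, smul_smul]
    congr 2
    split_ifs
    · ring
    · ring
  trace m hm := by
    have := congrArg (LieModule.toEnd ℂ _ V) (letter_trace hζ m hm)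
    rwa [map_sum, map_zero] at this
  smooth w := by
    obtain ⟨r, hr⟩ := h.exists_killedFrom w
    refine ⟨r, fun m hm p => hr _ (snd_letter hζ p m) fun i j => ?_⟩
    rw [mat_letter, letterMat, Matrix.sub_apply]
    refine OrdGE.sub ?_ ?_
    · by_cases hp : p = i ∧ p + m • g = j
      · obtain ⟨rfl, rfl⟩ := hp
        rw [Matrix.single_apply_same]
        exact ordGE_single hm _
      · rw [Matrix.single_apply_of_ne _ _ _ _ _ hp]
        exact ordGE_zero _
    · by_cases hij : i = j
      · subst hij
        rw [Matrix.scalar_apply, Matrix.diagonal_apply_eq]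
        exact ordGE_single hm _
      · rw [Matrix.scalar_apply, Matrix.diagonal_apply_ne _ hij]
        exact ordGE_zero _

theorem IsHighestWeight.letterEnd_pos (h : IsHighestWeight v μ) (hζ : IsTwist g ζ) (p : Fin N)
    (m : ℤ) (hm : 0 < m) : letterEnd V hζ p m v = 0 :=
  h.pos _ (letter_mem_nPlusTw hζ p hm)

theorem IsHighestWeight.letterEnd_zero (h : IsHighestWeight v μ) (hζ : IsTwist g ζ) (p : Fin N) :
    letterEnd V hζ p 0 v = letterWeight hζ μ p • v :=
  h.weight ⟨_, letter_zero_mem_cartan hζ p⟩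

/-- Replaces the Poincaré–Birkhoff–Witt theorem. Letters of degree `-1` generate all negative
degrees, and any letter can be moved to the right past a letter of degree `-1` at the cost of single
letters. By induction on the length, the span of the words is stable under all letters, hence a
submodule. -/
theorem IsHighestWeight.span_word (h : IsHighestWeight v μ) (hζ : IsTwist g ζ) (hg : g ≠ 0)
    (hgen : ∀ p q : Fin N, ∃ j : ℕ, q = p + j • g) :
    Submodule.span ℂ (Set.range (word g (letterEnd V hζ) v)) = ⊤ := by
  have hrep := h.isPrincipalRep hζ hg
  set S := Submodule.span ℂ (Set.range (word g (letterEnd V hζ) v)) with hS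
  have hvS : v ∈ S := Submodule.subset_span ⟨[], rfl⟩
  have hstab : ∀ T : Module.End ℂ V, (∀ l, T (word g (letterEnd V hζ) v l) ∈ S) →
      ∀ w ∈ S, T w ∈ S := by
    intro T hT w hw
    have : S ≤ S.comap T := by
      rw [hS, Submodule.span_le]
      rintro _ ⟨l, rfl⟩
      exact hT l
    exact this hw
  have hlow : ∀ p, ∀ w ∈ S, letterEnd V hζ p (-1) w ∈ S := by
    intro p
    refine hstab _ fun l => Submodule.subset_span ⟨(p - g) :: l, ?_⟩
    rw [word, sub_add_cancel]
  have hneg : ∀ (m : ℕ) p, ∀ w ∈ S, letterEnd V hζ p (-1 * (m + 1)) w ∈ S := by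
    refine hrep.generate hgen (Or.inr rfl) (A :=
      { carrier := {T | ∀ w ∈ S, T w ∈ S}
        add_mem' := fun hx hy w hw => S.add_mem (hx w hw) (hy w hw)
        zero_mem' := fun w _ => S.zero_mem
        smul_mem' := fun a x hx w hw => S.smul_mem a (hx w hw) }) ?_ hlow
    intro x hx y hy w hw
    exact S.sub_mem (hx _ (hy w hw)) (hy _ (hx w hw))
  have hall : ∀ l p m, letterEnd V hζ p m (word g (letterEnd V hζ) v l) ∈ S := by
    intro l
    induction l with
    | nil =>
      intro p m
      rcases lt_trichotomy m 0 with hm | rfl | hm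
      · have := hneg (-m - 1).toNat p v hvS
        rw [Int.toNat_of_nonneg (by omega)] at this
        convert this using 2
        ring_nf
        rfl
      · rw [word, h.letterEnd_zero]
        exact S.smul_mem _ hvS
      · rw [word, h.letterEnd_pos hζ p m hm]
        exact S.zero_mem
    | cons q l ih =>
      intro p m
      have h1 := LinearMap.congr_fun (hrep.comm p m (q + g) (-1) (Or.inr rfl))
        (word g (letterEnd V hζ) v l)
      rw [LinearMap.sub_apply, Module.End.mul_apply, sub_eq_iff_eq_add, Module.End.mul_apply] at h1
      rw [word, h1]
      have h2 : ∀ (P : Prop) [Decidable P] (q : Fin N) (n : ℤ),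
          (if P then letterEnd V hζ q n else 0) (word g (letterEnd V hζ) v l) ∈ S := by
        intro P _ q n
        split_ifs
        · exact ih q n
        · exact S.zero_mem
      refine S.add_mem (S.add_mem (S.sub_mem (h2 _ _ _) (h2 _ _ _)) (S.smul_mem _ ?_))
        (hlow _ _ (ih p m))
      exact Submodule.subset_span ⟨l, rfl⟩
  let W : LieSubmodule ℂ (Aff (twistedLoop N ζ) (1 / N)) V :=
    { S with
      lie_mem := fun {x w} hw => h.lie_mem_of_letter hζ (fun p m => hstab _ fun l => hall l p m) x hw }
  have hW : W = ⊤ := h.eq_top hvS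
  have : (W : Submodule ℂ V) = ⊤ := by rw [hW]; rfl
  exact this

/-- The lowering operators `f_p`. -/
def lowering (V : Type*) [AddCommGroup V] [Module ℂ V]
    [LieRingModule (Aff (twistedLoop N ζ) (1 / N)) V]
    [LieModule ℂ (Aff (twistedLoop N ζ) (1 / N)) V] (hζ : IsTwist g ζ) (p : Fin N) :
    Module.End ℂ V :=
  letterEnd V hζ (p + g) (-1)

/-- The values of the weight on the simple coroots. -/
def corootValue (hζ : IsTwist g ζ) (μ : Module.Dual ℂ (cartan (twistedLoop N ζ) (1 / N)))
    (p : Fin N) : ℂ :=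
  letterWeight hζ μ p - letterWeight hζ μ (p + g) + level μ / N

/-- The simple coroots add up to `k̂`, so a dominant integral weight has a natural number as its
level, and `1 + level μ / N` is positive. -/
theorem one_add_level_ne_zero {hζ : IsTwist g ζ} (hdom : ∀ p, ∃ m : ℕ, corootValue hζ μ p = m) :
    1 + level μ / (N : ℂ) ≠ 0 := by
  choose m hm using hdom
  have h1 : ∑ p, corootValue hζ μ p = level μ := by
    simp only [corootValue]
    rw [Finset.sum_add_distrib, Finset.sum_sub_distrib,
      show ∑ p, letterWeight hζ μ (p + g) = ∑ p, letterWeight hζ μ p from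
        Equiv.sum_comp (Equiv.addRight g) _, sub_self, zero_add, Finset.sum_const,
      Finset.card_univ, Fintype.card_fin, nsmul_eq_mul, mul_div_cancel₀]
    exact Nat.cast_ne_zero.mpr (NeZero.ne N)
  simp only [hm] at h1
  have h2 : (N : ℂ) ≠ 0 := Nat.cast_ne_zero.mpr (NeZero.ne N)
  rw [← h1, ← Nat.cast_sum]
  intro h3
  field_simp at h3
  have : (N + ∑ p, m p : ℕ) = 0 := by exact_mod_cast h3
  have := NeZero.ne N
  omega

/-- Nilpotency of the lowering operators on `v` alone spreads to the whole module, since they are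
ad-nilpotent. The Casimir argument then places `v` in every nonzero submodule. -/
theorem IsHighestWeight.irreducible (h : IsHighestWeight v μ) (hζ : IsTwist g ζ) (hg : g ≠ 0)
    (hgen : ∀ p q : Fin N, ∃ j : ℕ, q = p + j • g)
    (hdom : ∀ p, ∃ m : ℕ, corootValue hζ μ p = m) (hnil : ∀ p, ∃ n : ℕ, (lowering V hζ p ^ n) v = 0)
    {W : LieSubmodule ℂ (Aff (twistedLoop N ζ) (1 / N)) V} (hW : W ≠ ⊤) : W = ⊥ := by
  by_contra hbot
  refine hW (h.eq_top ?_)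
  refine (h.isPrincipalRep hζ hg).highestWeightVector_mem hg hgen (one_add_level_ne_zero hdom)
    (h.letterEnd_pos hζ) (h.letterEnd_zero hζ) (h.span_word hζ hg hgen) hdom ?_ (W := W)
    (fun p m w hw => W.lie_mem hw) (by simpa using hbot)
  intro p
  have hmat : (letter hζ p (-1)).mat = Matrix.single p (p - g) (HahnSeries.single (-1) 1) := by
    rw [mat_letter, letterMat_of_ne _ (smul_ne_zero_of_eq hg (Or.inr rfl)), neg_smul, one_smul,
      sub_eq_add_neg]
  refine locNil_of_generator (ad_single_pow_three (fun h => hg (sub_eq_self.mp h.symm)) hmat) ?_ h.span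
  have := hnil (p - g)
  rwa [lowering, sub_add_cancel] at this

theorem IsHighestWeight.sup_ne_top (h : IsHighestWeight v μ) (hζ : IsTwist g ζ) (hg : g ≠ 0)
    (hgen : ∀ p q : Fin N, ∃ j : ℕ, q = p + j • g)
    (hdom : ∀ p, ∃ m : ℕ, corootValue hζ μ p = m)
    {W₁ W₂ : LieSubmodule ℂ (Aff (twistedLoop N ζ) (1 / N)) V} (h₁ : W₁ ≠ ⊤) (h₂ : W₂ ≠ ⊤) :
    W₁ ⊔ W₂ ≠ ⊤ := by
  have := (h.isPrincipalRep hζ hg).notMem_sup hg (one_add_level_ne_zero hdom)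
    (h.letterEnd_pos hζ) (h.letterEnd_zero hζ) (h.span_word hζ hg hgen) (W₁ := W₁) (W₂ := W₂)
    (fun p m w hw => W₁.lie_mem hw) (fun p m w hw => W₂.lie_mem hw)
    (fun hv => h₁ (h.eq_top hv)) (fun hv => h₂ (h.eq_top hv))
  intro htop
  refine this ?_
  rw [← LieSubmodule.sup_toSubmodule, htop]
  trivial

theorem IsHighestWeight.quotient (h : IsHighestWeight v μ)
    (W : LieSubmodule ℂ (Aff (twistedLoop N ζ) (1 / N)) V) :
    IsHighestWeight (LieSubmodule.Quotient.mk' W v) μ where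
  pos x hx := by rw [← LieModuleHom.map_lie, h.pos x hx, map_zero]
  weight x := by rw [← LieModuleHom.map_lie, h.weight x, map_smul]
  span := by
    set S := LieSubmodule.lieSpan ℂ (Aff (twistedLoop N ζ) (1 / N)) {LieSubmodule.Quotient.mk' W v}
    have hS : S.comap (LieSubmodule.Quotient.mk' W) = ⊤ :=
      h.eq_top (LieSubmodule.subset_lieSpan (Set.mem_singleton _))
    refine eq_top_iff.mpr fun w _ => ?_
    obtain ⟨w, rfl⟩ := LieSubmodule.Quotient.surjective_mk' W w
    have : w ∈ S.comap (LieSubmodule.Quotient.mk' W) := hS ▸ LieSubmodule.mem_top w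
    exact this

theorem pow_toEnd_quotient {L : Type*} [LieRing L] [LieAlgebra ℂ L] [LieRingModule L V]
    [LieModule ℂ L V] (W : LieSubmodule ℂ L V) (x : L) (n : ℕ) (w : V) :
    (LieModule.toEnd ℂ L (V ⧸ W) x ^ n) (LieSubmodule.Quotient.mk' W w) =
      LieSubmodule.Quotient.mk' W ((LieModule.toEnd ℂ L V x ^ n) w) := by
  induction n with
  | zero => rfl
  | succ n ih => rw [pow_succ', Module.End.mul_apply, ih, pow_succ', Module.End.mul_apply]; rfl

end HighestWeight

/-- A submodule of a highest weight module of dominant integral highest weight contains all proper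
submodules if it contains the singular vectors `f_p ^ n v`. -/
theorem IsHighestWeight.maxProperSubmodule_le {N : ℕ} [N.AtLeastTwo] {g : Fin N} {ζ : ℂˣ}
    {V : Type} [AddCommGroup V] [Module ℂ V] [LieRingModule (Aff (twistedLoop N ζ) (1 / N)) V]
    [LieModule ℂ (Aff (twistedLoop N ζ) (1 / N)) V] {v : V}
    {μ : Module.Dual ℂ (cartan (twistedLoop N ζ) (1 / N))} (h : IsHighestWeight v μ)
    (hζ : IsTwist g ζ) (hg : g ≠ 0) (hgen : ∀ p q : Fin N, ∃ j : ℕ, q = p + j • g)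
    (hdom : ∀ p, ∃ m : ℕ, corootValue hζ μ p = m)
    {W : LieSubmodule ℂ (Aff (twistedLoop N ζ) (1 / N)) V}
    (hW : ∀ p, ∃ n : ℕ, (lowering V hζ p ^ n) v ∈ W) :
    maxProperSubmodule (Aff (twistedLoop N ζ) (1 / N)) V ≤ W := by
  refine sSup_le fun W' hW' => ?_
  by_cases hWtop : W = ⊤
  · rw [hWtop]; exact le_top
  have hsup := h.sup_ne_top hζ hg hgen hdom hWtop hW'
  -- The quotient by `W` is integrable. The image of `W'` in it is proper because the sum of `W` and
  -- `W'` is, hence is zero by irreducibility.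
  have hirr := (h.quotient W).irreducible hζ hg hgen hdom (fun p => by
    obtain ⟨n, hn⟩ := hW p
    refine ⟨n, ?_⟩
    rw [lowering, letterEnd, pow_toEnd_quotient]
    exact (LieSubmodule.Quotient.mk_eq_zero W).mpr hn) (W := W'.map (LieSubmodule.Quotient.mk' W)) (by
      intro htop
      refine hsup (eq_top_iff.mpr fun w _ => ?_)
      have : LieSubmodule.Quotient.mk' W w ∈ W'.map (LieSubmodule.Quotient.mk' W) := by
        rw [htop]; trivial
      obtain ⟨w', hw', he⟩ := (LieSubmodule.mem_map _).mp this
      rw [← sub_eq_zero, ← map_sub] at he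
      have he' : w' - w ∈ W := (LieSubmodule.Quotient.mk_eq_zero W).mp he
      rw [LieSubmodule.mem_sup]
      exact ⟨w - w', by rw [← neg_sub]; exact neg_mem he', w', hw', by abel⟩)
  intro w hw
  have : LieSubmodule.Quotient.mk' W w ∈ W'.map (LieSubmodule.Quotient.mk' W) :=
    LieSubmodule.mem_map_of_mem hw
  rw [hirr, LieSubmodule.mem_bot] at this
  exact (LieSubmodule.Quotient.mk_eq_zero W).mp this

/-! ### Real root vectors act locally nilpotently on integrable modules -/

section AdPow

variable {L V : Type*} [LieRing L] [LieAlgebra ℂ L] [AddCommGroup V] [Module ℂ V]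
  [LieRingModule L V] [LieModule ℂ L V]

/-- Each of the `b` factors `z` absorbs at most `d` copies of `x`, and `x` kills `v`. At exponent `d
* b` every `z` must become `w`, with a multinomial, hence nonzero, coefficient; beyond that nothing
is left. -/
theorem pow_toEnd_pow_apply {x z w : L} {d : ℕ} (hw : ((LieAlgebra.ad ℂ L x) ^ d) z = w)
    (hxw : ⁅x, w⁆ = 0) {v : V} (hv : ⁅x, v⁆ = 0) (b : ℕ) :
    (∀ n, d * b < n →
      (LieModule.toEnd ℂ L V x ^ n) ((LieModule.toEnd ℂ L V z ^ b) v) = 0) ∧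
    ∃ c : ℕ, c ≠ 0 ∧ (LieModule.toEnd ℂ L V x ^ (d * b)) ((LieModule.toEnd ℂ L V z ^ b) v) =
      c • (LieModule.toEnd ℂ L V w ^ b) v := by
  have had : ∀ i, d < i → ((LieAlgebra.ad ℂ L x) ^ i) z = 0 := by
    intro i hi
    refine pow_apply_eq_zero_of_le (m := d + 1) hi ?_
    rw [pow_succ', Module.End.mul_apply, hw]
    exact hxw
  induction b with
  | zero =>
    refine ⟨fun n hn => ?_, 1, one_ne_zero, by simp⟩
    refine pow_apply_eq_zero_of_le (m := 1) (by omega) ?_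
    simpa using hv
  | succ b ih =>
    obtain ⟨ih1, c, hc, ih2⟩ := ih
    have hz : (LieModule.toEnd ℂ L V z ^ (b + 1)) v =
        ⁅z, (LieModule.toEnd ℂ L V z ^ b) v⁆ := by
      rw [pow_succ', Module.End.mul_apply]; rfl
    refine ⟨fun n hn => ?_, (d * (b + 1)).choose d * c, ?_, ?_⟩
    · rw [hz, LieModule.toEnd_pow_lie]
      refine Finset.sum_eq_zero fun ij hij => ?_
      rw [Finset.HasAntidiagonal.mem_antidiagonal] at hij
      rcases lt_or_ge d ij.1 with h | h
      · rw [had _ h, zero_lie, smul_zero]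
      · rw [ih1 _ (by rw [mul_add] at hn; omega), lie_zero, smul_zero]
    · exact mul_ne_zero (Nat.choose_pos (Nat.le_mul_of_pos_right d b.succ_pos)).ne' hc
    · rw [hz, LieModule.toEnd_pow_lie, Finset.sum_eq_single (d, d * b)]
      · rw [hw, ih2, pow_succ', Module.End.mul_apply, LieModule.toEnd_apply_apply, lie_nsmul,
          smul_smul]
      · rintro ⟨i, j⟩ hij hne
        rw [Finset.HasAntidiagonal.mem_antidiagonal] at hij
        simp only at hij
        rw [mul_add] at hij
        rcases lt_or_ge d i with h | h
        · rw [had _ h, zero_lie, smul_zero]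
        · rw [ih1 _ ?_, lie_zero, smul_zero]
          rcases h.lt_or_eq with h | rfl
          · omega
          · exact absurd (by rw [Prod.mk.injEq]; omega) hne
      · intro h
        exact absurd (Finset.HasAntidiagonal.mem_antidiagonal.mpr (by ring)) h

/-- If `x` and `z` act locally nilpotently, so does the last nonzero `(ad x) ^ d z`. -/
theorem locNil_ad_pow {x z w : L} {d : ℕ} (hx : LocNil (LieModule.toEnd ℂ L V x))
    (hz : LocNil (LieModule.toEnd ℂ L V z)) (hw : ((LieAlgebra.ad ℂ L x) ^ d) z = w)
    (hxw : ⁅x, w⁆ = 0) : LocNil (LieModule.toEnd ℂ L V w) := by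
  have hcomm : Commute (LieModule.toEnd ℂ L V x) (LieModule.toEnd ℂ L V w) := by
    have := LieHom.map_lie (LieModule.toEnd ℂ L V) x w
    rw [hxw, map_zero, LieRing.of_associative_ring_bracket, eq_comm, sub_eq_zero] at this
    exact this
  -- Induction on the nilpotency order of `x` at `v`. Some `w ^ n` kills `x v`, so `x` kills `w ^ n
  -- v`. If `z ^ b` kills `w ^ n v`, so does `w ^ b`, by `pow_toEnd_pow_apply`.
  have key : ∀ a : ℕ, ∀ v : V, (LieModule.toEnd ℂ L V x ^ a) v = 0 →
      ∃ n : ℕ, (LieModule.toEnd ℂ L V w ^ n) v = 0 := by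
    intro a
    induction a with
    | zero => exact fun v hv => ⟨0, hv⟩
    | succ a ih =>
      intro v hv
      rw [pow_succ, Module.End.mul_apply] at hv
      obtain ⟨n, hn⟩ := ih _ hv
      rw [← Module.End.mul_apply, ← (hcomm.pow_right n).eq, Module.End.mul_apply] at hn
      obtain ⟨b, hb⟩ := hz ((LieModule.toEnd ℂ L V w ^ n) v)
      obtain ⟨_, c, hc, h⟩ := pow_toEnd_pow_apply hw hxw hn b
      rw [hb, map_zero, eq_comm, ← Nat.cast_smul_eq_nsmul ℂ,
        smul_eq_zero_iff_right (Nat.cast_ne_zero.mpr hc), ← Module.End.mul_apply, ← pow_add] at h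
      exact ⟨b + n, h⟩
  intro v
  obtain ⟨a, ha⟩ := hx v
  exact key a v ha

end AdPow

/-! ### Root vectors of the untwisted affine algebra -/

section Root

variable {N : ℕ}

/-- The root vectors `E_{p,q} f(ξ)`. -/
def root {p q : Fin N} (h : p ≠ q) : Laurent →ₗ[ℂ] AffQ N where
  toFun f := Aff.ofLoop ⟨Matrix.single p q f, Matrix.trace_single_eq_of_ne _ _ _ h⟩
  map_add' f f' := by
    refine Aff.ext_mat ?_ (add_zero (0 : ℂ)).symm
    exact Matrix.single_add _ _ _ _
  map_smul' a f := by
    refine Aff.ext_mat ?_ (mul_zero a).symm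
    change Matrix.single p q (a • f) = a • Matrix.single p q f
    rw [Matrix.smul_single]

theorem mat_root {p q : Fin N} (h : p ≠ q) (f : Laurent) :
    (root h f).mat = Matrix.single p q f := rfl

theorem snd_root {p q : Fin N} (h : p ≠ q) (f : Laurent) : (root h f).2 = 0 := rfl

theorem root_lie_root_of_ne {p q r : Fin N} (hpq : p ≠ q) (hqr : q ≠ r) (hpr : p ≠ r)
    (f f' : Laurent) : ⁅root hpq f, root hqr f'⁆ = root hpr (f * f') := by
  refine Aff.ext_mat ?_ ?_
  · rw [Aff.mat_lie, mat_root, mat_root, mat_root, Matrix.single_mul_single_same,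
      Matrix.single_mul_single_of_ne _ _ _ _ hpr.symm, sub_zero]
  · rw [Aff.snd_lie, mat_root, mat_root, resPairing_single_left,
      Matrix.single_apply_of_col_ne _ _ hpr.symm, mul_zero, HahnSeries.coeff_zero, mul_zero,
      snd_root]

theorem root_lie_root_of_col_ne {p q r : Fin N} (hpq : p ≠ q) (hpr : p ≠ r) (f f' : Laurent) :
    ⁅root hpq f, root hpr f'⁆ = 0 := by
  refine Aff.ext_mat ?_ ?_
  · rw [Aff.mat_lie, mat_root, mat_root, Matrix.single_mul_single_of_ne _ _ _ _ hpq.symm,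
      Matrix.single_mul_single_of_ne _ _ _ _ hpr.symm, sub_zero, Aff.mat_zero]
  · rw [Aff.snd_lie, mat_root, mat_root, resPairing_single_left,
      Matrix.single_apply_of_row_ne hpq, mul_zero, HahnSeries.coeff_zero, mul_zero]
    rfl

theorem root_lie_root_lie_root {p q : Fin N} (hpq : p ≠ q) (f f' : Laurent) :
    ⁅root hpq f, ⁅root hpq f, root hpq.symm f'⁆⁆ = (-2 : ℂ) • root hpq (f * f' * f) := by
  have h1 : ⁅root hpq f, root hpq.symm f'⁆.mat =
      Matrix.single p p (f * f') - Matrix.single q q (f' * f) := by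
    rw [Aff.mat_lie, mat_root, mat_root, Matrix.single_mul_single_same,
      Matrix.single_mul_single_same]
  refine Aff.ext_mat ?_ ?_
  · rw [Aff.mat_lie, h1, mat_root, ← map_smul, mat_root, mul_sub, sub_mul,
      Matrix.single_mul_single_of_ne _ _ _ _ hpq.symm, Matrix.single_mul_single_same,
      Matrix.single_mul_single_same, Matrix.single_mul_single_of_ne _ _ _ _ hpq.symm, zero_sub,
      sub_zero]
    have e : (-2 : ℂ) • (f * f' * f) = -(f * (f' * f)) - f * f' * f := by
      rw [show f * (f' * f) = f * f' * f by ring]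
      ext n
      rw [HahnSeries.coeff_smul, HahnSeries.coeff_sub, HahnSeries.coeff_neg, smul_eq_mul]
      ring
    rw [e]
    ext1 i j
    by_cases h : p = i ∧ q = j <;> simp [h]
  · rw [Aff.snd_lie, h1, mat_root, resPairing_single_left, Matrix.sub_apply,
      Matrix.single_apply_of_row_ne hpq, Matrix.single_apply_of_col_ne _ _ hpq.symm, sub_zero,
      mul_zero, HahnSeries.coeff_zero, mul_zero, Aff.snd_smul, snd_root, mul_zero]

variable (V : Type*) [AddCommGroup V] [Module ℂ V] [LieRingModule (AffQ N) V]
  [LieModule ℂ (AffQ N) V]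

/-- The root vector `E_{p,q} ξ^m` acts locally nilpotently. -/
def RootNil (p q : Fin N) (m : ℤ) : Prop :=
  ∀ h : p ≠ q, LocNil (LieModule.toEnd ℂ (AffQ N) V (root h (HahnSeries.single m 1)))

variable {V}

theorem RootNil.add {p q r : Fin N} {m n : ℤ} (h1 : RootNil V p q m) (h2 : RootNil V q r n)
    (hpq : p ≠ q) (hqr : q ≠ r) : RootNil V p r (m + n) := fun hpr => by
  refine locNil_ad_pow (d := 1) (h1 hpq) (h2 hqr) ?_ (root_lie_root_of_col_ne hpq hpr _ _)
  rw [pow_one, LieAlgebra.ad_apply, root_lie_root_of_ne hpq hqr hpr, HahnSeries.single_mul_single,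
    mul_one]

/-- Bracketing `E_{q,p} ξ^n` twice with `E_{p,q} ξ^m` gives `-2 E_{p,q} ξ^(2m+n)`: a reflection of
real roots without exponentiating operators. -/
theorem RootNil.reflect {p q : Fin N} {m n : ℤ} (h1 : RootNil V p q m) (h2 : RootNil V q p n) :
    RootNil V p q (m + n + m) := fun hpq => by
  have := locNil_ad_pow (d := 2) (h1 hpq) (h2 hpq.symm) rfl
    (ad_single_pow_three hpq (mat_root hpq (HahnSeries.single m 1)) _)
  have e : ((LieAlgebra.ad ℂ (AffQ N) (root hpq (HahnSeries.single m 1))) ^ 2)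
      (root hpq.symm (HahnSeries.single n 1)) =
      (-2 : ℂ) • root hpq (HahnSeries.single (m + n + m) 1) := by
    rw [pow_two, Module.End.mul_apply, LieAlgebra.ad_apply, LieAlgebra.ad_apply,
      root_lie_root_lie_root, HahnSeries.single_mul_single, HahnSeries.single_mul_single, mul_one,
      mul_one]
  rw [e, map_smul] at this
  have := this.smul (-2 : ℂ)⁻¹
  rwa [smul_smul, inv_mul_cancel₀ (by norm_num), one_smul] at this

variable [N.AtLeastTwo] {k : ℂ}

theorem IsIntegrableHighestWeight.rootNil_e (hV : IsIntegrableHighestWeight N k V) (i : Fin N) :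
    RootNil V (i - 1) i (if i = 0 then 1 else 0) := fun _ => hV.nilpotent_e i

theorem IsIntegrableHighestWeight.rootNil_f (hV : IsIntegrableHighestWeight N k V) (i : Fin N) :
    RootNil V i (i - 1) (if i = 0 then -1 else 0) := fun _ => hV.nilpotent_f i

/-- Induction on the height `d + 1` of the root, by bracketing with the simple root vectors of
degree zero. -/
theorem IsIntegrableHighestWeight.rootNil_zero (hV : IsIntegrableHighestWeight N k V) (d : ℕ) :
    ∀ p q : Fin N, p.val + (d + 1) = q.val → RootNil V p q 0 ∧ RootNil V q p 0 := by
  have hstep : ∀ p q : Fin N, p.val + 1 = q.val → RootNil V p q 0 ∧ RootNil V q p 0 := by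
    intro p q hpq
    have hq : q ≠ 0 := by rintro rfl; simp at hpq
    have hp : q - 1 = p := by
      rw [sub_eq_iff_eq_add]
      refine Fin.ext ?_
      rw [Fin.val_add, Fin.val_one', Nat.add_mod_mod, hpq, Nat.mod_eq_of_lt q.2]
    have h1 := hV.rootNil_e q
    have h2 := hV.rootNil_f q
    rw [if_neg hq, hp] at h1 h2
    exact ⟨h1, h2⟩
  induction d with
  | zero => exact hstep
  | succ d ih =>
    intro p q hpq
    have hr : p.val + (d + 1) < N := by have := q.2; omega
    obtain ⟨h1, h2⟩ := ih p ⟨p.val + (d + 1), hr⟩ rfl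
    obtain ⟨h3, h4⟩ := hstep ⟨p.val + (d + 1), hr⟩ q (by simp only; omega)
    have n1 : p ≠ ⟨p.val + (d + 1), hr⟩ := fun h => by
      have := congrArg Fin.val h; simp only at this; omega
    have n2 : (⟨p.val + (d + 1), hr⟩ : Fin N) ≠ q := fun h => by
      have := congrArg Fin.val h; simp only at this; omega
    exact ⟨by simpa using h1.add h3 n1 n2, by simpa using h4.add h2 n2.symm n1.symm⟩

/-- Between the last index `α` and 0, the degrees 0 and `±1` come from the finite roots, `e_0`,
`f_0` and reflections. Further reflections move the degree by 2 in both directions, and brackets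
with root vectors of degree zero reach all other pairs of indices. -/
theorem IsIntegrableHighestWeight.rootNil (hV : IsIntegrableHighestWeight N k V) (p q : Fin N)
    (m : ℤ) : RootNil V p q m := by
  have h0 : ∀ p q : Fin N, RootNil V p q 0 := by
    intro p q hpq
    rcases lt_or_gt_of_ne hpq with h | h
    · exact (hV.rootNil_zero (q.val - p.val - 1) p q (by omega)).1 hpq
    · exact (hV.rootNil_zero (p.val - q.val - 1) q p (by omega)).2 hpq
  have hα : (0 - 1 : Fin N) ≠ 0 := sub_one_ne 0
  set α : Fin N := 0 - 1
  have hZ : ∀ m, RootNil V α 0 m ∧ RootNil V 0 α m := by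
    have e1 : RootNil V α 0 1 := by
      have := hV.rootNil_e 0
      rwa [if_pos rfl] at this
    have f1 : RootNil V 0 α (-1) := by
      have := hV.rootNil_f 0
      rwa [if_pos rfl] at this
    have e2 : RootNil V 0 α 1 := by simpa using (h0 0 α).reflect e1
    have f2 : RootNil V α 0 (-1) := by simpa using (h0 α 0).reflect f1
    have up : ∀ n, RootNil V α 0 n ∧ RootNil V 0 α n →
        RootNil V α 0 (n + 2) ∧ RootNil V 0 α (n + 2) := fun n hn => by
      rw [show n + 2 = 1 + n + 1 by ring]
      exact ⟨e1.reflect hn.2, e2.reflect hn.1⟩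
    have down : ∀ n, RootNil V α 0 n ∧ RootNil V 0 α n →
        RootNil V α 0 (n - 2) ∧ RootNil V 0 α (n - 2) := fun n hn => by
      rw [show n - 2 = -1 + n + -1 by ring]
      exact ⟨f2.reflect hn.2, f1.reflect hn.1⟩
    have pos : ∀ n : ℕ, (RootNil V α 0 n ∧ RootNil V 0 α n) ∧
        (RootNil V α 0 (n + 1) ∧ RootNil V 0 α (n + 1)) := by
      intro n
      induction n with
      | zero => exact ⟨by simpa using ⟨h0 α 0, h0 0 α⟩, by simpa using ⟨e1, e2⟩⟩
      | succ n ih =>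
        refine ⟨by simpa using ih.2, ?_⟩
        have := up _ ih.1
        rwa [show ((n + 1 : ℕ) : ℤ) + 1 = n + 2 by push_cast; ring]
    have neg : ∀ n : ℕ, (RootNil V α 0 (-n) ∧ RootNil V 0 α (-n)) ∧
        (RootNil V α 0 (-n - 1) ∧ RootNil V 0 α (-n - 1)) := by
      intro n
      induction n with
      | zero => exact ⟨by simpa using ⟨h0 α 0, h0 0 α⟩, by simpa using ⟨f2, f1⟩⟩
      | succ n ih =>
        refine ⟨?_, ?_⟩
        · rw [show -((n + 1 : ℕ) : ℤ) = -n - 1 by push_cast; ring]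
          exact ih.2
        · have := down _ ih.1
          rwa [show -((n + 1 : ℕ) : ℤ) - 1 = -n - 2 by push_cast; ring]
    intro m
    obtain ⟨n, rfl | rfl⟩ := m.eq_nat_or_neg
    · exact (pos n).1
    · exact (neg n).1
  have hrow : ∀ q m, RootNil V α q m := by
    intro q m hq
    by_cases h : q = 0
    · subst h; exact (hZ m).1 hq
    · have := (hZ m).1.add (h0 0 q) hα (Ne.symm h)
      rw [add_zero] at this
      exact this hq
  have hcol : ∀ p m, RootNil V p α m := by
    intro p m hp
    by_cases h : p = 0
    · subst h; exact (hZ m).2 hp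
    · have := (h0 p 0).add (hZ m).2 h hα.symm
      rw [zero_add] at this
      exact this hp
  intro hpq
  by_cases hp : p = α
  · subst hp; exact hrow q m hpq
  by_cases hq : q = α
  · subst hq; exact hcol p m hpq
  have := (hcol p m).add (h0 α q) hp (Ne.symm hq)
  rw [add_zero] at this
  exact this hpq

/-- All root vectors `E_{p,q} f(ξ)` act locally nilpotently on integrable modules. -/
theorem IsIntegrableHighestWeight.locNil_root (hV : IsIntegrableHighestWeight N k V) {p q : Fin N}
    (hpq : p ≠ q) (f : Laurent) : LocNil (LieModule.toEnd ℂ (AffQ N) V (root hpq f)) := by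
  have hcomm : ∀ f f' : Laurent, Commute (LieModule.toEnd ℂ (AffQ N) V (root hpq f))
      (LieModule.toEnd ℂ (AffQ N) V (root hpq f')) := by
    intro f f'
    have := LieHom.map_lie (LieModule.toEnd ℂ (AffQ N) V) (root hpq f) (root hpq f')
    rw [root_lie_root_of_col_ne, map_zero, LieRing.of_associative_ring_bracket, eq_comm,
      sub_eq_zero] at this
    exact this
  intro w
  obtain ⟨v, _, _, hpos, _, hspan⟩ := hV.exists_highestWeightVector
  obtain ⟨r, hr⟩ := exists_killedFrom ⟨1, fun x hx hx' => hpos x ⟨hx, fun p q m hm =>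
    hx' p q m (by rcases hm with h | h <;> omega)⟩⟩ hspan w
  obtain ⟨s, _, hs⟩ := exists_ordGE f
  -- The part of `f` below order `r`: a finite sum of commuting locally nilpotent operators. The
  -- tail `f - t` kills `w` at once.
  set t : Laurent := ∑ m ∈ Finset.Ico s (r : ℤ), f.coeff m • HahnSeries.single m 1 with ht
  have htail : OrdGE r (f - t) := by
    intro n hn
    rw [HahnSeries.coeff_sub, sub_eq_zero, ht, HahnSeries.coeff_sum]
    have : ∀ m, (f.coeff m • HahnSeries.single m (1 : ℂ)).coeff n =
        if n = m then f.coeff m else 0 := by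
      intro m
      split_ifs with h
      · subst h; simp
      · rw [HahnSeries.coeff_smul, HahnSeries.coeff_single_of_ne h, smul_zero]
    rw [Finset.sum_congr rfl fun m _ => this m, Finset.sum_ite_eq]
    split_ifs with h
    · rfl
    · rw [Finset.mem_Ico, not_and_or, not_le] at h
      exact hs n (by omega)
  have h1 : LieModule.toEnd ℂ (AffQ N) V (root hpq f) = LieModule.toEnd ℂ (AffQ N) V (root hpq t) +
      LieModule.toEnd ℂ (AffQ N) V (root hpq (f - t)) := by
    rw [← map_add, ← map_add, add_sub_cancel]
  have h2 : LocNil (LieModule.toEnd ℂ (AffQ N) V (root hpq t)) := by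
    have : ∀ m, LieModule.toEnd ℂ (AffQ N) V (root hpq (f.coeff m • HahnSeries.single m 1)) =
        f.coeff m • LieModule.toEnd ℂ (AffQ N) V (root hpq (HahnSeries.single m 1)) := fun m => by
      rw [map_smul, map_smul]
    rw [ht, map_sum, map_sum]
    refine locNil_sum _ (fun m _ => ?_) fun m _ n _ => hcomm _ _
    rw [this]
    exact (hV.rootNil p q m hpq).smul _
  obtain ⟨n, hn⟩ := h2 w
  refine ⟨n + 1, ?_⟩
  rw [h1]
  refine add_pow_apply_eq_zero (hcomm _ _) hn ?_
  rw [pow_one]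
  refine hr _ (snd_root hpq _) fun i j => ?_
  rw [mat_root]
  by_cases h : p = i ∧ q = j
  · obtain ⟨rfl, rfl⟩ := h
    rw [Matrix.single_apply_same]
    exact htail
  · rw [Matrix.single_apply_of_ne _ _ _ _ _ h]
    exact ordGE_zero _

end Root

/-! ### Subspaces which pair a highest weight module with zero -/

section Pairing

variable {N : ℕ} [N.AtLeastTwo] {g : Fin N} {ζ : ℂˣ}

theorem matOrdGE_single {r : ℤ} {p q : Fin N} {f : Laurent} (hf : OrdGE r f) :
    MatOrdGE r (Matrix.single p q f) := fun i j => by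
  by_cases h : p = i ∧ q = j
  · obtain ⟨rfl, rfl⟩ := h
    rw [Matrix.single_apply_same]
    exact hf
  · rw [Matrix.single_apply_of_ne _ _ _ _ _ h]
    exact ordGE_zero _

variable {V : Type*} [AddCommGroup V] [Module ℂ V]
  [LieRingModule (Aff (twistedLoop N ζ) (1 / N)) V] [LieModule ℂ (Aff (twistedLoop N ζ) (1 / N)) V]
  {v : V} {μ : Module.Dual ℂ (cartan (twistedLoop N ζ) (1 / N))}

/-- Elements `E_{p,p+g} (ξ + ⋯)` act on the vectors `f_p ^ n v` like the simple root vectors. -/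
theorem IsHighestWeight.raise_lowering_pow (h : IsHighestWeight v μ) (hζ : IsTwist g ζ)
    (hg : g ≠ 0) {x : Aff (twistedLoop N ζ) (1 / N)} (hx : x.2 = 0) {p : Fin N} {F : Laurent}
    (hmat : x.mat = Matrix.single p (p + g) F) (hF : OrdGE 1 F) (hF1 : F.coeff 1 = 1) (n : ℕ) :
    LieModule.toEnd ℂ (Aff (twistedLoop N ζ) (1 / N)) V x ((lowering V hζ p ^ (n + 1)) v) =
      ((n + 1) * (corootValue hζ μ p - n) : ℂ) • (lowering V hζ p ^ n) v := by
  have hpq : p ≠ p + g := by simpa [eq_comm] using hg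
  set q := p + g with hq
  have hfmat : (letter hζ q (-1)).mat = Matrix.single q p (HahnSeries.single (-1) 1) := by
    rw [mat_letter, letterMat_of_ne _ (smul_ne_zero_of_eq hg (Or.inr rfl)), neg_smul, one_smul,
      hq, add_neg_cancel_right]
  -- `⁅x, f_p⁆` is the coroot with `G = 1 + ⋯` in place of 1 in its diagonal entries.
  set G : Laurent := F * HahnSeries.single (-1) 1 with hG
  have hGc : ∀ m, G.coeff m = F.coeff (m + 1) := fun m => by
    have := HahnSeries.coeff_mul_single_add (x := F) (r := (1 : ℂ)) (a := m + 1) (b := -1)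
    rwa [mul_one, show m + 1 + -1 = m by ring] at this
  have hymat : ⁅x, letter hζ q (-1)⁆.mat = Matrix.single p p G - Matrix.single q q G := by
    rw [Aff.mat_lie, hmat, hfmat, Matrix.single_mul_single_same, Matrix.single_mul_single_same,
      mul_comm (HahnSeries.single (-1) (1 : ℂ)) F]
  have hysnd : ⁅x, letter hζ q (-1)⁆.2 = 1 / N := by
    rw [Aff.snd_lie, hmat, hfmat, resPairing_single_left, Matrix.single_apply_same]
    have := HahnSeries.coeff_mul_single_add (x := LaurentSeries.derivative ℂ F) (r := (1 : ℂ))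
      (a := 0) (b := -1)
    rw [zero_add] at this
    rw [this, coeff_derivative, Int.cast_zero, zero_add, zero_add, hF1]
    ring
  have hG0 : OrdGE 1 (G - 1) := by
    intro m hm
    rw [HahnSeries.coeff_sub, hGc]
    rcases (show m ≤ 0 by omega).lt_or_eq with h0 | rfl
    · rw [hF _ (by omega), HahnSeries.coeff_one, if_neg h0.ne, sub_zero]
    · rw [zero_add, hF1, HahnSeries.coeff_one, if_pos rfl, sub_self]
  set y := ⁅x, letter hζ q (-1)⁆ with hy
  -- The deviation from the `sl₂` relation `[h, f] = -2 f`. It is a positive multiple of `E_{q,p}`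
  -- in the sense of orders, so it kills `v` and commutes with `f_p`, as `raise_pow_apply` requires.
  set z := ⁅y, letter hζ q (-1)⁆ + (2 : ℂ) • letter hζ q (-1) with hz
  set s : Laurent := HahnSeries.single (-1) 1 + HahnSeries.single (-1) 1 -
    (G * HahnSeries.single (-1) 1 + G * HahnSeries.single (-1) 1) with hs
  have hzmat : z.mat = Matrix.single q p s := by
    rw [hz, Aff.mat_add, Aff.mat_lie, Aff.mat_smul, hymat, hfmat, sub_mul, mul_sub,
      Matrix.single_mul_single_of_ne _ _ _ _ hpq, Matrix.single_mul_single_same,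
      Matrix.single_mul_single_same, Matrix.single_mul_single_of_ne _ _ _ _ hpq,
      mul_comm (HahnSeries.single (-1) (1 : ℂ)) G]
    ext i j n
    change (_ + (2 : ℂ) * _ : ℂ) = _
    by_cases h : q = i ∧ p = j
    · rw [← h.1, ← h.2]
      simp only [hs, Matrix.sub_apply, Matrix.zero_apply, Matrix.single_apply_same,
        HahnSeries.coeff_sub, HahnSeries.coeff_add, HahnSeries.coeff_zero]
      ring
    · simp [h]
  have hzsnd : z.2 = 0 := by
    rw [hz, Aff.snd_add, Aff.snd_smul, snd_letter, mul_zero, add_zero, Aff.snd_lie, hymat, hfmat,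
      resPairing_sub_left, resPairing_single_left, resPairing_single_left,
      Matrix.single_apply_of_row_ne hpq.symm, Matrix.single_apply_of_col_ne _ _ hpq, mul_zero,
      HahnSeries.coeff_zero, sub_zero, mul_zero]
  have hsord : OrdGE 1 s := by
    intro m hm
    rcases eq_or_ne m 0 with rfl | hm0
    -- The constant term is not controlled by the expansion of `F`; it vanishes because an
    -- off-diagonal position carries no degree zero coefficient in the twisted algebra.
    · by_contra hne
      have := hζ.eq_of_coeff_ne_zero z.1.2 (p := q) (q := p) (m := 0) (by
        change (z.mat q p).coeff 0 ≠ 0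
        rwa [hzmat, Matrix.single_apply_same])
      rw [zero_smul, add_zero] at this
      exact hpq this
    · have h1 := HahnSeries.coeff_mul_single_add (x := G) (r := (1 : ℂ)) (a := m + 1) (b := -1)
      rw [show m + 1 + -1 = m by ring, mul_one, hGc] at h1
      rw [hs, HahnSeries.coeff_sub, HahnSeries.coeff_add, HahnSeries.coeff_add, h1]
      rcases (show m ≤ -1 by omega).lt_or_eq with h0 | rfl
      · rw [hF _ (by omega), HahnSeries.coeff_single_of_ne h0.ne]
        ring
      · norm_num [hF1]
  have hzcomm : ⁅z, letter hζ q (-1)⁆ = 0 := by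
    refine Aff.ext_mat ?_ ?_
    · rw [Aff.mat_lie, hzmat, hfmat, Matrix.single_mul_single_of_ne _ _ _ _ hpq,
        Matrix.single_mul_single_of_ne _ _ _ _ hpq, sub_zero, Aff.mat_zero]
    · rw [Aff.snd_lie, hzmat, hfmat, resPairing_single_left,
        Matrix.single_apply_of_row_ne hpq.symm, mul_zero, HahnSeries.coeff_zero, mul_zero]
      rfl
  -- Up to the positive part, `y` is the simple coroot, which yields its eigenvalue on `v`.
  have hydiff : y - (letter hζ p 0 - letter hζ q 0) - (1 / N : ℂ) • khat _ _ ∈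
      nPlusTw N ζ (1 / N) := by
    refine mem_nPlusTw_of_ordGE ?_ ?_
    · rw [Aff.snd_sub, Aff.snd_sub, Aff.snd_sub, snd_letter, snd_letter, Aff.snd_smul, Aff.snd_khat,
        hysnd]
      ring
    · have : (y - (letter hζ p 0 - letter hζ q 0) - (1 / N : ℂ) • khat _ _).mat =
          Matrix.single p p (G - 1) - Matrix.single q q (G - 1) := by
        rw [Aff.mat_sub, Aff.mat_sub, Aff.mat_sub, Aff.mat_smul_khat, sub_zero, hymat, mat_letter,
          mat_letter, letterMat, letterMat, zero_smul, add_zero, add_zero, sub_sub_sub_cancel_right,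
          HahnSeries.single_zero_one]
        ext1 i j
        simp only [Matrix.sub_apply, Matrix.single_apply]
        split_ifs <;> ring
      rw [this]
      exact fun i j => (matOrdGE_single hG0 i j).sub (matOrdGE_single hG0 i j)
  have hxy : ∀ a b : Aff (twistedLoop N ζ) (1 / N),
      LieModule.toEnd ℂ _ V a * LieModule.toEnd ℂ _ V b -
        LieModule.toEnd ℂ _ V b * LieModule.toEnd ℂ _ V a = LieModule.toEnd ℂ _ V ⁅a, b⁆ :=
    fun a b => by rw [LieHom.map_lie]; rfl
  refine raise_pow_apply (f := lowering V hζ p) (H := LieModule.toEnd ℂ _ V y)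
    (G := LieModule.toEnd ℂ _ V z) (hxy _ _) ?_ ?_ ?_ ?_ ?_ n
  · have h1 := hxy y (letter hζ q (-1))
    rw [lowering, letterEnd, ← hq, h1, hz, map_add, map_smul, add_sub_cancel_right]
  · have h1 := hxy z (letter hζ q (-1))
    rw [hzcomm, map_zero, sub_eq_zero] at h1
    exact h1
  · exact h.pos _ (mem_nPlusTw_of_ordGE hx (hmat ▸ matOrdGE_single hF))
  · have h1 := h.pos _ hydiff
    rw [sub_lie, sub_lie, sub_lie, sub_sub, sub_eq_zero, smul_lie, h.khat_lie] at h1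
    rw [LieModule.toEnd_apply_apply, h1, ← letterEnd_apply, ← letterEnd_apply, h.letterEnd_zero,
      h.letterEnd_zero, corootValue]
    module
  · exact h.pos _ (mem_nPlusTw_of_ordGE hzsnd (hzmat ▸ matOrdGE_single hsord))

variable {U E : Type*} [AddCommGroup U] [Module ℂ U] [AddCommGroup E] [Module ℂ E]

/-- A pairing `B` of `V` and `U` modulo a subspace `O`, which is invariant under Lie algebra
elements whose action on `V` includes the principal basis and, for all `p`, elements
`E_{p,p+g} (ξ + ⋯)` whose action on `U` is locally nilpotent. -/
structure IsInvariantPairing (hζ : IsTwist g ζ) (B : V →ₗ[ℂ] U →ₗ[ℂ] E) (O : Submodule ℂ E) :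
    Prop where
  letter : ∀ p m, ∃ φ : Module.End ℂ U, ∀ a u, B ⁅letter hζ p m, a⁆ u + B a (φ u) ∈ O
  raise : ∀ p : Fin N, ∃ (x : Aff (twistedLoop N ζ) (1 / N)) (F : Laurent) (φ : Module.End ℂ U),
    x.2 = 0 ∧ x.mat = Matrix.single p (p + g) F ∧ OrdGE 1 F ∧ F.coeff 1 = 1 ∧ LocNil φ ∧
      ∀ a u, B ⁅x, a⁆ u + B a (φ u) ∈ O

variable {hζ : IsTwist g ζ} {B : V →ₗ[ℂ] U →ₗ[ℂ] E} {O : Submodule ℂ E}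

/-- The vectors which pair to zero with everything. -/
def IsInvariantPairing.radical (hB : IsInvariantPairing hζ B O) (h : IsHighestWeight v μ) :
    LieSubmodule ℂ (Aff (twistedLoop N ζ) (1 / N)) V where
  carrier := {a | ∀ u, B a u ∈ O}
  add_mem' ha hb u := by
    rw [map_add, LinearMap.add_apply]
    exact O.add_mem (ha u) (hb u)
  zero_mem' u := by
    rw [map_zero]
    exact O.zero_mem
  smul_mem' c a ha u := by
    rw [map_smul, LinearMap.smul_apply]
    exact O.smul_mem _ (ha u)
  lie_mem {x a} ha := by
    have hmem : ∀ w, w ∈ ⨅ u, O.comap (B.flip u) ↔ ∀ u, B w u ∈ O := fun w => by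
      simp only [Submodule.mem_iInf, Submodule.mem_comap, LinearMap.flip_apply]
    refine (hmem _).mp (h.lie_mem_of_letter hζ (fun p m w hw => (hmem _).mpr fun u => ?_) x
      ((hmem a).mpr ha))
    obtain ⟨φ, hφ⟩ := hB.letter p m
    exact (O.add_mem_iff_left ((hmem w).mp hw (φ u))).mp (hφ w u)

/-- Induction on the power `d` of `φ` killing `u`, for all `n` at once. Raising `f_p ^ (n+1) v`
gives a nonzero multiple of `f_p ^ n v`, and transferring the raising element to the other side
replaces `u` by `φ u`, killed by a smaller power. -/
theorem IsInvariantPairing.lowering_pow_mem (hB : IsInvariantPairing hζ B O)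
    (h : IsHighestWeight v μ) (hg : g ≠ 0) (p : Fin N) {n : ℕ}
    (hn : ∀ j : ℕ, n ≤ j → corootValue hζ μ p ≠ j) : (lowering V hζ p ^ n) v ∈ hB.radical h := by
  obtain ⟨x, F, φ, hx, hmat, hF, hF1, hφ, hinv⟩ := hB.raise p
  have hraise := h.raise_lowering_pow hζ hg hx hmat hF hF1
  have key : ∀ (d n : ℕ), (∀ j : ℕ, n ≤ j → corootValue hζ μ p ≠ j) → ∀ u, (φ ^ d) u = 0 →
      B ((lowering V hζ p ^ n) v) u ∈ O := by
    intro d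
    induction d with
    | zero =>
      intro n _ u hu
      rw [show u = 0 from hu, map_zero]
      exact O.zero_mem
    | succ d ih =>
      intro n hn u hu
      rw [pow_succ, Module.End.mul_apply] at hu
      have h1 := ih (n + 1) (fun j hj => hn j (by omega)) _ hu
      have h2 := (O.add_mem_iff_left h1).mp (hinv _ u)
      rw [← LieModule.toEnd_apply_apply ℂ, hraise, map_smul, LinearMap.smul_apply] at h2
      exact (O.smul_mem_iff (mul_ne_zero (Nat.cast_add_one_ne_zero n)
        (sub_ne_zero.mpr (hn n le_rfl)))).mp h2
  intro u
  obtain ⟨d, hd⟩ := hφ u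
  exact key d n hn u hd

theorem IsInvariantPairing.mem_of_not_dominant (hB : IsInvariantPairing hζ B O)
    (h : IsHighestWeight v μ) (hg : g ≠ 0) (hdom : ¬ ∀ p, ∃ m : ℕ, corootValue hζ μ p = m) (a : V)
    (u : U) : B a u ∈ O := by
  push Not at hdom
  obtain ⟨p, hp⟩ := hdom
  have hv : v ∈ hB.radical h := hB.lowering_pow_mem h hg p (n := 0) fun j _ => hp j
  have : a ∈ hB.radical h := h.eq_top hv ▸ LieSubmodule.mem_top a
  exact this u

end Pairing

theorem IsInvariantPairing.maxProperSubmodule_mem {N : ℕ} [N.AtLeastTwo] {g : Fin N} {ζ : ℂˣ}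
    {V : Type} [AddCommGroup V] [Module ℂ V] [LieRingModule (Aff (twistedLoop N ζ) (1 / N)) V]
    [LieModule ℂ (Aff (twistedLoop N ζ) (1 / N)) V] {v : V}
    {μ : Module.Dual ℂ (cartan (twistedLoop N ζ) (1 / N))} {U E : Type*} [AddCommGroup U]
    [Module ℂ U] [AddCommGroup E] [Module ℂ E] {hζ : IsTwist g ζ} {B : V →ₗ[ℂ] U →ₗ[ℂ] E}
    {O : Submodule ℂ E} (hB : IsInvariantPairing hζ B O) (h : IsHighestWeight v μ) (hg : g ≠ 0)
    (hgen : ∀ p q : Fin N, ∃ j : ℕ, q = p + j • g)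
    (hdom : ∀ p, ∃ m : ℕ, corootValue hζ μ p = m) {a : V}
    (ha : a ∈ maxProperSubmodule (Aff (twistedLoop N ζ) (1 / N)) V) (u : U) : B a u ∈ O := by
  refine h.maxProperSubmodule_le hζ hg hgen hdom (W := hB.radical h) (fun p => ?_) ha u
  obtain ⟨m, hm⟩ := hdom p
  -- The first exponent beyond the value `m` of the coroot.
  refine ⟨m + 1, hB.lowering_pow_mem h hg p fun j hj hj' => ?_⟩
  rw [hm, Nat.cast_inj] at hj'
  omega

/-! ### Locally nilpotent operators on tensor products -/

section Tensor

theorem LocNil.tensor {V W : Type*} [AddCommGroup V] [Module ℂ V] [AddCommGroup W] [Module ℂ W]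
    {f : Module.End ℂ V} {g : Module.End ℂ W} (hf : LocNil f) (hg : LocNil g) :
    LocNil (TensorProduct.map f LinearMap.id + TensorProduct.map LinearMap.id g) := by
  refine LocNil.add ?_ ?_ ?_
  · refine locNil_of_span (TensorProduct.span_tmul_eq_top ℂ V W) ?_
    rintro _ ⟨a, b, rfl⟩
    obtain ⟨n, hn⟩ := hf a
    exact ⟨n, by rw [show (LinearMap.id : Module.End ℂ W) = 1 from rfl, TensorProduct.map_pow,
      TensorProduct.map_tmul, hn, TensorProduct.zero_tmul]⟩
  · refine locNil_of_span (TensorProduct.span_tmul_eq_top ℂ V W) ?_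
    rintro _ ⟨a, b, rfl⟩
    obtain ⟨n, hn⟩ := hg b
    exact ⟨n, by rw [show (LinearMap.id : Module.End ℂ V) = 1 from rfl, TensorProduct.map_pow,
      TensorProduct.map_tmul, hn, TensorProduct.tmul_zero]⟩
  · rw [commute_iff_eq, Module.End.mul_eq_comp, Module.End.mul_eq_comp, ← TensorProduct.map_comp,
      ← TensorProduct.map_comp]
    rfl

theorem locNil_tensorAction {N L : ℕ} {M : Fin L → Type*} [∀ i, AddCommGroup (M i)]
    [∀ i, Module ℂ (M i)] [∀ i, LieRingModule (AffQ N) (M i)] [∀ i, LieModule ℂ (AffQ N) (M i)]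
    {x : Fin L → AffQ N} (hx : ∀ i, LocNil (LieModule.toEnd ℂ (AffQ N) (M i) (x i))) :
    LocNil (tensorAction N M x) := by
  refine locNil_sum _ (fun i _ => ?_) fun i _ j _ => ?_
  · refine locNil_of_span PiTensorProduct.span_tprod_eq_top ?_
    rintro _ ⟨a, rfl⟩
    obtain ⟨n, hn⟩ := hx i (a i)
    refine ⟨n, ?_⟩
    rw [← PiTensorProduct.map_pow, PiTensorProduct.map_tprod]
    refine MultilinearMap.map_coord_zero _ i ?_
    rw [Pi.pow_apply, Function.update_self, hn]
  · rw [commute_iff_eq, ← PiTensorProduct.map_mul, ← PiTensorProduct.map_mul]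
    congr 1
    funext l
    by_cases hi : l = i
    · subst hi
      by_cases hj : l = j
      · subst hj; rfl
      · rw [Function.update_of_ne hj]; rfl
    · rw [Function.update_of_ne hi]; rfl

end Tensor

/-! ### Meromorphic sections with prescribed germs -/

section Sections

theorem OrdGE.neg {r : ℤ} {f : Laurent} (hf : OrdGE r f) : OrdGE r (-f) := fun m hm => by
  rw [HahnSeries.coeff_neg, hf m hm, neg_zero]

/-- Each substitution of the equation into itself gains one order until `r` is reached. This bounds
expansions of rational functions without computing geometric series. -/
theorem ordGE_of_eq_add_mul {f a b : Laurent} {r : ℤ} (ha : OrdGE r a) (hb : OrdGE 1 b)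
    (h : f = a + b * f) : OrdGE r f := by
  obtain ⟨s, _, hs⟩ := exists_ordGE f
  have key : ∀ n : ℕ, OrdGE (min r (s + n)) f := by
    intro n
    induction n with
    | zero => exact hs.mono (by simp)
    | succ n ih =>
      rw [h]
      exact (ha.mono (min_le_left _ _)).add ((hb.mul ih).mono (by push_cast; omega))
  exact (key (r - s).toNat).mono (by omega)

variable {N L : ℕ} {z : Fin L → ℂ}

theorem X_mem_regularOutside : RatFunc.X ∈ regularOutside N z := fun w hw => by
  rw [RatFunc.denom_X] at hw
  simp at hw

theorem inv_X_mem_regularOutside : (RatFunc.X : RatFunc ℂ)⁻¹ ∈ regularOutside N z := fun w hw => by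
  have h := hw.dvd (RatFunc.denom_inv_dvd RatFunc.X_ne_zero)
  rw [RatFunc.num_X] at h
  exact Or.inl (by simpa using h)

theorem inv_pow_sub_mem_regularOutside (i : Fin L) :
    ((RatFunc.X : RatFunc ℂ) ^ N - algebraMap ℂ _ (z i ^ N))⁻¹ ∈ regularOutside N z := by
  intro w hw
  have h1 : ((RatFunc.X : RatFunc ℂ) ^ N - algebraMap ℂ _ (z i ^ N))⁻¹ =
      algebraMap _ _ 1 / algebraMap _ _ (Polynomial.X ^ N - Polynomial.C (z i ^ N)) := by
    rw [map_one, one_div, map_sub (algebraMap (Polynomial ℂ) _), map_pow (algebraMap (Polynomial ℂ) _),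
      RatFunc.algebraMap_X, RatFunc.algebraMap_C]
    rfl
  rw [h1] at hw
  have h := hw.dvd (RatFunc.denom_div_dvd _ _)
  exact Or.inr ⟨i, by simpa [sub_eq_zero] using h⟩

/-- `τ` is a coordinate of `ℙ¹` at `0` or `∞` with expansion `φ`, and `ψ` is the expansion at the
other one of these points. -/
structure IsCoordinate (z : Fin L → ℂ) (ζ : ℂˣ) (τ : RatFunc ℂ) (φ ψ : RatFunc ℂ →ₐ[ℂ] Laurent) :
    Prop where
  rotate : rotate N τ = algebraMap ℂ (RatFunc ℂ) ζ * τ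
  mem : τ ∈ regularOutside N z
  inv_mem : τ⁻¹ ∈ regularOutside N z
  expand : φ τ = HahnSeries.single 1 1
  expand_inv : ψ τ⁻¹ = HahnSeries.single 1 1

theorem isCoordinate_zero :
    IsCoordinate (N := N) z (eps N) RatFunc.X (expandAt 0) expandInfty where
  rotate := rotate_X N
  mem := X_mem_regularOutside
  inv_mem := inv_X_mem_regularOutside
  expand := by rw [expandAt_X, map_zero, zero_add]
  expand_inv := by
    rw [map_inv₀, expandInfty_X, HahnSeries.inv_single, neg_neg, inv_one]

theorem isCoordinate_infty :
    IsCoordinate (N := N) z (eps N)⁻¹ RatFunc.X⁻¹ expandInfty (expandAt 0) where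
  rotate := by
    rw [map_inv₀, rotate_X, mul_inv, ← map_inv₀, Units.val_inv_eq_inv_val]
  mem := inv_X_mem_regularOutside
  inv_mem := by
    rw [inv_inv]
    exact X_mem_regularOutside
  expand := (isCoordinate_zero (N := N) (z := z)).expand_inv
  expand_inv := by
    rw [inv_inv]
    exact (isCoordinate_zero (N := N) (z := z)).expand

variable {ζ : ℂˣ} {τ : RatFunc ℂ} {φ ψ : RatFunc ℂ →ₐ[ℂ] Laurent}

theorem IsCoordinate.ne_zero (hτ : IsCoordinate (N := N) z ζ τ φ ψ) : τ ≠ 0 := by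
  rintro rfl
  have h := hτ.expand
  rw [map_zero, eq_comm, HahnSeries.single_eq_zero_iff] at h
  exact one_ne_zero h

theorem IsCoordinate.zpow_mem (hτ : IsCoordinate (N := N) z ζ τ φ ψ) (m : ℤ) :
    τ ^ m ∈ regularOutside N z := by
  obtain ⟨n, rfl | rfl⟩ := m.eq_nat_or_neg
  · rw [zpow_natCast]
    exact pow_mem hτ.mem n
  · rw [zpow_neg, zpow_natCast, ← inv_pow]
    exact pow_mem hτ.inv_mem n

theorem IsCoordinate.rotate_zpow (hτ : IsCoordinate (N := N) z ζ τ φ ψ) (m : ℤ) :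
    OrbifoldWZW.rotate N (τ ^ m) = algebraMap ℂ (RatFunc ℂ) ((ζ ^ m : ℂˣ) : ℂ) * τ ^ m := by
  rw [map_zpow₀, hτ.rotate, mul_zpow, Units.val_zpow_eq_zpow_val, map_zpow₀]

theorem IsCoordinate.expand_zpow (hτ : IsCoordinate (N := N) z ζ τ φ ψ) (m : ℤ) :
    φ (τ ^ m) = HahnSeries.single m 1 := by
  rw [map_zpow₀, hτ.expand, ← RatFunc.single_zpow]

/-- The rational function `τ / (1 - c τ ^ N)`. -/
def pole (N : ℕ) (τ : RatFunc ℂ) (c : ℂ) : RatFunc ℂ := τ * (1 - algebraMap ℂ _ c * τ ^ N)⁻¹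

/-- For `τ = 1/t`, the choice `c = z_i^N` turns the denominator into a power of `t` times `t^N -
z_i^N`, so all new poles lie over `Q_i`. -/
theorem pole_infty_mem (i : Fin L) :
    pole N RatFunc.X⁻¹ (z i ^ N) ∈ regularOutside N z := by
  have h : pole N RatFunc.X⁻¹ (z i ^ N) = (RatFunc.X⁻¹ * RatFunc.X ^ N) *
      ((RatFunc.X : RatFunc ℂ) ^ N - algebraMap ℂ _ (z i ^ N))⁻¹ := by
    have hX : (RatFunc.X : RatFunc ℂ) ^ N ≠ 0 := pow_ne_zero _ RatFunc.X_ne_zero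
    have h1 : 1 - algebraMap ℂ _ (z i ^ N) * (RatFunc.X : RatFunc ℂ)⁻¹ ^ N =
        (RatFunc.X ^ N)⁻¹ * (RatFunc.X ^ N - algebraMap ℂ _ (z i ^ N)) := by
      rw [inv_pow, mul_sub, inv_mul_cancel₀ hX, mul_comm]
    rw [pole, h1, mul_inv, inv_inv, mul_assoc]
  rw [h]
  exact mul_mem (mul_mem inv_X_mem_regularOutside (pow_mem X_mem_regularOutside N))
    (inv_pow_sub_mem_regularOutside i)

theorem IsCoordinate.rotate_pole (hτ : IsCoordinate (N := N) z ζ τ φ ψ)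
    (hζN : ζ ^ N = 1) (c : ℂ) :
    OrbifoldWZW.rotate N (pole N τ c) = algebraMap ℂ _ (ζ : ℂ) * pole N τ c := by
  have h := hτ.rotate_zpow N
  rw [zpow_natCast, zpow_natCast, hζN, Units.val_one, map_one, one_mul] at h
  rw [pole, map_mul, map_inv₀, map_sub, map_one, map_mul, h, AlgHom.commutes, hτ.rotate, mul_assoc]

/-- For `τ = t` the choice is `c = z_i^{-N}`, which requires `z i ≠ 0`. -/
theorem pole_zero_mem (i : Fin L) (hz : z i ≠ 0) :
    pole N RatFunc.X (z i ^ N)⁻¹ ∈ regularOutside N z := by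
  have h : pole N RatFunc.X (z i ^ N)⁻¹ = algebraMap ℂ _ (-z i ^ N) *
      (RatFunc.X * ((RatFunc.X : RatFunc ℂ) ^ N - algebraMap ℂ _ (z i ^ N))⁻¹) := by
    have hc : algebraMap ℂ (RatFunc ℂ) (z i ^ N) ≠ 0 := by
      rw [Ne, map_eq_zero]
      exact pow_ne_zero _ hz
    have h1 : 1 - algebraMap ℂ _ (z i ^ N)⁻¹ * (RatFunc.X : RatFunc ℂ) ^ N =
        algebraMap ℂ _ (-z i ^ N)⁻¹ * (RatFunc.X ^ N - algebraMap ℂ _ (z i ^ N)) := by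
      rw [map_inv₀, map_inv₀, map_neg]
      field_simp
      ring
    rw [pole, h1, mul_inv, ← map_inv₀, inv_inv]
    ring
  rw [h]
  exact mul_mem (Subalgebra.algebraMap_mem _ _)
    (mul_mem X_mem_regularOutside (inv_pow_sub_mem_regularOutside i))

variable [N.AtLeastTwo] {g : Fin N}

theorem IsTwist.zpow_eq_one (hζ : IsTwist g ζ) {m : ℤ} (h : m • g = 0) : ζ ^ m = 1 := by
  rw [hζ 0 m, h, add_zero, sub_self, zpow_zero]

theorem trace_single_sub_scalar {R : Type*} [CommRing R] [Algebra ℂ R] (p : Fin N) (a : R) :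
    (Matrix.single p p a - Matrix.scalar (Fin N) (algebraMap ℂ R (1 / N) * a)).trace = 0 := by
  rw [Matrix.trace_sub, Matrix.trace_single_eq_same, Matrix.scalar_apply, Matrix.trace_diagonal,
    Finset.sum_const, Finset.card_univ, Fintype.card_fin, nsmul_eq_mul, ← mul_assoc,
    ← map_natCast (algebraMap ℂ R), ← map_mul, mul_one_div_cancel (NeZero.ne _), map_one, one_mul,
    sub_self]

/-- The principal basis of the Lie algebra of meromorphic sections without poles in `ℂˣ`. -/
def sectionLetter (hζ : IsTwist g ζ) (hτ : IsCoordinate (N := N) z ζ τ φ ψ) (p : Fin N) (m : ℤ) :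
    gOut N z :=
  ⟨Matrix.single p (p + m • g) (τ ^ m) - Matrix.scalar (Fin N)
    (algebraMap ℂ (RatFunc ℂ) (if m • g = 0 then 1 / (N : ℂ) else 0) * τ ^ m), by
    refine ⟨?_, ?_, fun i j => ?_⟩
    · by_cases h : m • g = 0
      · rw [if_pos h, h, add_zero, trace_single_sub_scalar]
      · rw [if_neg h, map_zero, zero_mul, map_zero, sub_zero,
          Matrix.trace_single_eq_of_ne _ _ _ (by simpa [eq_comm] using h)]
    · ext1 i j
      rw [Matrix.map_apply, adGamma_apply, Matrix.sub_apply, map_sub, mul_sub]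
      congr 1
      · by_cases h : p = i ∧ p + m • g = j
        · obtain ⟨rfl, rfl⟩ := h
          rw [Matrix.single_apply_same, hτ.rotate_zpow, hζ p m]
        · rw [Matrix.single_apply_of_ne _ _ _ _ _ h, map_zero, mul_zero]
      · rw [Matrix.scalar_apply]
        by_cases h : i = j
        · subst h
          rw [Matrix.diagonal_apply_eq, sub_self, zpow_zero, Units.val_one, map_one, one_mul,
            map_mul, AlgHom.commutes, hτ.rotate_zpow]
          by_cases hm : m • g = 0
          · rw [hζ.zpow_eq_one hm, Units.val_one, map_one, one_mul]
          · rw [if_neg hm, map_zero, zero_mul, zero_mul]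
        · rw [Matrix.diagonal_apply_ne _ h, map_zero, mul_zero]
    · rw [Matrix.sub_apply, Matrix.scalar_apply]
      refine sub_mem ?_ ?_
      · by_cases h : p = i ∧ p + m • g = j
        · obtain ⟨rfl, rfl⟩ := h
          rw [Matrix.single_apply_same]
          exact hτ.zpow_mem m
        · rw [Matrix.single_apply_of_ne _ _ _ _ _ h]
          exact zero_mem _
      · by_cases h : i = j
        · subst h
          rw [Matrix.diagonal_apply_eq]
          exact mul_mem (Subalgebra.algebraMap_mem _ _) (hτ.zpow_mem m)
        · rw [Matrix.diagonal_apply_ne _ h]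
          exact zero_mem _⟩

/-- The germs are exactly the letters, without higher terms, so invariance under `gOut` yields
invariance under the principal basis. -/
theorem map_sectionLetter (hζ : IsTwist g ζ) (hτ : IsCoordinate (N := N) z ζ τ φ ψ) (p : Fin N)
    (m : ℤ) : (sectionLetter hζ hτ p m).1.map φ = letterMat g p m := by
  rw [sectionLetter, letterMat, Matrix.map_sub _ (map_sub φ), Matrix.map_single, hτ.expand_zpow]
  congr 1
  rw [Matrix.scalar_apply, Matrix.diagonal_map (map_zero φ), Matrix.scalar_apply]
  congr 1
  funext i
  rw [map_mul, AlgHom.commutes, hτ.expand_zpow, algebraMap_laurent, HahnSeries.single_mul_single,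
    zero_add, mul_one]

/-- The form in which `ordGE_of_eq_add_mul` reads the expansion at the zero of `τ`. The denominator
is nonzero because its expansion there has constant term 1. -/
theorem IsCoordinate.pole_eq (hτ : IsCoordinate (N := N) z ζ τ φ ψ) (c : ℂ) :
    pole N τ c = τ + algebraMap ℂ _ c * τ ^ N * pole N τ c := by
  have hN : (N : ℤ) ≠ 0 := by exact_mod_cast NeZero.ne N
  have h : 1 - algebraMap ℂ _ c * τ ^ N ≠ 0 := by
    intro h
    have h1 := congrArg (fun f => (φ f).coeff 0) h
    have h2 := hτ.expand_zpow N
    rw [zpow_natCast] at h2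
    simp only [map_sub, map_one, map_mul, AlgHom.commutes, map_zero, HahnSeries.coeff_zero, h2,
      algebraMap_laurent, HahnSeries.single_mul_single, HahnSeries.coeff_sub] at h1
    rw [HahnSeries.coeff_one, if_pos rfl, HahnSeries.coeff_single_of_ne (by simpa using hN.symm)]
      at h1
    simp at h1
  have h1 : pole N τ c * (1 - algebraMap ℂ _ c * τ ^ N) = τ := by
    rw [pole, mul_assoc, inv_mul_cancel₀ h, mul_one]
  linear_combination h1

theorem IsCoordinate.ordGE_pole (hτ : IsCoordinate (N := N) z ζ τ φ ψ) (c : ℂ) :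
    OrdGE 1 (φ (pole N τ c)) ∧ (φ (pole N τ c)).coeff 1 = 1 := by
  have hN : 1 < N := Nat.AtLeastTwo.one_lt
  have h := congrArg φ (hτ.pole_eq c)
  have h2 := hτ.expand_zpow N
  rw [zpow_natCast] at h2
  rw [map_add, map_mul, map_mul, AlgHom.commutes, hτ.expand, h2, algebraMap_laurent,
    HahnSeries.single_mul_single, zero_add, mul_one] at h
  have h3 : OrdGE 1 (φ (pole N τ c)) :=
    ordGE_of_eq_add_mul (ordGE_single le_rfl _) (ordGE_single (by omega) c) h
  refine ⟨h3, ?_⟩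
  rw [h, HahnSeries.coeff_add, HahnSeries.coeff_single_same,
    ((ordGE_single (by omega : (1 : ℤ) ≤ N) c).mul h3) 1 (by norm_num), add_zero]

/-- Solved for inverse powers, the same equation has leading term `-c⁻¹ τ^{-(N-1)}`. It vanishes at
the opposite point because `N ≥ 2`. -/
theorem IsCoordinate.ordGE_pole_opposite (hτ : IsCoordinate (N := N) z ζ τ φ ψ) {c : ℂ}
    (hc : c ≠ 0) : OrdGE 1 (ψ (pole N τ c)) := by
  have hN : 1 < N := Nat.AtLeastTwo.one_lt
  have hc' : algebraMap ℂ (RatFunc ℂ) c ≠ 0 := by simpa using hc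
  have h1 : pole N τ c = -(algebraMap ℂ _ c⁻¹ * τ⁻¹ ^ (N - 1)) +
      algebraMap ℂ _ c⁻¹ * τ⁻¹ ^ N * pole N τ c := by
    have h0 := hτ.ne_zero
    have h2 := hτ.pole_eq c
    obtain ⟨n, hn⟩ : ∃ n, N = n + 1 := ⟨N - 1, by omega⟩
    have h3 : N - 1 = n := by omega
    rw [h3]
    generalize pole N τ c = χ at h2 ⊢
    rw [hn] at h2 ⊢
    have h4 : τ ^ (n + 1) ≠ 0 := pow_ne_zero _ h0
    rw [map_inv₀, inv_pow, inv_pow, ← mul_right_inj' (mul_ne_zero hc' h4)]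
    have h5 : τ ^ (n + 1) * (τ ^ n)⁻¹ = τ := by
      rw [pow_succ', mul_assoc, mul_inv_cancel₀ (pow_ne_zero _ h0), mul_one]
    have h6 := mul_inv_cancel₀ hc'
    have h7 := mul_inv_cancel₀ h4
    generalize algebraMap ℂ (RatFunc ℂ) c = C at *
    linear_combination -h2 + h6 * (τ ^ (n + 1) * (τ ^ n)⁻¹) + h5 -
      χ * (τ ^ (n + 1) * (τ ^ (n + 1))⁻¹) * h6 - χ * h7
  have h := congrArg ψ h1
  rw [map_add, map_neg, map_mul, map_mul, map_mul, map_pow, map_pow, AlgHom.commutes,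
    hτ.expand_inv, algebraMap_laurent, HahnSeries.single_pow, HahnSeries.single_pow, one_pow,
    one_pow, HahnSeries.single_mul_single, HahnSeries.single_mul_single] at h
  refine ordGE_of_eq_add_mul (OrdGE.neg (ordGE_single ?_ _)) (ordGE_single ?_ _) h
  · simp; omega
  · simp; omega

theorem matrix_single_mem_gOut {p : Fin N} (hζ : IsTwist g ζ) (hg : g ≠ 0) {χ : RatFunc ℂ}
    (h : χ ∈ regularOutside N z) (h' : rotate N χ = algebraMap ℂ _ (ζ : ℂ) * χ) :
    Matrix.single p (p + g) χ ∈ gOut N z := by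
  refine ⟨Matrix.trace_single_eq_of_ne _ _ _ (by simpa [eq_comm] using hg), ?_, fun i j => ?_⟩
  · ext1 i j
    rw [Matrix.map_apply, adGamma_apply]
    by_cases hij : p = i ∧ p + g = j
    · obtain ⟨rfl, rfl⟩ := hij
      have h1 := hζ p 1
      rw [one_smul, zpow_one] at h1
      rw [Matrix.single_apply_same, h', ← h1]
    · rw [Matrix.single_apply_of_ne _ _ _ _ _ hij, map_zero, mul_zero]
  · by_cases hij : p = i ∧ p + g = j
    · obtain ⟨rfl, rfl⟩ := hij
      rwa [Matrix.single_apply_same]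
    · rw [Matrix.single_apply_of_ne _ _ _ _ _ hij]
      exact zero_mem _

end Sections

/-! ### Verma modules -/

section Verma

variable {G : Type} [LieRing G] [LieAlgebra ℂ G]

/-- Submodules for a Lie algebra are stable under its universal enveloping algebra. -/
theorem Verma.smul_mem {n : Set G} {h : Submodule ℂ G} {μ : Module.Dual ℂ h}
    (W : LieSubmodule ℂ G (Verma n h μ)) (x : UniversalEnvelopingAlgebra ℂ G) {w : Verma n h μ}
    (hw : w ∈ W) : x • w ∈ W := by
  let S : Subalgebra ℂ (UniversalEnvelopingAlgebra ℂ G) :=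
    { carrier := {x | ∀ w ∈ W, x • w ∈ W}
      mul_mem' := fun {a b} ha hb w hw => by
        rw [mul_smul]
        exact ha _ (hb w hw)
      add_mem' := fun {a b} ha hb w hw => by
        rw [add_smul]
        exact add_mem (ha w hw) (hb w hw)
      algebraMap_mem' := fun c w hw => by
        rw [algebraMap_smul]
        exact W.smul_mem c hw }
  let j : G →ₗ⁅ℂ⁆ S :=
    { LinearMap.codRestrict (Subalgebra.toSubmodule S) (UniversalEnvelopingAlgebra.ι ℂ).toLinearMap
        (fun y w hw => W.lie_mem (x := y) hw) with
      map_lie' := fun {a b} => Subtype.ext (LieHom.map_lie (UniversalEnvelopingAlgebra.ι ℂ) a b) }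
  -- By the universal property, a subalgebra containing the image of `ι` is everything.
  have h1 : S.val.comp (UniversalEnvelopingAlgebra.lift ℂ j) = AlgHom.id ℂ _ := by
    apply UniversalEnvelopingAlgebra.hom_ext
    ext y
    change ((UniversalEnvelopingAlgebra.lift ℂ j (UniversalEnvelopingAlgebra.ι ℂ y) : S) :
      UniversalEnvelopingAlgebra ℂ G) = UniversalEnvelopingAlgebra.ι ℂ y
    rw [UniversalEnvelopingAlgebra.lift_ι_apply]
    rfl
  have h2 : x ∈ S := by
    rw [← AlgHom.id_apply (R := ℂ) x, ← h1]
    exact (UniversalEnvelopingAlgebra.lift ℂ j x).2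
  exact h2 w hw

/-- The generator of a Verma module. -/
def Verma.generator (n : Set G) (h : Submodule ℂ G) (μ : Module.Dual ℂ h) : Verma n h μ :=
  Submodule.Quotient.mk 1

theorem Verma.smul_generator {n : Set G} {h : Submodule ℂ G} {μ : Module.Dual ℂ h}
    (x : UniversalEnvelopingAlgebra ℂ G) :
    x • Verma.generator n h μ = Submodule.Quotient.mk (p := vermaIdeal n h μ) x := by
  change Submodule.Quotient.mk (p := vermaIdeal n h μ) (x • 1) = _
  rw [smul_eq_mul, mul_one]

theorem isHighestWeight_generator {N : ℕ} {ζ : ℂˣ}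
    (μ : Module.Dual ℂ (cartan (twistedLoop N ζ) (1 / N))) :
    IsHighestWeight (Verma.generator (nPlusTw N ζ (1 / N)) _ μ) μ where
  pos x hx := by
    change UniversalEnvelopingAlgebra.ι ℂ x • _ = _
    rw [Verma.smul_generator]
    exact (Submodule.Quotient.mk_eq_zero _).mpr (Submodule.subset_span (Or.inl ⟨x, hx, rfl⟩))
  weight x := by
    change UniversalEnvelopingAlgebra.ι ℂ _ • _ = _
    rw [← sub_eq_zero, ← algebraMap_smul
      (UniversalEnvelopingAlgebra ℂ (Aff (twistedLoop N ζ) (1 / N))) (μ x), ← sub_smul,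
      Verma.smul_generator]
    exact (Submodule.Quotient.mk_eq_zero _).mpr (Submodule.subset_span (Or.inr ⟨x, rfl⟩))
  span := by
    rw [eq_top_iff]
    rintro w -
    obtain ⟨x, rfl⟩ := Submodule.Quotient.mk_surjective _ w
    rw [← Verma.smul_generator]
    exact Verma.smul_mem _ x (LieSubmodule.subset_lieSpan rfl)

end Verma

/-! ### Dominant integral weights -/

section Dominant

variable {N : ℕ} [N.AtLeastTwo]

theorem coroot_eq {g : Fin N} {ζ : ℂˣ} (hζ : IsTwist g ζ) (σ : ℂ) (i : Fin N) :
    coroot ζ σ i = σ • (letter hζ (i - 1) 0 - letter hζ i 0) + (1 / N : ℂ) • khat _ _ := by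
  refine Aff.ext_mat ?_ ?_
  · rw [Aff.mat_add, Aff.mat_smul_khat, add_zero, Aff.mat_smul, Aff.mat_sub, mat_letter,
      mat_letter, letterMat, letterMat, sub_sub_sub_cancel_right, zero_smul, add_zero, add_zero]
    change σ • (hMat i).map (algebraMap ℂ Laurent) = _
    congr 1
    ext p q n
    rw [Matrix.map_apply, algebraMap_laurent, Matrix.sub_apply, HahnSeries.coeff_sub, hMat,
      Matrix.diagonal_apply, Matrix.single_apply, Matrix.single_apply]
    by_cases hpq : p = q
    · rw [← hpq, if_pos rfl]
      simp only [Pi.sub_apply, Pi.single_apply, eq_comm (a := p), and_self]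
      split_ifs <;> simp
    · rw [if_neg hpq, if_neg fun h => hpq (h.1.symm.trans h.2),
        if_neg fun h => hpq (h.1.symm.trans h.2)]
      simp
  · rw [Aff.snd_add, Aff.snd_smul, Aff.snd_smul, Aff.snd_sub, snd_letter, snd_letter, Aff.snd_khat]
    change (1 / N : ℂ) = _
    ring

theorem apply_coroot {g : Fin N} {ζ : ℂˣ} (hζ : IsTwist g ζ)
    (μ : Module.Dual ℂ (cartan (twistedLoop N ζ) (1 / N))) (σ : ℂ) (i : Fin N) :
    μ ⟨coroot ζ σ i, coroot_mem_cartan _ _ _⟩ =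
      σ * (letterWeight hζ μ (i - 1) - letterWeight hζ μ i) + level μ / N := by
  have h : (⟨coroot ζ σ i, coroot_mem_cartan _ _ _⟩ : cartan (twistedLoop N ζ) (1 / N)) =
      σ • (⟨letter hζ (i - 1) 0, letter_zero_mem_cartan hζ _⟩ -
        ⟨letter hζ i 0, letter_zero_mem_cartan hζ _⟩) +
        (1 / N : ℂ) • ⟨khat _ _, khat_mem_cartan⟩ := Subtype.ext (coroot_eq hζ σ i)
  rw [h, map_add, map_smul, map_sub, map_smul, level, letterWeight, letterWeight, smul_eq_mul,
    smul_eq_mul]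
  ring

/-- With `g = 1`, the coroot of index `i` involves the positions `i - 1` and `i`, hence corresponds
to `p = i - 1`. -/
theorem dominantIntegralZero_iff {μ : WeightZero N} :
    DominantIntegralZero μ ↔ ∀ p, ∃ m : ℕ, corootValue isTwist_zero μ p = m := by
  have h : ∀ i, μ ⟨coroot (eps N) 1 i, coroot_mem_cartan _ _ _⟩ =
      corootValue isTwist_zero μ (i - 1) := fun i => by
    rw [apply_coroot isTwist_zero, corootValue, sub_add_cancel, one_mul]
  refine ⟨fun hμ p => ?_, fun hμ i => h i ▸ hμ _⟩
  have := hμ (p + 1)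
  rwa [h, add_sub_cancel_right] at this

/-- With `g = -1`, the sign of the coroot reverses its two positions, so here `p = i` without a
shift. -/
theorem dominantIntegralInfty_iff {μ : WeightInfty N} :
    DominantIntegralInfty μ ↔ ∀ p, ∃ m : ℕ, corootValue isTwist_infty μ p = m := by
  have h : ∀ i, μ ⟨coroot (eps N)⁻¹ (-1) i, coroot_mem_cartan _ _ _⟩ =
      corootValue isTwist_infty μ i := fun i => by
    rw [apply_coroot isTwist_infty, corootValue, ← sub_eq_add_neg]
    ring
  simp only [DominantIntegralInfty, h]

theorem fin_one_ne_zero : (1 : Fin N) ≠ 0 := fun h => sub_one_ne (0 : Fin N) (by rw [h, sub_zero])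

end Dominant

/-! ### Coinvariants -/

section Pairings

variable {N L : ℕ} {z : Fin L → ℂ}
  {V₀ : Type*} [AddCommGroup V₀] [Module ℂ V₀] [LieRingModule (AffZero N) V₀]
  [LieModule ℂ (AffZero N) V₀]
  {M : Fin L → Type*} [∀ i, AddCommGroup (M i)] [∀ i, Module ℂ (M i)]
  [∀ i, LieRingModule (AffQ N) (M i)] [∀ i, LieModule ℂ (AffQ N) (M i)]
  {V₁ : Type*} [AddCommGroup V₁] [Module ℂ V₁] [LieRingModule (AffInfty N) V₁]
  [LieModule ℂ (AffInfty N) V₁]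

variable (V₀ M V₁) in
/-- The tensor product pairing of `V₀` with the other factors. -/
def pairingZero : V₀ →ₗ[ℂ] (⨂[ℂ] i, M i) ⊗[ℂ] V₁ →ₗ[ℂ] V₀ ⊗[ℂ] (⨂[ℂ] i, M i) ⊗[ℂ] V₁ :=
  (TensorProduct.mk ℂ V₀ ((⨂[ℂ] i, M i) ⊗[ℂ] V₁)).compr₂
    (TensorProduct.assoc ℂ V₀ (⨂[ℂ] i, M i) V₁).symm.toLinearMap

variable (V₀ M V₁) in
/-- The tensor product pairing of `V₁` with the other factors. -/
def pairingInfty : V₁ →ₗ[ℂ] V₀ ⊗[ℂ] (⨂[ℂ] i, M i) →ₗ[ℂ] V₀ ⊗[ℂ] (⨂[ℂ] i, M i) ⊗[ℂ] V₁ :=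
  (TensorProduct.mk ℂ (V₀ ⊗[ℂ] (⨂[ℂ] i, M i)) V₁).flip

theorem pairingZero_tmul (a : V₀) (m : ⨂[ℂ] i, M i) (b : V₁) :
    pairingZero V₀ M V₁ a (m ⊗ₜ b) = (a ⊗ₜ m) ⊗ₜ b := rfl

theorem pairingInfty_apply (b : V₁) (u : V₀ ⊗[ℂ] (⨂[ℂ] i, M i)) :
    pairingInfty V₀ M V₁ b u = u ⊗ₜ b := rfl

/-- Separates the germ at 0 from an operator on the other factors, the `φ` of `IsInvariantPairing`.
-/
theorem outAction_pairingZero (f : gOut N z) (a : V₀) (u : (⨂[ℂ] i, M i) ⊗[ℂ] V₁) :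
    outAction N z V₀ M V₁ f (pairingZero V₀ M V₁ a u) =
      pairingZero V₀ M V₁ ⁅germZero f, a⁆ u + pairingZero V₀ M V₁ a
        ((TensorProduct.map (tensorAction N M (germ f)) LinearMap.id +
          TensorProduct.map LinearMap.id (LieModule.toEnd ℂ (AffInfty N) V₁ (germInfty f)) :
          Module.End ℂ ((⨂[ℂ] i, M i) ⊗[ℂ] V₁)) u) := by
  induction u with
  | zero => simp only [map_zero, add_zero]
  | add u u' hu hu' =>
    rw [map_add, map_add, hu, hu', map_add, map_add, map_add]
    abel
  | tmul m b =>
    rw [LinearMap.add_apply, map_add, TensorProduct.map_tmul, TensorProduct.map_tmul]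
    simp only [pairingZero_tmul, outAction, LinearMap.add_apply, TensorProduct.map_tmul,
      LinearMap.id_apply, LieModule.toEnd_apply_apply]
    abel

theorem outAction_pairingInfty (f : gOut N z) (b : V₁) (u : V₀ ⊗[ℂ] (⨂[ℂ] i, M i)) :
    outAction N z V₀ M V₁ f (pairingInfty V₀ M V₁ b u) =
      pairingInfty V₀ M V₁ ⁅germInfty f, b⁆ u + pairingInfty V₀ M V₁ b
        ((TensorProduct.map (LieModule.toEnd ℂ (AffZero N) V₀ (germZero f)) LinearMap.id +
          TensorProduct.map LinearMap.id (tensorAction N M (germ f)) :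
          Module.End ℂ (V₀ ⊗[ℂ] (⨂[ℂ] i, M i))) u) := by
  simp only [pairingInfty_apply, outAction, LinearMap.add_apply, TensorProduct.map_tmul,
    LinearMap.id_apply, LieModule.toEnd_apply_apply, TensorProduct.add_tmul]
  abel

theorem outAction_mem (f : gOut N z) (x : V₀ ⊗[ℂ] (⨂[ℂ] i, M i) ⊗[ℂ] V₁) :
    outAction N z V₀ M V₁ f x ∈ outSubmodule N z V₀ M V₁ :=
  Submodule.mem_iSup_of_mem f ⟨x, rfl⟩

variable {V₀' : Type*} [AddCommGroup V₀'] [Module ℂ V₀'] [LieRingModule (AffZero N) V₀']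
  [LieModule ℂ (AffZero N) V₀'] {V₁' : Type*} [AddCommGroup V₁'] [Module ℂ V₁']
  [LieRingModule (AffInfty N) V₁'] [LieModule ℂ (AffInfty N) V₁']

theorem outAction_map (f : gOut N z) (π₀ : V₀ →ₗ⁅ℂ, AffZero N⁆ V₀')
    (π₁ : V₁ →ₗ⁅ℂ, AffInfty N⁆ V₁') (x : V₀ ⊗[ℂ] (⨂[ℂ] i, M i) ⊗[ℂ] V₁) :
    outAction N z V₀' M V₁' f (TensorProduct.map (TensorProduct.map (π₀ : V₀ →ₗ[ℂ] V₀')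
      LinearMap.id) (π₁ : V₁ →ₗ[ℂ] V₁') x) =
    TensorProduct.map (TensorProduct.map (π₀ : V₀ →ₗ[ℂ] V₀') LinearMap.id) (π₁ : V₁ →ₗ[ℂ] V₁')
      (outAction N z V₀ M V₁ f x) := by
  have h₀ : LieModule.toEnd ℂ (AffZero N) V₀' (germZero f) ∘ₗ (π₀ : V₀ →ₗ[ℂ] V₀') =
      (π₀ : V₀ →ₗ[ℂ] V₀') ∘ₗ LieModule.toEnd ℂ (AffZero N) V₀ (germZero f) :=
    LinearMap.ext fun a => (LieModuleHom.map_lie π₀ _ a).symm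
  have h₁ : LieModule.toEnd ℂ (AffInfty N) V₁' (germInfty f) ∘ₗ (π₁ : V₁ →ₗ[ℂ] V₁') =
      (π₁ : V₁ →ₗ[ℂ] V₁') ∘ₗ LieModule.toEnd ℂ (AffInfty N) V₁ (germInfty f) :=
    LinearMap.ext fun a => (LieModuleHom.map_lie π₁ _ a).symm
  rw [← LinearMap.comp_apply, ← LinearMap.comp_apply (g := outAction N z V₀ M V₁ f)]
  congr 1
  simp only [outAction, LinearMap.add_comp, LinearMap.comp_add, ← TensorProduct.map_comp,
    LinearMap.id_comp, LinearMap.comp_id, h₀, h₁]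

/-- Quotients of the outer modules by submodules which pair to zero with everything do not change
the coinvariants. -/
theorem exists_coinvariants_equiv {W₀ : LieSubmodule ℂ (AffZero N) V₀}
    {W₁ : LieSubmodule ℂ (AffInfty N) V₁}
    (h₀ : ∀ a ∈ W₀, ∀ u, pairingZero V₀ M V₁ a u ∈ outSubmodule N z V₀ M V₁)
    (h₁ : ∀ b ∈ W₁, ∀ u, pairingInfty V₀ M V₁ b u ∈ outSubmodule N z V₀ M V₁) :
    ∃ e : CCorb N z V₀ M V₁ ≃ₗ[ℂ] CCorb N z (V₀ ⧸ W₀) M (V₁ ⧸ W₁),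
      ∀ x, e (Submodule.Quotient.mk x) = Submodule.Quotient.mk
        (TensorProduct.map (TensorProduct.map
          (LieSubmodule.Quotient.mk' W₀ : V₀ →ₗ[ℂ] V₀ ⧸ W₀) LinearMap.id)
          (LieSubmodule.Quotient.mk' W₁ : V₁ →ₗ[ℂ] V₁ ⧸ W₁) x) := by
  set π₀ := (LieSubmodule.Quotient.mk' W₀ : V₀ →ₗ[ℂ] V₀ ⧸ W₀) with hπ₀
  set π₁ := (LieSubmodule.Quotient.mk' W₁ : V₁ →ₗ[ℂ] V₁ ⧸ W₁) with hπ₁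
  set q := TensorProduct.map (TensorProduct.map π₀ (LinearMap.id : (⨂[ℂ] i, M i) →ₗ[ℂ] _)) π₁
    with hq
  have hs₀ : Function.Surjective π₀ := LieSubmodule.Quotient.surjective_mk' W₀
  have hs₁ : Function.Surjective π₁ := LieSubmodule.Quotient.surjective_mk' W₁
  have hs := TensorProduct.map_surjective hs₀
    (g' := (LinearMap.id : (⨂[ℂ] i, M i) →ₗ[ℂ] ⨂[ℂ] i, M i)) Function.surjective_id
  have hqs : Function.Surjective q := TensorProduct.map_surjective hs hs₁
  have he₀ : Function.Exact (W₀ : Submodule ℂ V₀).subtype π₀ := fun a =>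
    (LieSubmodule.Quotient.mk_eq_zero W₀).trans (by simp)
  have he₁ : Function.Exact (W₁ : Submodule ℂ V₁).subtype π₁ := fun a =>
    (LieSubmodule.Quotient.mk_eq_zero W₁).trans (by simp)
  -- By right exactness, the kernel is spanned by tensors with a factor in `W₀` or in `W₁`, which
  -- the hypotheses place in `outSubmodule`.
  have hker : LinearMap.ker q ≤ outSubmodule N z V₀ M V₁ := by
    have he : Function.Exact (LinearMap.rTensor (⨂[ℂ] i, M i) (W₀ : Submodule ℂ V₀).subtype)
        (TensorProduct.map π₀ LinearMap.id) := rTensor_exact _ he₀ hs₀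
    rw [hq, TensorProduct.map_ker he hs he₁ hs₁, sup_le_iff]
    constructor
    · rintro _ ⟨x, rfl⟩
      induction x with
      | zero => rw [map_zero]; exact zero_mem _
      | add x y hx hy => rw [map_add]; exact add_mem hx hy
      | tmul u b => exact h₁ b.1 b.2 u
    · rintro _ ⟨x, rfl⟩
      induction x with
      | zero => rw [map_zero]; exact zero_mem _
      | add x y hx hy => rw [map_add]; exact add_mem hx hy
      | tmul u b =>
        induction u with
        | zero => rw [TensorProduct.zero_tmul, map_zero]; exact zero_mem _
        | add x y hx hy => rw [TensorProduct.add_tmul, map_add]; exact add_mem hx hy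
        | tmul a m => exact h₀ a.1 a.2 (m ⊗ₜ b)
  -- The action of each section commutes with the surjection `q`, so the ranges correspond.
  have hmap : (outSubmodule N z V₀ M V₁).map q = outSubmodule N z (V₀ ⧸ W₀) M (V₁ ⧸ W₁) := by
    rw [outSubmodule, outSubmodule, Submodule.map_iSup]
    congr 1
    funext f
    ext y
    constructor
    · rintro ⟨_, ⟨x, rfl⟩, rfl⟩
      exact ⟨q x, outAction_map f _ _ x⟩
    · rintro ⟨y, rfl⟩
      obtain ⟨x, rfl⟩ := hqs y
      exact ⟨_, ⟨x, rfl⟩, (outAction_map f _ _ x).symm⟩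
  have hcomap : (outSubmodule N z (V₀ ⧸ W₀) M (V₁ ⧸ W₁)).comap q = outSubmodule N z V₀ M V₁ := by
    rw [← hmap, Submodule.comap_map_eq, sup_eq_left.mpr hker]
  refine ⟨LinearEquiv.ofBijective (Submodule.mapQ _ _ q hcomap.ge) ⟨?_, ?_⟩, fun x => rfl⟩
  · rw [← LinearMap.ker_eq_bot, Submodule.ker_mapQ, hcomap, Submodule.mkQ_map_self]
  · intro y
    obtain ⟨y, rfl⟩ := Submodule.Quotient.mk_surjective _ y
    obtain ⟨x, rfl⟩ := hqs y
    exact ⟨Submodule.Quotient.mk x, rfl⟩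

variable [N.AtLeastTwo]

theorem germZero_sectionLetter (p : Fin N) (m : ℤ) :
    germZero (sectionLetter isTwist_zero (isCoordinate_zero (z := z)) p m) =
      letter isTwist_zero p m :=
  Aff.ext_mat (map_sectionLetter _ isCoordinate_zero p m) rfl

theorem germInfty_sectionLetter (p : Fin N) (m : ℤ) :
    germInfty (sectionLetter isTwist_infty (isCoordinate_infty (z := z)) p m) =
      letter isTwist_infty p m :=
  Aff.ext_mat (map_sectionLetter _ isCoordinate_infty p m) rfl

theorem locNil_germ {k : ℂ} (hM : ∀ i, IsIntegrableHighestWeight N k (M i)) {p q : Fin N}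
    (hpq : p ≠ q) {f : gOut N z} {χ : RatFunc ℂ} (hf : f.1 = Matrix.single p q χ) :
    LocNil (tensorAction N M (germ f)) := by
  refine locNil_tensorAction fun i => ?_
  have h : germ f i = root hpq (expandAt (z i) χ) :=
    Aff.ext_mat (by
      change f.1.map (expandAt (z i)) = _
      rw [hf, Matrix.map_single, mat_root]) rfl
  rw [h]
  exact (hM i).locNil_root hpq _

/-- Elements `E_{p,q} F` with `F` vanishing at the marked point act locally nilpotently on highest
weight modules. -/
theorem IsHighestWeight.locNil {ζ : ℂˣ} {V : Type*} [AddCommGroup V] [Module ℂ V]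
    [LieRingModule (Aff (twistedLoop N ζ) (1 / N)) V]
    [LieModule ℂ (Aff (twistedLoop N ζ) (1 / N)) V] {v : V}
    {μ : Module.Dual ℂ (cartan (twistedLoop N ζ) (1 / N))} (h : IsHighestWeight v μ)
    {x : Aff (twistedLoop N ζ) (1 / N)} (hx : x.2 = 0) {p q : Fin N} (hpq : p ≠ q) {F : Laurent}
    (hmat : x.mat = Matrix.single p q F) (hF : OrdGE 1 F) :
    LocNil (LieModule.toEnd ℂ (Aff (twistedLoop N ζ) (1 / N)) V x) := by
  refine locNil_of_generator (ad_single_pow_three hpq hmat) ⟨1, ?_⟩ h.span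
  rw [pow_one]
  exact h.pos x (mem_nPlusTw_of_ordGE hx (hmat ▸ matOrdGE_single hF))

-- A single point `Q_i` supplies the raising sections `E_{p,p+1} χ`. Being off-diagonal, they act
-- nilpotently on the integrable factors whatever their poles, and vanishing at ∞ gives nilpotency
-- on the highest weight module there. Nilpotency is needed only on these factors, so `V₀` may be
-- any module.
variable (V₀) in
theorem isInvariantPairing_zero {k : ℂ} (hM : ∀ i, IsIntegrableHighestWeight N k (M i)) (i : Fin L)
    (hz : z i ≠ 0) {v : V₁} {μ : WeightInfty N} (h : IsHighestWeight v μ) :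
    IsInvariantPairing (isTwist_zero (N := N)) (pairingZero V₀ M V₁) (outSubmodule N z V₀ M V₁) where
  letter p m := ⟨_, fun a u => by
    rw [← germZero_sectionLetter (z := z), ← outAction_pairingZero]
    exact outAction_mem _ _⟩
  raise p := by
    have hp : p ≠ p + 1 := by simpa using fin_one_ne_zero
    have hζ : eps N ^ N = 1 := (eps_isPrimitiveRoot N).pow_eq_one
    let f : gOut N z := ⟨_, matrix_single_mem_gOut (p := p) isTwist_zero fin_one_ne_zero
      (pole_zero_mem i hz) (isCoordinate_zero.rotate_pole (z := z) hζ _)⟩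
    have hc : (z i ^ N)⁻¹ ≠ 0 := inv_ne_zero (pow_ne_zero _ hz)
    refine ⟨germZero f, _, _, rfl, Matrix.map_single _ _ _ _,
      ((isCoordinate_zero (z := z)).ordGE_pole _).1, ((isCoordinate_zero (z := z)).ordGE_pole _).2,
      (locNil_germ (f := f) hM hp rfl).tensor (h.locNil (x := germInfty f) rfl hp (Matrix.map_single _ _ _ _)
        ((isCoordinate_zero (z := z)).ordGE_pole_opposite hc)), fun a u => ?_⟩
    rw [← outAction_pairingZero]
    exact outAction_mem _ _

-- The mirror image, with coordinate `1/t` and shift `-1`: the raising sections now vanish to first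
-- order at ∞, and the highest weight module at 0 needs only that they vanish there.
variable (V₁) in
theorem isInvariantPairing_infty {k : ℂ} (hM : ∀ i, IsIntegrableHighestWeight N k (M i)) (i : Fin L)
    (hz : z i ≠ 0) {v : V₀} {μ : WeightZero N} (h : IsHighestWeight v μ) :
    IsInvariantPairing (isTwist_infty (N := N)) (pairingInfty V₀ M V₁) (outSubmodule N z V₀ M V₁) where
  letter p m := ⟨_, fun a u => by
    rw [← germInfty_sectionLetter (z := z), ← outAction_pairingInfty]
    exact outAction_mem _ _⟩
  raise p := by
    have h1 : (-1 : Fin N) ≠ 0 := neg_ne_zero.mpr fin_one_ne_zero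
    have hp : p ≠ p + -1 := by simpa using h1
    have hζ : (eps N)⁻¹ ^ N = 1 := by
      rw [inv_pow, (eps_isPrimitiveRoot N).pow_eq_one, inv_one]
    let f : gOut N z := ⟨_, matrix_single_mem_gOut (p := p) isTwist_infty h1
      (pole_infty_mem i) (isCoordinate_infty.rotate_pole (z := z) hζ _)⟩
    refine ⟨germInfty f, _, _, rfl, Matrix.map_single _ _ _ _,
      ((isCoordinate_infty (z := z)).ordGE_pole _).1,
      ((isCoordinate_infty (z := z)).ordGE_pole _).2,
      (h.locNil (x := germZero f) rfl hp (Matrix.map_single _ _ _ _)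
        ((isCoordinate_infty (z := z)).ordGE_pole_opposite (pow_ne_zero _ hz))).tensor
        (locNil_germ (f := f) hM hp rfl), fun a u => ?_⟩
    rw [← outAction_pairingInfty]
    exact outAction_mem _ _

end Pairings

end OrbifoldWZW

end

/-! ### The vanishing and comparison of coinvariants -/

open OrbifoldWZW TensorProduct in
theorem mainTheorem4 (N : ℕ) [N.AtLeastTwo] (L : ℕ) (hL : 1 ≤ L)
    (z : Fin L → ℂ) (hz : ∀ i, z i ≠ 0) (hzz : ∀ i j, i ≠ j → z i ^ N ≠ z j ^ N)
    (k : ℂ)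
    (M : Fin L → Type*) [∀ i, AddCommGroup (M i)] [∀ i, Module ℂ (M i)]
    [∀ i, LieRingModule (AffQ N) (M i)] [∀ i, LieModule ℂ (AffQ N) (M i)]
    (hM : ∀ i, IsIntegrableHighestWeight N k (M i))
    (μ₀ : WeightZero N) (μ₁ : WeightInfty N) (hμ₀ : level μ₀ = k) (hμ₁ : level μ₁ = k) :
    (¬ (DominantIntegralZero μ₀ ∧ DominantIntegralInfty μ₁) →
      Subsingleton (CCorb N z (VermaZero μ₀) M (VermaInfty μ₁))) ∧
    (DominantIntegralZero μ₀ → DominantIntegralInfty μ₁ →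
      ∃ e : CCorb N z (VermaZero μ₀) M (VermaInfty μ₁) ≃ₗ[ℂ]
          CCorb N z (IrrZero μ₀) M (IrrInfty μ₁),
        ∀ x : VermaZero μ₀ ⊗[ℂ] (⨂[ℂ] i, M i) ⊗[ℂ] VermaInfty μ₁,
          e (Submodule.Quotient.mk x) =
            Submodule.Quotient.mk
              (TensorProduct.map
                (TensorProduct.map
                  (LieSubmodule.Quotient.mk' (maxProperSubmodule (AffZero N) (VermaZero μ₀)) :
                    VermaZero μ₀ →ₗ[ℂ] IrrZero μ₀)
                  LinearMap.id)
                (LieSubmodule.Quotient.mk' (maxProperSubmodule (AffInfty N) (VermaInfty μ₁)) :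
                  VermaInfty μ₁ →ₗ[ℂ] IrrInfty μ₁)
                x)) := by
  have h₀ := isHighestWeight_generator μ₀
  have h₁ := isHighestWeight_generator μ₁
  have hB₀ := isInvariantPairing_zero (VermaZero μ₀) hM ⟨0, hL⟩ (hz _) h₁
  have hB₁ := isInvariantPairing_infty (VermaInfty μ₁) hM ⟨0, hL⟩ (hz _) h₀
  have hg : (-1 : Fin N) ≠ 0 := neg_ne_zero.mpr fin_one_ne_zero
  refine ⟨fun hdom => ?_, fun hdom₀ hdom₁ => ?_⟩
  · rw [Submodule.Quotient.subsingleton_iff, eq_top_iff, ← TensorProduct.span_tmul_eq_top,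
      Submodule.span_le]
    rintro _ ⟨u, b, rfl⟩
    rcases not_and_or.mp hdom with hdom | hdom
    · rw [dominantIntegralZero_iff] at hdom
      -- The factor at 0 sits inside `u`, so `u` is split into pure tensors before the pairing at 0
      -- applies; at ∞ the factor `b` is already separate.
      induction u with
      | zero => rw [TensorProduct.zero_tmul]; exact zero_mem _
      | add x y hx hy => rw [TensorProduct.add_tmul]; exact add_mem hx hy
      | tmul a m => exact hB₀.mem_of_not_dominant h₀ fin_one_ne_zero hdom a (m ⊗ₜ b)
    · rw [dominantIntegralInfty_iff] at hdom
      exact hB₁.mem_of_not_dominant h₁ hg hdom b u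
  · rw [dominantIntegralZero_iff] at hdom₀
    rw [dominantIntegralInfty_iff] at hdom₁
    exact exists_coinvariants_equiv
      (fun a ha u => hB₀.maxProperSubmodule_mem h₀ fin_one_ne_zero exists_add_nsmul_one hdom₀ ha u)
      (fun b hb u => hB₁.maxProperSubmodule_mem h₁ hg exists_add_nsmul_neg_one hdom₁ hb u)
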